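/- Let $M$ be a smooth (Hausdorff) manifold of dimension $n>2$ with a conformal structure of any signature, i.e. a class of smooth pseudo-Riemannian metrics given up to multiplication by positive smooth functions, and let $\mathcal G\to M$ be its bundle of metrics, with fibres $\mathcal G_x=\{s^2g_x : s>0\}$. A conformal density of weight $w\in\mathbb Z$ is a smooth function $\sigma$ on $\mathcal G$ with $\sigma(s^2b)=s^w\sigma(b)$ for $s>0$; a conformal scale is a nowhere vanishing density $\tau$ of weight $1$. Let $g_\tau=\tau^{-2}g_0$ ($g_0$ the tautological form on $\mathcal G$) be its metric, $\nabla_\tau$ its Levi-Civita connection, with $\nabla_\tau\tau=0$, $$P_\tau=\frac1{n-2}\Big(\mathrm{Ric}_\tau-\frac{\mathrm{Sc}_\tau\,g_\tau}{2(n-1)}\Big)$$ its Schouten tensor, $\operatorname{div}_\tau P_\tau$ the covector $g_\tau^{jk}\nabla_kP_{ij}$, and $\operatorname{div}_\tau^2P_\tau$ the scalar divergence of that covector. Let $\mathcal T$ be the standard tractor bundle, of rank $n+2$, with tractor metric $k$ and canonical section $X$ of weight $1$. A scale $\tau$ determines a frame $X,\ Z_\tau,\ Y_\tau$ in which $k(X,Y_\tau)=1$,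 $k(Z_\tau,Z_\tau)=g_\tau$, all other products vanish, and the tractor connection coupled to $\nabla_\tau$ is $$\nabla_\tau X=Z_\tau,\qquad \nabla_\tau Z_\tau=-P_\tau X-g_\tau Y_\tau,\qquad \nabla_\tau Y_\tau=g_\tau^{-1}(Z_\tau)\cdot P_\tau .$$ If $\hat\tau=\Omega^{-1}\tau$ and $\Upsilon=\Omega^{-1}d\Omega$, then $Z_{\hat\tau}=Z_\tau+\Upsilon X$ and $Y_{\hat\tau}=Y_\tau-g_\tau^{-1}(\Upsilon,Z_\tau)-\tfrac12g_\tau^{-1}(\Upsilon,\Upsilon)X$. On sections $V$ of weight $w$ of a density or tractor bundle, the tractor $D$-operator, computed in a background scale $\tau$ of the conformal class, is $$DV=(n+2w-2)\,w\,Y_\tau\otimes V+(n+2w-2)\,g_\tau^{-1}(Z_\tau,\nabla_\tau V)-X\otimes(\Delta_\tau+w\operatorname{tr}_{g_\tau}P_\tau)V .$$ Two densities $\sigma_1,\sigma_2$ of equal weight osculate at $x\in M$ if $\sigma_1=\sigma_2$, $D\sigma_1=D\sigma_2$ and $D^2\sigma_1=D^2\sigma_2$ at $x$. **Theorem.** Let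 $x\in M$. For conformal scales $\tau_1,\tau_2$, consider the following four conditions at the point $x$: $$\tau_1=\tau_2,\qquad P_{\tau_1}=P_{\tau_2},\qquad \operatorname{div}_{\tau_1}P_{\tau_1}=\operatorname{div}_{\tau_2}P_{\tau_2},\qquad \operatorname{div}^2_{\tau_1}P_{\tau_1}=\operatorname{div}^2_{\tau_2}P_{\tau_2}. \tag{$*$}$$ Whichever background scale of the conformal class is used to compute $D$, the following hold. 1. If $\tau_1$ and $\tau_2$ osculate at $x$, then $(*)$ holds. 2. The conditions are not sufficient: for every scale $\tau_1$ there is a scale $\tau_2$ that satisfies $(*)$ but does not osculate with $\tau_1$ at $x$. 3. If $D\tau_1=D\tau_2$ at $x$, then $Y_{\tau_1}=Y_{\tau_2}$ at $x$; and $\tau_1,\tau_2$ osculate at $x$ if and only if $(*)$ holds and $Y_{\tau_1}=Y_{\tau_2}$ at $x$. 4. This $Y$ tractor is an additional $n$-dimensional affine degree of freedom: for every scale $\tau_1$, the tractors $Y_{\tau_2}(x)$ of all scales $\tau_2$ satisfying $(*)$ are exactly the null tractors $W$ of weight $-1$ at $x$ with $k(X,W)=1$, and $$\Upsilon\longmapsto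 Y_{\tau_1}-g^{-1}(\Upsilon,Z_{\tau_1})-\tfrac12g^{-1}(\Upsilon,\Upsilon)X$$ (with $g^{-1}$ the weighted inverse conformal metric) is a bijection from $T_x^*M$ onto the set of these tractors. -/

import Mathlib

open scoped Manifold ContDiff

noncomputable section

namespace ConformalOsculation

/-! ### Pseudo-Riemannian metrics in charts -/

section Metrics

variable {n : ℕ} {M : Type*} [TopologicalSpace M] [ChartedSpace (EuclideanSpace ℝ (Fin n)) M]

/-- Bilinear forms on the tangent space `T_x M`. -/
abbrev TangentForm (n : ℕ) {M : Type*} [TopologicalSpace M]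
    [ChartedSpace (EuclideanSpace ℝ (Fin n)) M] (x : M) : Type :=
  LinearMap.BilinForm ℝ (TangentSpace (𝓡 n) x)

/-- The `i`-th coordinate vector field of the chart `e`, at the point with coordinates `y`. -/
def coordVector (e : OpenPartialHomeomorph M (EuclideanSpace ℝ (Fin n)))
    (y : EuclideanSpace ℝ (Fin n)) (i : Fin n) : TangentSpace (𝓡 n) (e.symm y) :=
  mfderiv (𝓡 n) (𝓡 n) e.symm y (EuclideanSpace.single i (1 : ℝ) : EuclideanSpace ℝ (Fin n))

/-- The component matrix, in the chart `e`, of a field of bilinear forms. -/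
def coordMatrix (e : OpenPartialHomeomorph M (EuclideanSpace ℝ (Fin n)))
    (b : ∀ x : M, TangentForm n x) (y : EuclideanSpace ℝ (Fin n)) : Matrix (Fin n) (Fin n) ℝ :=
  Matrix.of fun i j => b (e.symm y) (coordVector e y i) (coordVector e y j)

/-- A smooth pseudo-Riemannian metric (of arbitrary signature) on the `n`-manifold `M`. Smoothness
means smoothness of the components in every chart of the smooth structure. -/
structure PseudoRiemannianMetric (n : ℕ) (M : Type*) [TopologicalSpace M]
    [ChartedSpace (EuclideanSpace ℝ (Fin n)) M] where
  /-- the form on each tangent space -/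
  form : ∀ x : M, TangentForm n x
  symm : ∀ (x : M) (v w : TangentSpace (𝓡 n) x), form x v w = form x w v
  nondegenerate : ∀ (x : M) (v : TangentSpace (𝓡 n) x),
    (∀ w : TangentSpace (𝓡 n) x, form x v w = 0) → v = 0
  smooth : ∀ e ∈ IsManifold.maximalAtlas (𝓡 n) ∞ M, ∀ i j : Fin n,
    ContDiffOn ℝ ∞ (fun y => coordMatrix e form y i j) e.target

end Metrics

/-! ### Levi-Civita connection and curvature of a coordinate metric

Here `G` is the component matrix of a metric, a function of the coordinates `y`. -/

section Curvature

variable {n : ℕ}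

/-- The coordinate derivative `∂_i F`. -/
def pd {F : Type*} [NormedAddCommGroup F] [NormedSpace ℝ F] (i : Fin n)
    (f : EuclideanSpace ℝ (Fin n) → F) (y : EuclideanSpace ℝ (Fin n)) : F :=
  fderiv ℝ f y (EuclideanSpace.single i (1 : ℝ))

variable (G : EuclideanSpace ℝ (Fin n) → Matrix (Fin n) (Fin n) ℝ)

/-- Christoffel symbols of the Levi-Civita connection; `christoffel G y k i j` is `Γ^k_{ij}`. -/
def christoffel (y : EuclideanSpace ℝ (Fin n)) (k i j : Fin n) : ℝ :=
  (1 / 2) * ∑ l, (G y)⁻¹ k l *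
    (pd i (fun z => G z j l) y + pd j (fun z => G z i l) y - pd l (fun z => G z i j) y)

/-- The Ricci tensor (positive on round spheres). -/
def ricci (y : EuclideanSpace ℝ (Fin n)) (j k : Fin n) : ℝ :=
  ∑ i, (pd i (fun z => christoffel G z i j k) y - pd k (fun z => christoffel G z i i j) y
    + ∑ m, (christoffel G y i i m * christoffel G y m j k
      - christoffel G y i k m * christoffel G y m i j))

/-- The scalar curvature. -/
def scalarCurvature (y : EuclideanSpace ℝ (Fin n)) : ℝ :=
  ∑ i, ∑ j, (G y)⁻¹ i j * ricci G y i j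

/-- The Schouten tensor `P = (Ric - Sc g / (2 (n - 1))) / (n - 2)`. -/
def schouten (y : EuclideanSpace ℝ (Fin n)) (i j : Fin n) : ℝ :=
  (1 / ((n : ℝ) - 2)) * (ricci G y i j - scalarCurvature G y * G y i j / (2 * ((n : ℝ) - 1)))

/-- The trace of the Schouten tensor. -/
def schoutenTrace (y : EuclideanSpace ℝ (Fin n)) : ℝ :=
  ∑ i, ∑ j, (G y)⁻¹ i j * schouten G y i j

/-- The divergence `g^{jk} ∇_k T_{ij}` of a covariant `2`-tensor `T`. -/
def divTwoTensor (T : EuclideanSpace ℝ (Fin n) → Fin n → Fin n → ℝ)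
    (y : EuclideanSpace ℝ (Fin n)) (i : Fin n) : ℝ :=
  ∑ j, ∑ k, (G y)⁻¹ j k * (pd k (fun z => T z i j) y
    - ∑ l, (christoffel G y l k i * T y l j + christoffel G y l k j * T y i l))

/-- The divergence `g^{ij} ∇_i α_j` of a covector field `α`. -/
def divCovector (α : EuclideanSpace ℝ (Fin n) → Fin n → ℝ) (y : EuclideanSpace ℝ (Fin n)) : ℝ :=
  ∑ i, ∑ j, (G y)⁻¹ i j * (pd i (fun z => α z j) y - ∑ k, christoffel G y k i j * α y k)

/-- The covector `div P`. -/
def divSchouten (y : EuclideanSpace ℝ (Fin n)) (i : Fin n) : ℝ :=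
  divTwoTensor G (schouten G) y i

/-- The scalar `div² P = div (div P)`. -/
def divDivSchouten (y : EuclideanSpace ℝ (Fin n)) : ℝ :=
  divCovector G (divSchouten G) y

end Curvature

/-! ### Tractors in the frame of a background scale

A metric `g` of the conformal class and a chart give the frame `X, Z_1, …, Z_n, Y` of the tractor
bundle, and `g` trivializes all density bundles by a parallel section. The triple `(s, μ, r)` stands
for the tractor `s X + ∑ i, μ i Z_i + r Y`. The same triples, with entries in the fibre `F` of a
bundle `V`, stand for elements of the tensor product of the tractor bundle with `V`. The tractor
bundle is identified with its dual by the tractor metric. -/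

section Tractors

variable {n : ℕ}

/-- Triples of coefficients of `X`, of `Z_1, …, Z_n` and of `Y`. -/
abbrev TractorTensor (n : ℕ) (F : Type*) : Type _ := F × (Fin n → F) × F

/-- Tractors. -/
abbrev Tractor (n : ℕ) : Type := TractorTensor n ℝ

/-- The tractor `X`. -/
def tractorX (n : ℕ) : Tractor n := (1, 0, 0)

variable (G : EuclideanSpace ℝ (Fin n) → Matrix (Fin n) (Fin n) ℝ)

/-- The tractor metric `k`, determined by `k(X, Y) = 1` and `k(Z_i, Z_j) = g_{ij}`, all other
products of frame elements being `0`. -/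
def tractorMetric (y : EuclideanSpace ℝ (Fin n)) (V W : Tractor n) : ℝ :=
  V.1 * W.2.2 + V.2.2 * W.1 + ∑ i, ∑ j, G y i j * V.2.1 i * W.2.1 j

/-- A connection form: for every point and every coordinate direction an endomorphism of the
fibre. -/
abbrev ConnectionForm (n : ℕ) (F : Type*) : Type _ := EuclideanSpace ℝ (Fin n) → Fin n → F → F

/-- The connection form of the density bundles, in the trivialization by the background scale. -/
def densityConnection (n : ℕ) : ConnectionForm n ℝ := fun _ _ _ => 0

/-- The connection form of the (weighted) tractor bundle coupled to the Levi-Civita connection of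
the background scale: `∇_j X = Z_j`, `∇_j Z_i = Γ^k_{ji} Z_k - P_{ji} X - g_{ji} Y` and
`∇_j Y = g^{ik} P_{jk} Z_i`. -/
def tractorConnection : ConnectionForm n (Tractor n) := fun y j V =>
  (- ∑ i, schouten G y j i * V.2.1 i,
   fun i => (∑ k, christoffel G y i j k * V.2.1 k) + (if i = j then V.1 else 0)
     + (∑ k, (G y)⁻¹ i k * schouten G y j k) * V.2.2,
   - ∑ i, G y j i * V.2.1 i)

variable {F : Type*} [NormedAddCommGroup F] [NormedSpace ℝ F]

/-- The covariant derivative `∇_j V`. -/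
def covDeriv (A : ConnectionForm n F) (V : EuclideanSpace ℝ (Fin n) → F)
    (y : EuclideanSpace ℝ (Fin n)) (j : Fin n) : F :=
  pd j V y + A y j (V y)

/-- The Laplacian `Δ V = g^{ij} ∇_i ∇_j V`, where the Levi-Civita connection acts on the index
`j`. -/
def laplacian (A : ConnectionForm n F) (V : EuclideanSpace ℝ (Fin n) → F)
    (y : EuclideanSpace ℝ (Fin n)) : F :=
  ∑ i, ∑ j, (G y)⁻¹ i j • (covDeriv A (fun z => covDeriv A V z j) y i
    - ∑ k, christoffel G y k i j • covDeriv A V y k)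

/-- The tractor `D`-operator on sections of weight `w` of a bundle with connection form `A`,
`D V = (n + 2 w - 2) w Y ⊗ V + (n + 2 w - 2) g⁻¹(Z, ∇ V) - X ⊗ (Δ V + w tr(P) V)`. -/
def tractorD (A : ConnectionForm n F) (w : ℤ) (V : EuclideanSpace ℝ (Fin n) → F)
    (y : EuclideanSpace ℝ (Fin n)) : TractorTensor n F :=
  (- (laplacian G A V y + ((w : ℝ) * schoutenTrace G y) • V y),
   fun i => ((n : ℝ) + 2 * w - 2) • ∑ j, (G y)⁻¹ i j • covDeriv A V y j,
   (((n : ℝ) + 2 * w - 2) * w) • V y)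

end Tractors

/-! ### Conformal manifolds, densities and scales -/

section Conformal

variable {n : ℕ} {M : Type*} [TopologicalSpace M] [ChartedSpace (EuclideanSpace ℝ (Fin n)) M]

/-- A conformal structure on `M`, given by its ray bundle: the fibre over `x` consists of the
positive multiples of a metric at `x`. -/
structure ConformalStructure (n : ℕ) (M : Type*) [TopologicalSpace M]
    [ChartedSpace (EuclideanSpace ℝ (Fin n)) M] where
  /-- the fibre of the bundle of metrics in the conformal class -/
  ray : ∀ x : M, Set (TangentForm n x)
  exists_metric : ∃ g : PseudoRiemannianMetric n M, ∀ x : M,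
    ray x = {b | ∃ s : ℝ, 0 < s ∧ b = s ^ 2 • g.form x}

variable (c : ConformalStructure n M)

/-- The metric `g` belongs to the conformal class `c`. -/
def ConformalStructure.Compatible (g : PseudoRiemannianMetric n M) : Prop :=
  ∀ x : M, g.form x ∈ c.ray x

/-- A smooth conformal density of weight `w`: a function on the bundle of metrics of the conformal
class that is homogeneous of degree `w` under the dilations `b ↦ s² b`. -/
structure Density (w : ℤ) where
  /-- the function on the ray bundle -/
  toFun : ∀ x : M, c.ray x → ℝ
  homogeneous : ∀ (x : M) (b b' : c.ray x) (s : ℝ), 0 < s →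
    (b' : TangentForm n x) = s ^ 2 • (b : TangentForm n x) → toFun x b' = s ^ w * toFun x b
  smooth : ∀ (g : PseudoRiemannianMetric n M) (hg : c.Compatible g),
    ContMDiff (𝓡 n) 𝓘(ℝ, ℝ) ∞ fun x => toFun x ⟨g.form x, hg x⟩

/-- A conformal scale: a nowhere vanishing density of weight `1`. -/
structure Scale extends Density c 1 where
  ne_zero : ∀ (x : M) (b : c.ray x), toFun x b ≠ 0

variable {c}

/-- The function that represents a density in the trivialization by the metric `g`. -/
def Density.value {w : ℤ} (σ : Density c w) {g : PseudoRiemannianMetric n M}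
    (hg : c.Compatible g) (x : M) : ℝ :=
  σ.toFun x ⟨g.form x, hg x⟩

/-- The same function in the coordinates of the chart `e`. -/
def Density.coord {w : ℤ} (σ : Density c w) {g : PseudoRiemannianMetric n M}
    (hg : c.Compatible g) (e : OpenPartialHomeomorph M (EuclideanSpace ℝ (Fin n)))
    (y : EuclideanSpace ℝ (Fin n)) : ℝ :=
  σ.value hg (e.symm y)

theorem ConformalStructure.exists_compatible (c : ConformalStructure n M) :
    ∃ g : PseudoRiemannianMetric n M, c.Compatible g := by
  obtain ⟨g, hg⟩ := c.exists_metric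
  refine ⟨g, fun x => ?_⟩
  rw [hg x]
  exact ⟨1, one_pos, by simp⟩

/-- The metric `τ⁻² g₀` of the conformal scale `τ`, where `g₀` is the tautological form on the
ray bundle. -/
def Scale.form (τ : Scale c) (x : M) : TangentForm n x :=
  ((τ.value c.exists_compatible.choose_spec x) ^ 2)⁻¹ • c.exists_compatible.choose.form x

/-- The metric of a scale can be computed from any point of the ray. -/
theorem Scale.form_eq (τ : Scale c) (x : M) (b : c.ray x) :
    τ.form x = ((τ.toFun x b) ^ 2)⁻¹ • (b : TangentForm n x) := by
  obtain ⟨g, hg⟩ := c.exists_metric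
  have hd := c.exists_compatible.choose_spec x
  obtain ⟨s, hs, hbs⟩ : ∃ s : ℝ, 0 < s ∧ (b : TangentForm n x) = s ^ 2 • g.form x :=
    (Set.ext_iff.mp (hg x) _).mp b.2
  obtain ⟨t, ht, hdt⟩ : ∃ t : ℝ, 0 < t ∧ c.exists_compatible.choose.form x = t ^ 2 • g.form x :=
    (Set.ext_iff.mp (hg x) _).mp hd
  have hrel : (b : TangentForm n x) = (s / t) ^ 2 • c.exists_compatible.choose.form x := by
    rw [hbs, hdt, smul_smul]
    congr 1
    field_simp
  have hh := τ.homogeneous x ⟨_, hd⟩ b (s / t) (div_pos hs ht) hrel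
  have h0 := τ.ne_zero x ⟨_, hd⟩
  have hst : s / t ≠ 0 := (div_pos hs ht).ne'
  rw [hh, hrel, smul_smul, Scale.form, Density.value]
  congr 1
  rw [zpow_one]
  field_simp

/-- The metric `g_τ` of the conformal scale `τ`. -/
def Scale.metric [IsManifold (𝓡 n) ∞ M] (τ : Scale c) : PseudoRiemannianMetric n M where
  form := τ.form
  symm x v w := by
    simp only [Scale.form, LinearMap.smul_apply]
    rw [c.exists_compatible.choose.symm x v w]
  nondegenerate x v h := by
    refine c.exists_compatible.choose.nondegenerate x v fun w => ?_
    have h1 := h w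
    simp only [Scale.form, LinearMap.smul_apply, smul_eq_mul] at h1
    refine (mul_eq_zero.mp h1).resolve_left (inv_ne_zero (pow_ne_zero 2 ?_))
    exact τ.ne_zero x _
  smooth e he i j := by
    have h1 := c.exists_compatible.choose.smooth e he i j
    have h2 : ContMDiffOn (𝓡 n) 𝓘(ℝ, ℝ) ∞
        (fun y => τ.coord c.exists_compatible.choose_spec e y) e.target :=
      (τ.smooth _ c.exists_compatible.choose_spec).comp_contMDiffOn
        (contMDiffOn_symm_of_mem_maximalAtlas he)
    exact ((h2.contDiffOn.pow 2).inv fun y _ => pow_ne_zero 2 (τ.ne_zero _ _)).mul h1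

/-- The metric of a scale belongs to the conformal class. -/
theorem Scale.metric_compatible [IsManifold (𝓡 n) ∞ M] (τ : Scale c) :
    c.Compatible τ.metric := by
  intro x
  obtain ⟨g, hg⟩ := c.exists_metric
  have hgx : g.form x ∈ c.ray x := (Set.ext_iff.mp (hg x) _).mpr ⟨1, one_pos, by simp⟩
  refine (Set.ext_iff.mp (hg x) _).mpr ⟨|τ.toFun x ⟨_, hgx⟩|⁻¹,
    inv_pos.mpr (abs_pos.mpr (τ.ne_zero x _)), ?_⟩
  rw [inv_pow, sq_abs]
  exact τ.form_eq x ⟨_, hgx⟩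

end Conformal

/-! ### Osculation

In this section `g` is a background metric of the conformal class and `e` a chart around the
point `x`; all tractors are written in the frame that they determine. -/

section Osculation

variable {n : ℕ} {M : Type*} [TopologicalSpace M] [ChartedSpace (EuclideanSpace ℝ (Fin n)) M]
  {c : ConformalStructure n M} {g : PseudoRiemannianMetric n M}

/-- `D σ`, a tractor field of weight `w - 1`. -/
def Density.D {w : ℤ} (σ : Density c w) (hg : c.Compatible g)
    (e : OpenPartialHomeomorph M (EuclideanSpace ℝ (Fin n))) (y : EuclideanSpace ℝ (Fin n)) :
    Tractor n :=
  tractorD (coordMatrix e g.form) (densityConnection n) w (σ.coord hg e) y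

/-- `D² σ = D (D σ)`, a section of weight `w - 2` of the tensor square of the tractor bundle. -/
def Density.DD {w : ℤ} (σ : Density c w) (hg : c.Compatible g)
    (e : OpenPartialHomeomorph M (EuclideanSpace ℝ (Fin n))) (y : EuclideanSpace ℝ (Fin n)) :
    TractorTensor n (Tractor n) :=
  tractorD (coordMatrix e g.form) (tractorConnection (coordMatrix e g.form)) (w - 1)
    (σ.D hg e) y

/-- The two densities have the same value at `x`. -/
def Density.EqAt {w : ℤ} (σ₁ σ₂ : Density c w) (x : M) : Prop :=
  ∀ b : c.ray x, σ₁.toFun x b = σ₂.toFun x b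

/-- Two densities of weight `w` osculate at `x`: the densities themselves, their images under `D`
and their images under `D²` agree at `x`. -/
def Density.Osculate {w : ℤ} (hg : c.Compatible g)
    (e : OpenPartialHomeomorph M (EuclideanSpace ℝ (Fin n))) (σ₁ σ₂ : Density c w) (x : M) : Prop :=
  σ₁.EqAt σ₂ x ∧ σ₁.D hg e (e x) = σ₂.D hg e (e x) ∧ σ₁.DD hg e (e x) = σ₂.DD hg e (e x)

/-- The four conditions `τ₁ = τ₂`, `P_{τ₁} = P_{τ₂}`, `div_{τ₁} P_{τ₁} = div_{τ₂} P_{τ₂}` and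
`div²_{τ₁} P_{τ₁} = div²_{τ₂} P_{τ₂}` at the point `x`. -/
structure CurvatureAgree [IsManifold (𝓡 n) ∞ M]
    (e : OpenPartialHomeomorph M (EuclideanSpace ℝ (Fin n))) (τ₁ τ₂ : Scale c) (x : M) : Prop where
  scale : τ₁.toDensity.EqAt τ₂.toDensity x
  schouten : schouten (coordMatrix e τ₁.metric.form) (e x)
    = schouten (coordMatrix e τ₂.metric.form) (e x)
  div : divSchouten (coordMatrix e τ₁.metric.form) (e x)
    = divSchouten (coordMatrix e τ₂.metric.form) (e x)
  divDiv : divDivSchouten (coordMatrix e τ₁.metric.form) (e x)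
    = divDivSchouten (coordMatrix e τ₂.metric.form) (e x)

/-- The covector `Υ = Ω⁻¹ dΩ`, where `τ = Ω⁻¹ τ_g` and `τ_g` is the scale of the background
metric, so that `Ω⁻¹` is the function that represents `τ` in the trivialization by `g`. -/
def Scale.upsilon (τ : Scale c) (hg : c.Compatible g)
    (e : OpenPartialHomeomorph M (EuclideanSpace ℝ (Fin n))) (y : EuclideanSpace ℝ (Fin n))
    (i : Fin n) : ℝ :=
  - (τ.coord hg e y)⁻¹ * pd i (τ.coord hg e) y

/-- The covector `Υ` with its index raised by the inverse metric. -/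
def raise (G : EuclideanSpace ℝ (Fin n) → Matrix (Fin n) (Fin n) ℝ) (y : EuclideanSpace ℝ (Fin n))
    (Υ : Fin n → ℝ) (i : Fin n) : ℝ :=
  ∑ j, (G y)⁻¹ i j * Υ j

/-- The squared length `g⁻¹(Υ, Υ)` of a covector. -/
def covectorSq (G : EuclideanSpace ℝ (Fin n) → Matrix (Fin n) (Fin n) ℝ)
    (y : EuclideanSpace ℝ (Fin n)) (Υ : Fin n → ℝ) : ℝ :=
  ∑ i, raise G y Υ i * Υ i

/-- The tractor `Z_{τ,i} = ∇_{τ,i} X = Z_i + Υ_i X` (`X` has weight `1`). -/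
def Scale.tractorZ (τ : Scale c) (hg : c.Compatible g)
    (e : OpenPartialHomeomorph M (EuclideanSpace ℝ (Fin n))) (y : EuclideanSpace ℝ (Fin n))
    (i : Fin n) : Tractor n :=
  (τ.upsilon hg e y i, Pi.single i 1, 0)

/-- The tractor `Y_τ = Y - g⁻¹(Υ, Z) - g⁻¹(Υ, Υ) X / 2` of the scale `τ`, the null tractor with
`k(X, Y_τ) = 1` that is orthogonal to all `Z_{τ,i}`. -/
def Scale.tractorY (τ : Scale c) (hg : c.Compatible g)
    (e : OpenPartialHomeomorph M (EuclideanSpace ℝ (Fin n))) (y : EuclideanSpace ℝ (Fin n)) :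
    Tractor n :=
  (- (1 / 2) * covectorSq (coordMatrix e g.form) y (τ.upsilon hg e y),
   fun i => - raise (coordMatrix e g.form) y (τ.upsilon hg e y) i, 1)

/-- The null tractors `W` with `k(X, W) = 1`. -/
def nullTractors (G : EuclideanSpace ℝ (Fin n) → Matrix (Fin n) (Fin n) ℝ)
    (y : EuclideanSpace ℝ (Fin n)) : Set (Tractor n) :=
  {W | tractorMetric G y W W = 0 ∧ tractorMetric G y (tractorX n) W = 1}

/-- The translate `Y_τ - g⁻¹(Υ, Z_τ) - g⁻¹(Υ, Υ) X / 2` of the tractor `Y_τ` by the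
covector `Υ`. -/
def Scale.shiftedY (τ : Scale c) (hg : c.Compatible g)
    (e : OpenPartialHomeomorph M (EuclideanSpace ℝ (Fin n))) (y : EuclideanSpace ℝ (Fin n))
    (Υ : Fin n → ℝ) : Tractor n :=
  τ.tractorY hg e y - ∑ i, raise (coordMatrix e g.form) y Υ i • τ.tractorZ hg e y i
    - ((1 / 2) * covectorSq (coordMatrix e g.form) y Υ) • tractorX n

end Osculation

end ConformalOsculation

end

/-! In a chart and a background metric g, a scale becomes a function f without zeros. Since D is
linear on densities, two scales osculate at x exactly when h = f₂ − f₁ satisfies h = 0, Dh = 0 and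
D²h = 0 there. Put L = g^{ij}∂_i∂_j. For weight 1 the slots of Dh are n h, n g⁻¹dh and −Lh plus
lower-order terms. The Z slot of D²h is (n − 2) g⁻¹∇(Dh), and its X slot contains the Laplacian of
Dh. Read off in turn, these say that the two-jet of h vanishes, that d(Lh) = 0 and that LLh = 0 at
x. This is `OsculatesZero`, and the equivalence is `tractorD_eq_zero_iff`.

Each of these conditions, given the earlier ones, sees only leading terms: Christoffel symbols and
derivatives of coefficients meet derivatives of h that already vanish. Hence the conditions survive
multiplication of h by a smooth function and a conformal change of g (`OsculatesZero.mul`,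
`osculatesZero_rescale_iff`). So g may be replaced by the metric of τ₁, and h by u − 1 with u =
f₂/f₁.

On the curvature side everything follows from the law P̂ = P + u⁻¹ Hess u − ½ u⁻² |du|² g for the
metric u⁻²g (`schouten_rescale`). Suppose u = 1 and du = 0 at x. Then P is unchanged iff the second
derivatives of u vanish; in that case div P changes by d(Lu); if this is zero, div² P changes by
LLu. These are the same three conditions in the same order (`osculatesZero_sub_one_iff`). Once τ₁ =
τ₂ at x, the remaining hypothesis du = 0 says that the covectors Υ agree, which is equality of the Y
tractors. So osculation is (*) together with Y_{τ₁} = Y_{τ₂}.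

Conversely (*) does not restrict du (`exists_rescale`). The Hessian of u can be chosen to cancel the
|du|² term and keep P. With N = g_{ij}(x) z^i z^j and ℓ a linear form, a cubic factor 1 + ℓN then
corrects div P without touching P, and a quartic factor 1 + cN² corrects div² P without touching the
other two. A bump function makes the result global. Finally Υ parametrizes the null tractors W with
k(X, W) = 1 bijectively (`IsMetricAt.translateY_bijOn`), so all of them occur. -/

noncomputable section

namespace ConformalOsculation

open Filter Topology

/-! ### Coordinate derivatives and order of vanishing at a point -/

section Vanishing

variable {n : ℕ} {x : EuclideanSpace ℝ (Fin n)} {f g : EuclideanSpace ℝ (Fin n) → ℝ}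

theorem ContDiffAt.pd {F : Type*} [NormedAddCommGroup F] [NormedSpace ℝ F]
    {f : EuclideanSpace ℝ (Fin n) → F} (hf : ContDiffAt ℝ ∞ f x) (i : Fin n) :
    ContDiffAt ℝ ∞ (pd i f) x :=
  (hf.fderiv_right (m := ∞) (by simp)).clm_apply contDiffAt_const

theorem differentiableAt_of_contDiffAt {F : Type*} [NormedAddCommGroup F] [NormedSpace ℝ F]
    {f : EuclideanSpace ℝ (Fin n) → F} (hf : ContDiffAt ℝ ∞ f x) : DifferentiableAt ℝ f x :=
  hf.differentiableAt (by simp)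

theorem eventually_differentiableAt {F : Type*} [NormedAddCommGroup F] [NormedSpace ℝ F]
    {f : EuclideanSpace ℝ (Fin n) → F} (hf : ContDiffAt ℝ ∞ f x) :
    ∀ᶠ y in 𝓝 x, DifferentiableAt ℝ f y := by
  have h1 : ContDiffAt ℝ 1 f x := hf.of_le (by exact_mod_cast le_top)
  filter_upwards [h1.eventually (by simp)] with y hy using hy.differentiableAt (by simp)

theorem pd_eventuallyEq {F : Type*} [NormedAddCommGroup F] [NormedSpace ℝ F]
    {f g : EuclideanSpace ℝ (Fin n) → F} (h : f =ᶠ[𝓝 x] g) (i : Fin n) :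
    pd i f =ᶠ[𝓝 x] pd i g := by
  filter_upwards [h.fderiv (𝕜 := ℝ)] with y hy
  simp only [pd, hy]

theorem pd_congr {F : Type*} [NormedAddCommGroup F] [NormedSpace ℝ F]
    {f g : EuclideanSpace ℝ (Fin n) → F} (h : f =ᶠ[𝓝 x] g) (i : Fin n) :
    pd i f x = pd i g x := (pd_eventuallyEq h i).eq_of_nhds

theorem pd_const {F : Type*} [NormedAddCommGroup F] [NormedSpace ℝ F] (a : F) (i : Fin n) :
    pd i (fun _ : EuclideanSpace ℝ (Fin n) => a) x = 0 := by
  simp [pd]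

theorem pd_add {F : Type*} [NormedAddCommGroup F] [NormedSpace ℝ F]
    {f g : EuclideanSpace ℝ (Fin n) → F} (hf : DifferentiableAt ℝ f x)
    (hg : DifferentiableAt ℝ g x) (i : Fin n) :
    pd i (fun y => f y + g y) x = pd i f x + pd i g x := by
  simp [pd, fderiv_fun_add hf hg]

theorem pd_sub {F : Type*} [NormedAddCommGroup F] [NormedSpace ℝ F]
    {f g : EuclideanSpace ℝ (Fin n) → F} (hf : DifferentiableAt ℝ f x)
    (hg : DifferentiableAt ℝ g x) (i : Fin n) :
    pd i (fun y => f y - g y) x = pd i f x - pd i g x := by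
  simp [pd, fderiv_fun_sub hf hg]

theorem pd_neg {F : Type*} [NormedAddCommGroup F] [NormedSpace ℝ F]
    (f : EuclideanSpace ℝ (Fin n) → F) (i : Fin n) :
    pd i (fun y => - f y) x = - pd i f x := by
  simp [pd, fderiv_fun_neg]

theorem pd_sum {ι : Type*} (s : Finset ι) {F : ι → EuclideanSpace ℝ (Fin n) → ℝ}
    (hF : ∀ a ∈ s, DifferentiableAt ℝ (F a) x) (i : Fin n) :
    pd i (fun y => ∑ a ∈ s, F a y) x = ∑ a ∈ s, pd i (F a) x := by
  simp [pd, fderiv_fun_sum hF]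

theorem pd_mul (hf : DifferentiableAt ℝ f x) (hg : DifferentiableAt ℝ g x) (i : Fin n) :
    pd i (fun y => f y * g y) x = pd i f x * g x + f x * pd i g x := by
  simp [pd, fderiv_fun_mul hf hg]; ring

theorem pd_const_mul (a : ℝ) (hf : DifferentiableAt ℝ f x) (i : Fin n) :
    pd i (fun y => a * f y) x = a * pd i f x := by
  simp [pd, fderiv_const_mul hf]

theorem pd_inv (hf : DifferentiableAt ℝ f x) (h0 : f x ≠ 0) (i : Fin n) :
    pd i (fun y => (f y)⁻¹) x = - (f x ^ 2)⁻¹ * pd i f x := by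
  have h := (hasDerivAt_inv h0).comp_hasFDerivAt x hf.hasFDerivAt
  have h' : fderiv ℝ (fun y => (f y)⁻¹) x = -(f x ^ 2)⁻¹ • fderiv ℝ f x := h.fderiv
  simp [pd, h']

theorem pd_comm_of_contDiffAt_two (hf : ContDiffAt ℝ 2 f x) (i j : Fin n) :
    pd i (pd j f) x = pd j (pd i f) x := by
  have hs : IsSymmSndFDerivAt ℝ f x := hf.isSymmSndFDerivAt (by simp)
  have hd : DifferentiableAt ℝ (fderiv ℝ f) x :=
    (hf.fderiv_right (m := 1) (by norm_num)).differentiableAt (by simp)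
  have key : ∀ a b : EuclideanSpace ℝ (Fin n),
      fderiv ℝ (fun y => fderiv ℝ f y a) x b = fderiv ℝ (fderiv ℝ f) x b a := by
    intro a b
    rw [fderiv_clm_apply hd (differentiableAt_const a)]
    simp
  unfold pd
  rw [key, key]
  exact hs _ _

/-- Commutation is needed on a neighbourhood, not only at x, because the mixed derivatives are
differentiated further. -/
theorem pd_comm_eventually (hf : ContDiffAt ℝ ∞ f x) (i j : Fin n) :
    pd i (pd j f) =ᶠ[𝓝 x] pd j (pd i f) := by
  have h2 : ContDiffAt ℝ 2 f x := hf.of_le (WithTop.coe_le_coe.2 (le_top : (2 : ℕ∞) ≤ ⊤))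
  filter_upwards [h2.eventually (by simp)] with y hy using pd_comm_of_contDiffAt_two hy i j

theorem pd_comm (hf : ContDiffAt ℝ ∞ f x) (i j : Fin n) :
    pd i (pd j f) x = pd j (pd i f) x := (pd_comm_eventually hf i j).eq_of_nhds

/-- The smooth function `f` vanishes to order `k` at `x`: all its partial derivatives of order less
than `k` are zero at `x`. -/
def VanishesTo (x : EuclideanSpace ℝ (Fin n)) : ℕ → (EuclideanSpace ℝ (Fin n) → ℝ) → Prop
  | 0, f => ContDiffAt ℝ ∞ f x
  | k + 1, f => ContDiffAt ℝ ∞ f x ∧ f x = 0 ∧ ∀ i, VanishesTo x k (pd i f)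

theorem VanishesTo.contDiffAt {k : ℕ} (h : VanishesTo x k f) : ContDiffAt ℝ ∞ f x := by
  cases k with
  | zero => exact h
  | succ k => exact h.1

theorem VanishesTo.differentiableAt {k : ℕ} (h : VanishesTo x k f) : DifferentiableAt ℝ f x :=
  differentiableAt_of_contDiffAt h.contDiffAt

theorem VanishesTo.eq_zero {k : ℕ} (h : VanishesTo x (k + 1) f) : f x = 0 := h.2.1

theorem VanishesTo.pd {k : ℕ} (h : VanishesTo x (k + 1) f) (i : Fin n) :
    VanishesTo x k (pd i f) := h.2.2 i

theorem VanishesTo.of_succ {k : ℕ} (h : VanishesTo x (k + 1) f) : VanishesTo x k f := by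
  induction k generalizing f with
  | zero => exact h.1
  | succ k ih => exact ⟨h.1, h.2.1, fun i => ih (h.2.2 i)⟩

theorem VanishesTo.mono {k l : ℕ} (h : VanishesTo x l f) (hkl : k ≤ l) : VanishesTo x k f := by
  induction hkl with
  | refl => exact h
  | step _ ih => exact ih h.of_succ

theorem VanishesTo.congr {k : ℕ} (h : VanishesTo x k f) (hfg : g =ᶠ[𝓝 x] f) :
    VanishesTo x k g := by
  induction k generalizing f g with
  | zero => exact ContDiffAt.congr_of_eventuallyEq h hfg
  | succ k ih =>
    exact ⟨h.1.congr_of_eventuallyEq hfg, hfg.eq_of_nhds.trans h.2.1,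
      fun i => ih (h.2.2 i) (pd_eventuallyEq hfg i)⟩

theorem vanishesTo_zero_fun (k : ℕ) : VanishesTo x k (fun _ => 0) := by
  induction k with
  | zero => exact contDiffAt_const
  | succ k ih =>
    refine ⟨contDiffAt_const, rfl, fun i => ?_⟩
    have : pd i (fun _ : EuclideanSpace ℝ (Fin n) => (0 : ℝ)) = fun _ => 0 :=
      funext fun y => pd_const 0 i
    rwa [this]

theorem VanishesTo.add {k : ℕ} (hf : VanishesTo x k f) (hg : VanishesTo x k g) :
    VanishesTo x k (fun y => f y + g y) := by
  induction k generalizing f g with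
  | zero => exact ContDiffAt.add hf hg
  | succ k ih =>
    refine ⟨hf.1.add hg.1, by simp [hf.2.1, hg.2.1], fun i => ?_⟩
    refine (ih (hf.2.2 i) (hg.2.2 i)).congr ?_
    filter_upwards [eventually_differentiableAt hf.1, eventually_differentiableAt hg.1]
      with y h1 h2 using pd_add h1 h2 i

/-- By the Leibniz rule a derivative lowers the order of only one factor. A factor of order 0 is
merely smooth and has no order to lose, so in that case the order is given up in the other factor.
-/
theorem VanishesTo.mul {k l : ℕ} (hf : VanishesTo x k f) (hg : VanishesTo x l g) :
    VanishesTo x (k + l) (fun y => f y * g y) := by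
  induction hm : k + l generalizing k l f g with
  | zero => exact hf.contDiffAt.mul hg.contDiffAt
  | succ m ih =>
    refine ⟨hf.contDiffAt.mul hg.contDiffAt, ?_, fun i => ?_⟩
    · rcases k with _ | k
      · rcases l with _ | l
        · omega
        · simp [hg.2.1]
      · simp [hf.2.1]
    · have key : VanishesTo x m (fun y => ConformalOsculation.pd i f y * g y +
          f y * ConformalOsculation.pd i g y) := by
        refine VanishesTo.add ?_ ?_
        · rcases k with _ | k
          · have h0 : VanishesTo x 0 (ConformalOsculation.pd i f) := ContDiffAt.pd hf i
            rcases l with _ | l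
            · omega
            · exact ih h0 hg.of_succ (by omega)
          · exact ih (hf.2.2 i) hg (by omega)
        · rcases l with _ | l
          · have h0 : VanishesTo x 0 (ConformalOsculation.pd i g) := ContDiffAt.pd hg i
            rcases k with _ | k
            · omega
            · exact ih hf.of_succ h0 (by omega)
          · exact ih hf (hg.2.2 i) (by omega)
      refine key.congr ?_
      filter_upwards [eventually_differentiableAt hf.contDiffAt,
        eventually_differentiableAt hg.contDiffAt] with y h1 h2 using pd_mul h1 h2 i

theorem VanishesTo.contDiffAt_mul {k : ℕ} (hf : ContDiffAt ℝ ∞ f x) (hg : VanishesTo x k g) :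
    VanishesTo x k (fun y => f y * g y) := by
  have h := VanishesTo.mul (k := 0) hf hg
  rwa [Nat.zero_add] at h

theorem VanishesTo.neg {k : ℕ} (hf : VanishesTo x k f) : VanishesTo x k (fun y => - f y) :=
  (VanishesTo.contDiffAt_mul (f := fun _ => -1) contDiffAt_const hf).congr
    (Eventually.of_forall fun y => by simp)

theorem VanishesTo.sub {k : ℕ} (hf : VanishesTo x k f) (hg : VanishesTo x k g) :
    VanishesTo x k (fun y => f y - g y) :=
  (hf.add hg.neg).congr (Eventually.of_forall fun _ => sub_eq_add_neg _ _)

theorem VanishesTo.sum {ι : Type*} (s : Finset ι) {F : ι → EuclideanSpace ℝ (Fin n) → ℝ} {k : ℕ}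
    (h : ∀ a ∈ s, VanishesTo x k (F a)) : VanishesTo x k (fun y => ∑ a ∈ s, F a y) := by
  classical
  induction s using Finset.induction_on with
  | empty => simpa using vanishesTo_zero_fun k
  | insert a s ha ih =>
    simp only [Finset.sum_insert ha]
    exact (h a (by simp)).add (ih fun b hb => h b (by simp [hb]))

theorem VanishesTo.mul_of_le {k l m : ℕ} (hf : VanishesTo x k f) (hg : VanishesTo x l g)
    (hm : m ≤ k + l) : VanishesTo x m (fun y => f y * g y) := (hf.mul hg).mono hm

theorem vanishesTo_one (hf : ContDiffAt ℝ ∞ f x) (h0 : f x = 0) : VanishesTo x 1 f :=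
  ⟨hf, h0, fun i => ContDiffAt.pd hf i⟩

theorem vanishesTo_two (hf : ContDiffAt ℝ ∞ f x) (h0 : f x = 0) (h1 : ∀ i, pd i f x = 0) :
    VanishesTo x 2 f :=
  ⟨hf, h0, fun i => vanishesTo_one (ContDiffAt.pd hf i) (h1 i)⟩

theorem vanishesTo_three (hf : ContDiffAt ℝ ∞ f x) (h0 : f x = 0) (h1 : ∀ i, pd i f x = 0)
    (h2 : ∀ i j, pd i (pd j f) x = 0) : VanishesTo x 3 f :=
  ⟨hf, h0, fun i => vanishesTo_two (ContDiffAt.pd hf i) (h1 i) fun j => h2 j i⟩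

end Vanishing

/-! ### Contractions of the difference tensor of two Levi-Civita connections -/

section ContractionAlgebra

variable {n : ℕ}

/-- The difference of the Levi-Civita connections of two conformally related metrics. -/
def connectionShift (g : Matrix (Fin n) (Fin n) ℝ) (Υ U : Fin n → ℝ) (k i j : Fin n) : ℝ :=
  (if k = j then Υ i else 0) + (if k = i then Υ j else 0) - g i j * U k

variable {g : Matrix (Fin n) (Fin n) ℝ} {Υ U : Fin n → ℝ}

/-- `U` is Υ with its index raised, so the three terms of the shift contribute Υ_m, nΥ_m and −Υ_m.
-/
theorem connectionShift_trace (hU : ∀ j, ∑ i, g i j * U i = Υ j) (m : Fin n) :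
    ∑ i, connectionShift g Υ U i i m = n * Υ m := by
  simp [connectionShift, Finset.sum_add_distrib, Finset.sum_sub_distrib, hU]

theorem sum_mul_connectionShift (a : Fin n → ℝ) (j k : Fin n) :
    ∑ m, a m * connectionShift g Υ U m j k =
      a k * Υ j + a j * Υ k - g j k * ∑ m, a m * U m := by
  simp only [connectionShift, mul_add, mul_sub, Finset.sum_add_distrib, Finset.sum_sub_distrib,
    mul_ite, mul_zero, Finset.sum_ite_eq', Finset.mem_univ, if_true, Finset.mul_sum]
  congr 1
  exact Finset.sum_congr rfl fun _ _ => by ring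

theorem sum_connectionShift_mul (a : Fin n → Fin n → ℝ) (k : Fin n) :
    ∑ i, ∑ m, connectionShift g Υ U i k m * a m i =
      Υ k * ∑ i, a i i + ∑ m, Υ m * a m k - ∑ i, ∑ m, g k m * U i * a m i := by
  have h : ∀ i m, connectionShift g Υ U i k m * a m i =
      (if i = m then Υ k * a m i else 0) + (if i = k then Υ m * a m i else 0)
        - g k m * U i * a m i := by
    intro i m
    unfold connectionShift
    split_ifs <;> ring
  simp only [h, Finset.sum_add_distrib, Finset.sum_sub_distrib, Finset.sum_ite_eq,
    Finset.mem_univ, if_true, Finset.mul_sum]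
  congr 2
  rw [Finset.sum_comm]
  simp

/-- Half of the quadratic part of the Ricci transformation law; the other half is a trace times a
shift and follows from `connectionShift_trace`. -/
theorem sum_connectionShift_sq (hs : ∀ i j, g i j = g j i) (hU : ∀ j, ∑ i, g i j * U i = Υ j)
    (j k : Fin n) :
    ∑ i, ∑ m, connectionShift g Υ U i k m * connectionShift g Υ U m i j =
      (n + 2) * (Υ j * Υ k) - 2 * g j k * ∑ m, Υ m * U m := by
  rw [sum_connectionShift_mul (fun m i => connectionShift g Υ U m i j) k]
  have h1 := connectionShift_trace hU j
  have h2 : ∑ m, Υ m * connectionShift g Υ U m k j = 2 * (Υ j * Υ k) - g k j * ∑ m, Υ m * U m := by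
    rw [sum_mul_connectionShift]; ring
  have h3 : ∑ i, ∑ m, g k m * U i * connectionShift g Υ U m i j = g j k * ∑ m, Υ m * U m := by
    have : ∀ i, ∑ m, g k m * U i * connectionShift g Υ U m i j =
        U i * (g k j * Υ i) + (g i k * U i) * Υ j - (g i j * U i) * Υ k := by
      intro i
      rw [sum_mul_connectionShift (fun m => g k m * U i)]
      have : ∑ m, g k m * U i * U m = U i * Υ k := by
        rw [← hU k, Finset.mul_sum]
        exact Finset.sum_congr rfl fun m _ => by rw [hs k m]; ring
      rw [this, hs k i]; ring
    simp only [this, Finset.sum_add_distrib, Finset.sum_sub_distrib, ← Finset.sum_mul, hU]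
    rw [hs j k, Finset.mul_sum]
    have : ∑ i, U i * (g k j * Υ i) = ∑ i, g k j * (Υ i * U i) :=
      Finset.sum_congr rfl fun m _ => by ring
    rw [this]; ring
  rw [h1, h2, h3, hs k j]; ring

end ContractionAlgebra

/-! ### Coordinate metrics, their inverses and metric compatibility -/

section Metric

variable {n : ℕ} {x : EuclideanSpace ℝ (Fin n)}
  {G : EuclideanSpace ℝ (Fin n) → Matrix (Fin n) (Fin n) ℝ}

/-- `G` is smooth, symmetric and invertible at `x`. -/
structure IsMetricAt (G : EuclideanSpace ℝ (Fin n) → Matrix (Fin n) (Fin n) ℝ)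
    (x : EuclideanSpace ℝ (Fin n)) : Prop where
  contDiffAt : ∀ i j, ContDiffAt ℝ ∞ (fun y => G y i j) x
  symm : ∀ i j, G x i j = G x j i
  isUnit_det : IsUnit (G x).det

/-- `G` is the component matrix of a metric in a neighbourhood of `x`. -/
def IsMetricNear (G : EuclideanSpace ℝ (Fin n) → Matrix (Fin n) (Fin n) ℝ)
    (x : EuclideanSpace ℝ (Fin n)) : Prop := ∀ᶠ y in 𝓝 x, IsMetricAt G y

theorem IsMetricNear.isMetricAt (h : IsMetricNear G x) : IsMetricAt G x := h.self_of_nhds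

theorem IsMetricNear.eventually (h : IsMetricNear G x) : ∀ᶠ y in 𝓝 x, IsMetricNear G y :=
  h.eventually_nhds

theorem contDiffAt_det {A : EuclideanSpace ℝ (Fin n) → Matrix (Fin n) (Fin n) ℝ}
    (hA : ∀ i j, ContDiffAt ℝ ∞ (fun y => A y i j) x) :
    ContDiffAt ℝ ∞ (fun y => (A y).det) x := by
  simp only [Matrix.det_apply]
  refine ContDiffAt.sum fun σ _ => ContDiffAt.const_smul _ ?_
  exact contDiffAt_prod fun i _ => hA _ _

/-- Cramer's rule: every entry is a quotient of determinants, which are polynomials in smooth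
functions. -/
theorem IsMetricAt.contDiffAt_inv (h : IsMetricAt G x) (i j : Fin n) :
    ContDiffAt ℝ ∞ (fun y => (G y)⁻¹ i j) x := by
  have h1 : ∀ y, (G y)⁻¹ i j = ((G y).det)⁻¹ * ((G y).updateRow j (Pi.single i 1)).det := by
    intro y
    rw [Matrix.inv_def, Matrix.smul_apply, Matrix.adjugate_apply, Ring.inverse_eq_inv', smul_eq_mul]
  simp only [h1]
  refine ((contDiffAt_det h.contDiffAt).inv h.isUnit_det.ne_zero).mul (contDiffAt_det fun a b => ?_)
  by_cases hab : a = j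
  · subst hab
    simpa using contDiffAt_const
  · simpa [Matrix.updateRow_ne hab] using h.contDiffAt a b

theorem IsMetricAt.sum_inv_mul (h : IsMetricAt G x) (i k : Fin n) :
    ∑ j, (G x)⁻¹ i j * G x j k = if i = k then 1 else 0 := by
  have := congrFun (congrFun (Matrix.nonsing_inv_mul _ h.isUnit_det) i) k
  rwa [Matrix.mul_apply, Matrix.one_apply] at this

theorem IsMetricAt.sum_mul_inv (h : IsMetricAt G x) (i k : Fin n) :
    ∑ j, G x i j * (G x)⁻¹ j k = if i = k then 1 else 0 := by
  have := congrFun (congrFun (Matrix.mul_nonsing_inv _ h.isUnit_det) i) k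
  rwa [Matrix.mul_apply, Matrix.one_apply] at this

theorem IsMetricAt.inv_symm (h : IsMetricAt G x) (i j : Fin n) : (G x)⁻¹ i j = (G x)⁻¹ j i := by
  have hs : (G x).transpose = G x := Matrix.ext fun a b => h.symm b a
  have := congrFun (congrFun (Matrix.transpose_nonsing_inv (G x)) j) i
  rwa [hs, Matrix.transpose_apply] at this

theorem IsMetricAt.sum_mul_raise (h : IsMetricAt G x) (Υ : Fin n → ℝ) (i : Fin n) :
    ∑ j, G x i j * raise G x Υ j = Υ i := by
  simp only [raise, Finset.mul_sum, ← mul_assoc]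
  rw [Finset.sum_comm]
  simp [← Finset.sum_mul, h.sum_mul_inv]

theorem IsMetricAt.sum_inv_mul_lower (h : IsMetricAt G x) (U : Fin n → ℝ) (i : Fin n) :
    ∑ j, (G x)⁻¹ i j * ∑ k, G x j k * U k = U i := by
  simp only [Finset.mul_sum, ← mul_assoc]
  rw [Finset.sum_comm]
  simp [← Finset.sum_mul, h.sum_inv_mul]

theorem IsMetricAt.contDiffAt_christoffel (h : IsMetricAt G x) (k i j : Fin n) :
    ContDiffAt ℝ ∞ (fun y => christoffel G y k i j) x := by
  unfold christoffel
  refine contDiffAt_const.mul (ContDiffAt.sum fun l _ => (h.contDiffAt_inv k l).mul ?_)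
  exact ((ContDiffAt.pd (h.contDiffAt _ _) _).add (ContDiffAt.pd (h.contDiffAt _ _) _)).sub
    (ContDiffAt.pd (h.contDiffAt _ _) _)

theorem IsMetricNear.pd_symm (h : IsMetricNear G x) (m i j : Fin n) :
    pd m (fun y => G y i j) x = pd m (fun y => G y j i) x := by
  refine pd_congr ?_ m
  filter_upwards [h] with y hy using hy.symm i j

theorem IsMetricNear.christoffel_symm (h : IsMetricNear G x) (k i j : Fin n) :
    christoffel G x k i j = christoffel G x k j i := by
  unfold christoffel
  congr 1
  refine Finset.sum_congr rfl fun l _ => ?_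
  rw [h.pd_symm l i j]; ring

/-- Lowering the upper index cancels the inverse metric and leaves the Christoffel symbols of the
first kind; metric compatibility is then the sum of two of them. -/
theorem IsMetricNear.sum_metric_mul_christoffel (h : IsMetricNear G x) (m i j : Fin n) :
    ∑ l, G x m l * christoffel G x l i j = (1 / 2) * (pd i (fun z => G z j m) x
      + pd j (fun z => G z i m) x - pd m (fun z => G z i j) x) := by
  have := h.isMetricAt.sum_mul_raise (fun l => pd i (fun z => G z j l) x
    + pd j (fun z => G z i l) x - pd l (fun z => G z i j) x) m
  rw [← this, Finset.mul_sum]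
  refine Finset.sum_congr rfl fun l _ => ?_
  unfold christoffel raise
  ring

/-- Metric compatibility of the Levi-Civita connection. -/
theorem IsMetricNear.pd_metric (h : IsMetricNear G x) (m i j : Fin n) :
    pd m (fun z => G z i j) x =
      ∑ l, (G x j l * christoffel G x l m i + G x i l * christoffel G x l m j) := by
  rw [Finset.sum_add_distrib, h.sum_metric_mul_christoffel, h.sum_metric_mul_christoffel,
    h.pd_symm m j i, h.pd_symm i m j, h.pd_symm j m i]
  rw [h.pd_symm j i m, h.pd_symm i j m]
  ring

/-- Metric compatibility of the Levi-Civita connection, for the inverse metric. -/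
theorem IsMetricNear.pd_inv (h : IsMetricNear G x) (m i j : Fin n) :
    pd m (fun z => (G z)⁻¹ i j) x =
      - ∑ l, ((G x)⁻¹ j l * christoffel G x i m l + (G x)⁻¹ i l * christoffel G x j m l) := by
  have hx := h.isMetricAt
  have key : ∀ a b : Fin n, ∑ c, pd m (fun z => (G z)⁻¹ a c) x * G x c b =
      - ∑ c, (G x)⁻¹ a c * pd m (fun z => G z c b) x := by
    intro a b
    -- Differentiate g⁻¹g = 1, which holds on a neighbourhood; contraction with g⁻¹ then isolates
    -- ∂g⁻¹.
    have h1 : pd m (fun z => ∑ c, (G z)⁻¹ a c * G z c b) x = 0 := by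
      rw [← pd_const (x := x) (if a = b then (1 : ℝ) else 0) m]
      refine pd_congr ?_ m
      filter_upwards [h] with y hy using hy.sum_inv_mul a b
    rw [pd_sum _ (fun c _ => differentiableAt_of_contDiffAt
      ((hx.contDiffAt_inv a c).mul (hx.contDiffAt c b)))] at h1
    simp only [pd_mul (differentiableAt_of_contDiffAt (hx.contDiffAt_inv _ _))
      (differentiableAt_of_contDiffAt (hx.contDiffAt _ _)), Finset.sum_add_distrib] at h1
    linarith
  have h2 : pd m (fun z => (G z)⁻¹ i j) x =
      ∑ b, (∑ c, pd m (fun z => (G z)⁻¹ i c) x * G x c b) * (G x)⁻¹ b j := by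
    simp only [Finset.sum_mul, mul_assoc]
    rw [Finset.sum_comm]
    simp [← Finset.mul_sum, hx.sum_mul_inv]
  rw [h2]
  simp only [key, h.pd_metric]
  have e1 : ∀ b, ∑ c, (G x)⁻¹ i c * ∑ l, (G x b l * christoffel G x l m c
      + G x c l * christoffel G x l m b) =
      (∑ l, G x b l * ∑ c, (G x)⁻¹ i c * christoffel G x l m c) + christoffel G x i m b := by
    intro b
    simp only [Finset.sum_add_distrib, mul_add]
    congr 1
    · simp only [Finset.mul_sum]
      rw [Finset.sum_comm]
      exact Finset.sum_congr rfl fun _ _ => Finset.sum_congr rfl fun _ _ => by ring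
    · exact hx.sum_inv_mul_lower (fun l => christoffel G x l m b) i
  simp only [e1, neg_mul, Finset.sum_neg_distrib, add_mul]
  rw [Finset.sum_add_distrib, Finset.sum_add_distrib]
  congr 1
  rw [add_comm]
  congr 1
  · exact Finset.sum_congr rfl fun b _ => by rw [hx.inv_symm b j]; ring
  · have := hx.sum_inv_mul_lower (fun l => ∑ c, (G x)⁻¹ i c * christoffel G x l m c) j
    rw [← this]
    exact Finset.sum_congr rfl fun b _ => by rw [hx.inv_symm b j]; ring

end Metric

/-! ### Conformal transformation of the connection, the Ricci tensor and the Schouten tensor -/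

section Rescaling

variable {n : ℕ} {x : EuclideanSpace ℝ (Fin n)}
  {G : EuclideanSpace ℝ (Fin n) → Matrix (Fin n) (Fin n) ℝ} {u : EuclideanSpace ℝ (Fin n) → ℝ}

/-- `u` is smooth and has no zeros in a neighbourhood of `x`. -/
def IsFactorNear (u : EuclideanSpace ℝ (Fin n) → ℝ) (x : EuclideanSpace ℝ (Fin n)) : Prop :=
  ∀ᶠ y in 𝓝 x, ContDiffAt ℝ ∞ u y ∧ u y ≠ 0

theorem IsFactorNear.contDiffAt (h : IsFactorNear u x) : ContDiffAt ℝ ∞ u x := h.self_of_nhds.1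

theorem IsFactorNear.ne_zero (h : IsFactorNear u x) : u x ≠ 0 := h.self_of_nhds.2

theorem IsFactorNear.eventually (h : IsFactorNear u x) : ∀ᶠ y in 𝓝 x, IsFactorNear u y :=
  h.eventually_nhds

/-- The components of the metric `u⁻² g`. -/
def rescale (u : EuclideanSpace ℝ (Fin n) → ℝ)
    (G : EuclideanSpace ℝ (Fin n) → Matrix (Fin n) (Fin n) ℝ) :
    EuclideanSpace ℝ (Fin n) → Matrix (Fin n) (Fin n) ℝ := fun y => ((u y) ^ 2)⁻¹ • G y

/-- The covector `Υ = Ω⁻¹ dΩ` with `Ω = u⁻¹`. -/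
def rescaleCovector (u : EuclideanSpace ℝ (Fin n) → ℝ) (y : EuclideanSpace ℝ (Fin n))
    (i : Fin n) : ℝ := - (u y)⁻¹ * pd i u y

/-- The Hessian of a function. -/
def hess (G : EuclideanSpace ℝ (Fin n) → Matrix (Fin n) (Fin n) ℝ)
    (u : EuclideanSpace ℝ (Fin n) → ℝ) (y : EuclideanSpace ℝ (Fin n)) (i j : Fin n) : ℝ :=
  pd i (pd j u) y - ∑ m, christoffel G y m i j * pd m u y

theorem rescale_inv_apply (hu : u x ≠ 0) (hG : IsMetricAt G x) (i j : Fin n) :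
    (rescale u G x)⁻¹ i j = u x ^ 2 * (G x)⁻¹ i j := by
  have : (rescale u G x)⁻¹ = u x ^ 2 • (G x)⁻¹ := by
    refine Matrix.inv_eq_left_inv ?_
    rw [rescale, Matrix.smul_mul, Matrix.mul_smul, smul_smul,
      mul_inv_cancel₀ (pow_ne_zero 2 hu), one_smul, Matrix.nonsing_inv_mul _ hG.isUnit_det]
  rw [this, Matrix.smul_apply, smul_eq_mul]

theorem IsMetricAt.rescale (hG : IsMetricAt G x) (hu : ContDiffAt ℝ ∞ u x) (h0 : u x ≠ 0) :
    IsMetricAt (rescale u G) x where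
  contDiffAt i j := ((hu.pow 2).inv (pow_ne_zero 2 h0)).mul (hG.contDiffAt i j)
  symm i j := by simp [ConformalOsculation.rescale, hG.symm i j]
  isUnit_det := by
    rw [ConformalOsculation.rescale, Matrix.det_smul]
    exact ((isUnit_iff_ne_zero.mpr (inv_ne_zero (pow_ne_zero 2 h0))).pow _).mul hG.isUnit_det

theorem IsMetricNear.rescale (hG : IsMetricNear G x) (hu : IsFactorNear u x) :
    IsMetricNear (rescale u G) x := by
  filter_upwards [hG, hu] with y h1 h2 using h1.rescale h2.1 h2.2

theorem IsFactorNear.contDiffAt_rescaleCovector (hu : IsFactorNear u x) (i : Fin n) :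
    ContDiffAt ℝ ∞ (fun y => rescaleCovector u y i) x :=
  ((hu.contDiffAt.inv hu.ne_zero).neg).mul (ContDiffAt.pd hu.contDiffAt i)

theorem IsMetricAt.contDiffAt_raise (hG : IsMetricAt G x)
    {Υ : EuclideanSpace ℝ (Fin n) → Fin n → ℝ} (hΥ : ∀ i, ContDiffAt ℝ ∞ (fun y => Υ y i) x)
    (i : Fin n) : ContDiffAt ℝ ∞ (fun y => raise G y (Υ y) i) x :=
  ContDiffAt.sum fun j _ => (hG.contDiffAt_inv i j).mul (hΥ j)

theorem pd_rescale (hG : IsMetricAt G x) (hu : IsFactorNear u x) (m i j : Fin n) :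
    pd m (fun y => rescale u G y i j) x = (u x ^ 2)⁻¹ *
      (2 * rescaleCovector u x m * G x i j + pd m (fun y => G y i j) x) := by
  have hd := differentiableAt_of_contDiffAt hu.contDiffAt
  have h0 := hu.ne_zero
  have h1 : pd m (fun y => (u y ^ 2)⁻¹) x = (u x ^ 2)⁻¹ * (2 * rescaleCovector u x m) := by
    rw [ConformalOsculation.pd_inv (hd.fun_pow 2) (pow_ne_zero 2 h0)]
    have : pd m (fun y => u y ^ 2) x = 2 * u x * pd m u x := by
      simp only [pow_two]
      rw [pd_mul hd hd]; ring
    rw [this, rescaleCovector]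
    field_simp
  have : (fun y => rescale u G y i j) = fun y => (u y ^ 2)⁻¹ * G y i j := rfl
  rw [this, pd_mul ((hd.fun_pow 2).fun_inv (pow_ne_zero 2 h0))
    (differentiableAt_of_contDiffAt (hG.contDiffAt i j)), h1]
  ring

/-- The factor u⁻² cancels against the u² of the inverse metric, and its logarithmic derivative 2Υ
produces the shift. -/
theorem christoffel_rescale (hG : IsMetricAt G x) (hu : IsFactorNear u x) (k i j : Fin n) :
    christoffel (rescale u G) x k i j = christoffel G x k i j
      + connectionShift (G x) (rescaleCovector u x) (raise G x (rescaleCovector u x)) k i j := by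
  have h0 := hu.ne_zero
  have h1 := hG.sum_inv_mul k i
  have h2 := hG.sum_inv_mul k j
  unfold christoffel
  simp only [rescale_inv_apply h0 hG, pd_rescale hG hu]
  have e : ∀ l, u x ^ 2 * (G x)⁻¹ k l *
      ((u x ^ 2)⁻¹ * (2 * rescaleCovector u x i * G x j l + pd i (fun y => G y j l) x)
      + (u x ^ 2)⁻¹ * (2 * rescaleCovector u x j * G x i l + pd j (fun y => G y i l) x)
      - (u x ^ 2)⁻¹ * (2 * rescaleCovector u x l * G x i j + pd l (fun y => G y i j) x))
      = (G x)⁻¹ k l * (pd i (fun y => G y j l) x + pd j (fun y => G y i l) x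
        - pd l (fun y => G y i j) x) + 2 * (rescaleCovector u x i * ((G x)⁻¹ k l * G x l j)
        + rescaleCovector u x j * ((G x)⁻¹ k l * G x l i)
        - G x i j * ((G x)⁻¹ k l * rescaleCovector u x l)) := by
    intro l
    rw [hG.symm l j, hG.symm l i]
    field_simp
    ring
  simp only [e, Finset.sum_add_distrib, Finset.sum_sub_distrib, ← Finset.mul_sum, h1, h2,
    connectionShift, raise, mul_ite, mul_one, mul_zero]
  ring

/-- Υ = −d log|u|, so closedness is the symmetry of second derivatives. -/
theorem rescaleCovector_closed (hu : IsFactorNear u x) (i j : Fin n) :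
    pd i (fun y => rescaleCovector u y j) x = pd j (fun y => rescaleCovector u y i) x := by
  have hd := differentiableAt_of_contDiffAt hu.contDiffAt
  have h : ∀ a b, pd a (fun y => rescaleCovector u y b) x =
      (u x ^ 2)⁻¹ * pd a u x * pd b u x - (u x)⁻¹ * pd a (pd b u) x := by
    intro a b
    unfold rescaleCovector
    rw [pd_mul (hd.fun_inv hu.ne_zero).fun_neg
      (differentiableAt_of_contDiffAt (ContDiffAt.pd hu.contDiffAt b)),
      pd_neg, pd_inv hd hu.ne_zero]
    ring
  rw [h, h, pd_comm hu.contDiffAt]; ring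

/-- The divergence of a covector as a divergence of a vector field. -/
theorem IsMetricNear.divCovector_eq (hG : IsMetricNear G x)
    {Υ : EuclideanSpace ℝ (Fin n) → Fin n → ℝ} (hΥ : ∀ i, ContDiffAt ℝ ∞ (fun y => Υ y i) x) :
    divCovector G Υ x = ∑ i, (pd i (fun y => raise G y (Υ y) i) x
      + ∑ m, christoffel G x i i m * raise G x (Υ x) m) := by
  have hx := hG.isMetricAt
  have h1 : ∀ i, pd i (fun y => raise G y (Υ y) i) x = ∑ j, ((G x)⁻¹ i j * pd i (fun y => Υ y j) x
      - (∑ l, ((G x)⁻¹ j l * christoffel G x i i l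
        + (G x)⁻¹ i l * christoffel G x j i l)) * Υ x j) := by
    intro i
    unfold raise
    rw [pd_sum _ (fun j _ => differentiableAt_of_contDiffAt ((hx.contDiffAt_inv i j).mul (hΥ j)))]
    refine Finset.sum_congr rfl fun j _ => ?_
    rw [pd_mul (differentiableAt_of_contDiffAt (hx.contDiffAt_inv i j))
      (differentiableAt_of_contDiffAt (hΥ j)), hG.pd_inv]
    ring
  simp only [h1]
  unfold divCovector
  refine Finset.sum_congr rfl fun i _ => ?_
  simp only [mul_sub, Finset.sum_sub_distrib, add_mul, Finset.sum_add_distrib, raise,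
    Finset.mul_sum, Finset.sum_mul]
  have e1 : ∑ j, ∑ l, (G x)⁻¹ j l * christoffel G x i i l * Υ x j =
      ∑ m, ∑ j, christoffel G x i i m * ((G x)⁻¹ m j * Υ x j) := by
    rw [Finset.sum_comm]
    exact Finset.sum_congr rfl fun m _ => Finset.sum_congr rfl fun j _ => by
      rw [hx.inv_symm j m]; ring
  have e2 : ∑ j, ∑ l, (G x)⁻¹ i l * christoffel G x j i l * Υ x j =
      ∑ j, ∑ k, (G x)⁻¹ i j * (christoffel G x k i j * Υ x k) := by
    rw [Finset.sum_comm]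
    exact Finset.sum_congr rfl fun m _ => Finset.sum_congr rfl fun j _ => by ring
  rw [e1, e2]; ring

theorem contDiffAt_connectionShift (hG : IsMetricAt G x)
    {Υ : EuclideanSpace ℝ (Fin n) → Fin n → ℝ} (hΥ : ∀ i, ContDiffAt ℝ ∞ (fun y => Υ y i) x)
    (k i j : Fin n) :
    ContDiffAt ℝ ∞ (fun y => connectionShift (G y) (Υ y) (raise G y (Υ y)) k i j) x := by
  unfold connectionShift
  refine ContDiffAt.sub (ContDiffAt.add ?_ ?_) ((hG.contDiffAt i j).mul (hG.contDiffAt_raise hΥ k))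
  · split_ifs
    exacts [hΥ i, contDiffAt_const]
  · split_ifs
    exacts [hΥ j, contDiffAt_const]

/-- The conformal transformation law of the Ricci tensor. -/
theorem ricci_rescale (hG : IsMetricNear G x) (hu : IsFactorNear u x) (j k : Fin n) :
    ricci (rescale u G) x j k = ricci G x j k
      - ((n : ℝ) - 2) * (pd k (fun y => rescaleCovector u y j) x
        - ∑ m, christoffel G x m j k * rescaleCovector u x m
        - rescaleCovector u x j * rescaleCovector u x k)
      - (divCovector G (rescaleCovector u) x
        + ((n : ℝ) - 2) * covectorSq G x (rescaleCovector u x)) * G x j k := by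
  have hx := hG.isMetricAt
  have hΥ := fun i => hu.contDiffAt_rescaleCovector i
  have hU := fun i => hx.contDiffAt_raise hΥ i
  have hS := fun k i j => contDiffAt_connectionShift hx hΥ k i j
  set Υ := rescaleCovector u with hΥdef
  set U : Fin n → ℝ := raise G x (Υ x) with hUdef
  set S := connectionShift (G x) (Υ x) U with hSdef
  set Γ := christoffel G x with hΓ
  have hlow : ∀ j, ∑ i, G x i j * U i = Υ x j := fun j => by
    rw [← hx.sum_mul_raise (Υ x) j]
    exact Finset.sum_congr rfl fun i _ => by rw [hx.symm i j]
  have hpd : ∀ l k i j, pd l (fun z => christoffel (rescale u G) z k i j) x =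
      pd l (fun z => christoffel G z k i j) x
        + pd l (fun y => connectionShift (G y) (Υ y) (raise G y (Υ y)) k i j) x := by
    intro l k i j
    rw [← pd_add (differentiableAt_of_contDiffAt (hx.contDiffAt_christoffel k i j))
      (differentiableAt_of_contDiffAt (hS k i j))]
    refine pd_congr ?_ l
    filter_upwards [hG, hu.eventually] with y h1 h2 using christoffel_rescale h1 h2 k i j
  -- the divergence of the shift
  have hA1 : ∑ i, pd i (fun y => connectionShift (G y) (Υ y) (raise G y (Υ y)) i j k) x =
      pd k (fun y => Υ y j) x + pd j (fun y => Υ y k) x - ∑ i, (pd i (fun y => G y j k) x * U i)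
        - G x j k * ∑ i, pd i (fun y => raise G y (Υ y) i) x := by
    have : ∀ i, pd i (fun y => connectionShift (G y) (Υ y) (raise G y (Υ y)) i j k) x =
        (if i = k then pd i (fun y => Υ y j) x else 0)
          + (if i = j then pd i (fun y => Υ y k) x else 0)
          - (pd i (fun y => G y j k) x * U i + G x j k * pd i (fun y => raise G y (Υ y) i) x) := by
      intro i
      unfold connectionShift
      have d1 : DifferentiableAt ℝ (fun y => if i = k then Υ y j else 0) x := by
        split_ifs
        exacts [differentiableAt_of_contDiffAt (hΥ j), differentiableAt_const _]
      have d2 : DifferentiableAt ℝ (fun y => if i = j then Υ y k else 0) x := by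
        split_ifs
        exacts [differentiableAt_of_contDiffAt (hΥ k), differentiableAt_const _]
      have d3 := differentiableAt_of_contDiffAt (hx.contDiffAt j k)
      have d4 := differentiableAt_of_contDiffAt (hU i)
      rw [pd_sub (d1.fun_add d2) (d3.fun_mul d4), pd_add d1 d2, pd_mul d3 d4]
      congr 2
      · split_ifs
        exacts [rfl, pd_const _ _]
      · split_ifs
        exacts [rfl, pd_const _ _]
    simp only [this, Finset.sum_add_distrib, Finset.sum_sub_distrib, Finset.sum_ite_eq',
      Finset.mem_univ, if_true, Finset.mul_sum]
    ring
  -- The trace of the shift equals nΥ at all nearby points, so the identity may be differentiated.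
  have hA2 : ∑ i, pd k (fun y => connectionShift (G y) (Υ y) (raise G y (Υ y)) i i j) x =
      n * pd k (fun y => Υ y j) x := by
    rw [← pd_sum _ (fun i _ => differentiableAt_of_contDiffAt (hS i i j)),
      ← pd_const_mul _ (differentiableAt_of_contDiffAt (hΥ j))]
    refine pd_congr ?_ k
    filter_upwards [hG] with y hy
    refine connectionShift_trace (fun j => ?_) j
    rw [← hy.sum_mul_raise (Υ y) j]
    exact Finset.sum_congr rfl fun i _ => by rw [hy.symm i j]
  have hB1 : ∑ i, ∑ m, Γ i i m * S m j k = Υ x j * (∑ i, Γ i i k) + Υ x k * (∑ i, Γ i i j)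
      - G x j k * ∑ i, ∑ m, Γ i i m * U m := by
    simp only [S, sum_mul_connectionShift, Finset.sum_sub_distrib, Finset.sum_add_distrib,
      ← Finset.sum_mul, ← Finset.mul_sum]
    ring
  have hB2 : ∑ i, ∑ m, S i i m * Γ m j k = n * ∑ m, Γ m j k * Υ x m := by
    rw [Finset.sum_comm]
    simp only [← Finset.sum_mul, S, connectionShift_trace hlow, Finset.mul_sum]
    exact Finset.sum_congr rfl fun m _ => by ring
  have hB3 : ∑ i, ∑ m, Γ i k m * S m i j = ∑ m, Γ m j k * Υ x m + Υ x j * (∑ i, Γ i i k)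
      - ∑ i, U i * ∑ l, G x j l * Γ l i k := by
    simp only [S, sum_mul_connectionShift, Finset.sum_sub_distrib, Finset.sum_add_distrib,
      ← Finset.sum_mul]
    have e1 : ∑ i, Γ i k j * Υ x i = ∑ m, Γ m j k * Υ x m :=
      Finset.sum_congr rfl fun m _ => by rw [hΓ, hG.christoffel_symm m k j]
    have e2 : ∑ i, Γ i k i = ∑ i, Γ i i k :=
      Finset.sum_congr rfl fun m _ => hG.christoffel_symm m k m
    have e3 : ∑ i, G x i j * ∑ m, Γ i k m * U m = ∑ i, U i * ∑ l, G x j l * Γ l i k := by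
      simp only [Finset.mul_sum]
      rw [Finset.sum_comm]
      refine Finset.sum_congr rfl fun a _ => Finset.sum_congr rfl fun b _ => ?_
      rw [hx.symm b j, hΓ, hG.christoffel_symm b k a]; ring
    rw [e1, e2, e3]; ring
  have hB4 : ∑ i, ∑ m, S i k m * Γ m i j = Υ x k * (∑ i, Γ i i j) + ∑ m, Γ m j k * Υ x m
      - ∑ i, U i * ∑ l, G x k l * Γ l i j := by
    rw [sum_connectionShift_mul (fun m i => Γ m i j) k]
    have e1 : ∑ m, Υ x m * Γ m k j = ∑ m, Γ m j k * Υ x m :=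
      Finset.sum_congr rfl fun m _ => by rw [hΓ, hG.christoffel_symm m k j]; ring
    rw [e1]
    congr 1
    refine Finset.sum_congr rfl fun a _ => ?_
    rw [Finset.mul_sum]
    exact Finset.sum_congr rfl fun b _ => by ring
  have hC1 : ∑ i, ∑ m, S i i m * S m j k =
      n * (2 * (Υ x j * Υ x k) - G x j k * ∑ m, Υ x m * U m) := by
    rw [Finset.sum_comm]
    simp only [← Finset.sum_mul]
    have : ∀ m, (∑ i, S i i m) * S m j k = n * (Υ x m * S m j k) := fun m => by
      rw [hSdef, connectionShift_trace hlow]; ring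
    simp only [this, ← Finset.mul_sum]
    rw [hSdef, sum_mul_connectionShift]
    ring
  have hC2 : ∑ i, ∑ m, S i k m * S m i j =
      ((n : ℝ) + 2) * (Υ x j * Υ x k) - 2 * G x j k * ∑ m, Υ x m * U m :=
    sum_connectionShift_sq hx.symm hlow j k
  have hsq : covectorSq G x (Υ x) = ∑ m, Υ x m * U m :=
    Finset.sum_congr rfl fun m _ => by rw [mul_comm]
  -- Metric compatibility turns the derivative of g into Christoffel terms, which cancel the last
  -- sums of `hB3` and `hB4`.
  have hdg : ∑ i, (pd i (fun y => G y j k) x * U i) =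
      ∑ i, U i * (∑ l, G x k l * Γ l i j) + ∑ i, U i * ∑ l, G x j l * Γ l i k := by
    rw [← Finset.sum_add_distrib]
    refine Finset.sum_congr rfl fun i _ => ?_
    rw [hG.pd_metric, Finset.sum_add_distrib]; ring
  -- This collects ∂_iU^i from `hA1` and Γ^i_{im}U^m from `hB1` into the divergence of Υ.
  have hdiv : divCovector G Υ x = ∑ i, pd i (fun y => raise G y (Υ y) i) x
      + ∑ i, ∑ m, Γ i i m * U m := by
    rw [hG.divCovector_eq hΥ, Finset.sum_add_distrib]
  -- With the new symbols equal to Γ + S, the Ricci formula splits into the old one, terms linear in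
  -- ∂S, mixed ΓS terms and SS terms.
  have hmain : ricci (rescale u G) x j k = ricci G x j k
      + (∑ i, pd i (fun y => connectionShift (G y) (Υ y) (raise G y (Υ y)) i j k) x
      - ∑ i, pd k (fun y => connectionShift (G y) (Υ y) (raise G y (Υ y)) i i j) x
      + (∑ i, ∑ m, Γ i i m * S m j k) + (∑ i, ∑ m, S i i m * Γ m j k)
      - (∑ i, ∑ m, Γ i k m * S m i j) - (∑ i, ∑ m, S i k m * Γ m i j)
      + (∑ i, ∑ m, S i i m * S m j k) - ∑ i, ∑ m, S i k m * S m i j) := by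
    unfold ricci
    simp only [hpd, christoffel_rescale hx hu, ← Finset.sum_add_distrib, ← Finset.sum_sub_distrib]
    refine Finset.sum_congr rfl fun i _ => ?_
    have : ∀ m, (christoffel G x i i m + S i i m) * (christoffel G x m j k + S m j k)
        - (christoffel G x i k m + S i k m) * (christoffel G x m i j + S m i j) =
        (christoffel G x i i m * christoffel G x m j k
          - christoffel G x i k m * christoffel G x m i j)
        + (Γ i i m * S m j k + S i i m * Γ m j k - Γ i k m * S m i j - S i k m * Γ m i j
          + S i i m * S m j k - S i k m * S m i j) := fun m => by rw [hΓ]; ring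
    simp only [← hΥdef, ← hUdef, ← hSdef, this]
    simp only [Finset.sum_add_distrib, Finset.sum_sub_distrib]
    ring
  rw [hmain, hA1, hA2, hB1, hB2, hB3, hB4, hC1, hC2, hsq, hdg, hdiv,
    rescaleCovector_closed hu j k]
  ring

/-- The conformal transformation law of the Schouten tensor, in terms of `Υ`. -/
theorem schouten_rescale_aux (hn : 2 < n) (hG : IsMetricNear G x) (hu : IsFactorNear u x)
    (j k : Fin n) :
    schouten (rescale u G) x j k = schouten G x j k
      - (pd k (fun y => rescaleCovector u y j) x
        - ∑ m, christoffel G x m j k * rescaleCovector u x m)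
      + rescaleCovector u x j * rescaleCovector u x k
      - (1 / 2) * covectorSq G x (rescaleCovector u x) * G x j k := by
  have hx := hG.isMetricAt
  have hn' : (2 : ℝ) < n := by exact_mod_cast hn
  have hn2 : (n : ℝ) - 2 ≠ 0 := by linarith
  have hn1 : (n : ℝ) - 1 ≠ 0 := by linarith
  have h0 := hu.ne_zero
  have hsc : scalarCurvature (rescale u G) x = u x ^ 2 * (scalarCurvature G x
      - ((n : ℝ) - 2) * (divCovector G (rescaleCovector u) x
        - covectorSq G x (rescaleCovector u x))
      - (divCovector G (rescaleCovector u) x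
        + ((n : ℝ) - 2) * covectorSq G x (rescaleCovector u x)) * n) := by
    have e1 : ∑ i, ∑ j, (G x)⁻¹ i j * G x i j = n := by
      have : ∀ i, ∑ j, (G x)⁻¹ i j * G x i j = 1 := fun i => by
        have := hx.sum_inv_mul i i
        rw [if_pos rfl] at this
        rw [← this]
        exact Finset.sum_congr rfl fun j _ => by rw [hx.symm]
      simp [this]
    have e2 : ∑ i, ∑ j, (G x)⁻¹ i j * (pd j (fun y => rescaleCovector u y i) x
        - ∑ m, christoffel G x m i j * rescaleCovector u x m) =
        divCovector G (rescaleCovector u) x := by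
      unfold divCovector
      refine Finset.sum_congr rfl fun i _ => Finset.sum_congr rfl fun j _ => ?_
      rw [rescaleCovector_closed hu i j]
    have e3 : ∑ i, ∑ j, (G x)⁻¹ i j * (rescaleCovector u x i * rescaleCovector u x j) =
        covectorSq G x (rescaleCovector u x) := by
      unfold covectorSq raise
      simp only [Finset.sum_mul]
      exact Finset.sum_congr rfl fun i _ => Finset.sum_congr rfl fun j _ => by ring
    unfold scalarCurvature
    have e4 : ∀ i j, (rescale u G x)⁻¹ i j * ricci (rescale u G) x i j = u x ^ 2 *
        ((G x)⁻¹ i j * ricci G x i j - ((n : ℝ) - 2) *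
          ((G x)⁻¹ i j * (pd j (fun y => rescaleCovector u y i) x
            - ∑ m, christoffel G x m i j * rescaleCovector u x m)
          - (G x)⁻¹ i j * (rescaleCovector u x i * rescaleCovector u x j))
        - (divCovector G (rescaleCovector u) x
          + ((n : ℝ) - 2) * covectorSq G x (rescaleCovector u x)) * ((G x)⁻¹ i j * G x i j)) := by
      intro i j
      rw [rescale_inv_apply h0 hx, ricci_rescale hG hu]
      ring
    simp only [e4, ← Finset.mul_sum, Finset.sum_sub_distrib]
    rw [e1, e2, e3]
  unfold schouten
  -- In the combination that defines P the divergence of Υ cancels, and the |Υ|² coefficients leave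
  -- −½.
  rw [hsc, ricci_rescale hG hu, rescale, Matrix.smul_apply, smul_eq_mul]
  field_simp
  ring

/-- The conformal transformation law of the Schouten tensor. -/
theorem schouten_rescale (hn : 2 < n) (hG : IsMetricNear G x) (hu : IsFactorNear u x)
    (i j : Fin n) :
    schouten (rescale u G) x i j = schouten G x i j + (u x)⁻¹ * hess G u x i j
      - (1 / 2) * (u x ^ 2)⁻¹ * covectorSq G x (fun k => pd k u x) * G x i j := by
  have hd := differentiableAt_of_contDiffAt hu.contDiffAt
  have h0 := hu.ne_zero
  -- The quadratic term here cancels the ΥΥ term of `schouten_rescale_aux`, so that only u⁻¹ Hess u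
  -- remains.
  have h1 : pd j (fun y => rescaleCovector u y i) x =
      (u x ^ 2)⁻¹ * pd i u x * pd j u x - (u x)⁻¹ * pd i (pd j u) x := by
    unfold rescaleCovector
    rw [pd_mul (hd.fun_inv h0).fun_neg
      (differentiableAt_of_contDiffAt (ContDiffAt.pd hu.contDiffAt i)),
      pd_neg, pd_inv hd h0, pd_comm hu.contDiffAt]
    ring
  have h2 : covectorSq G x (rescaleCovector u x) =
      (u x ^ 2)⁻¹ * covectorSq G x (fun k => pd k u x) := by
    unfold covectorSq raise rescaleCovector
    simp only [Finset.mul_sum, Finset.sum_mul]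
    refine Finset.sum_congr rfl fun a _ => Finset.sum_congr rfl fun b _ => ?_
    field_simp
  have h3 : ∑ m, christoffel G x m i j * rescaleCovector u x m =
      - (u x)⁻¹ * ∑ m, christoffel G x m i j * pd m u x := by
    rw [Finset.mul_sum]
    exact Finset.sum_congr rfl fun a _ => by unfold rescaleCovector; ring
  rw [schouten_rescale_aux hn hG hu, h1, h2, h3, hess, rescaleCovector, rescaleCovector]
  field_simp
  ring

end Rescaling

/-! ### Functions that agree to a given order at a point -/

section Agreement

variable {n : ℕ} {x : EuclideanSpace ℝ (Fin n)} {f g h f' g' : EuclideanSpace ℝ (Fin n) → ℝ}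
  {k : ℕ}

/-- The functions `f` and `g` are smooth at `x` and agree to order `k` there. -/
structure AgreesTo (x : EuclideanSpace ℝ (Fin n)) (k : ℕ) (f g : EuclideanSpace ℝ (Fin n) → ℝ) :
    Prop where
  left : ContDiffAt ℝ ∞ f x
  right : ContDiffAt ℝ ∞ g x
  sub : VanishesTo x k fun y => f y - g y

theorem AgreesTo.refl (hf : ContDiffAt ℝ ∞ f x) : AgreesTo x k f f :=
  ⟨hf, hf, by simpa using vanishesTo_zero_fun k⟩

theorem AgreesTo.of_eventuallyEq (hf : ContDiffAt ℝ ∞ f x) (h : g =ᶠ[𝓝 x] f) :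
    AgreesTo x k g f := by
  refine ⟨hf.congr_of_eventuallyEq h, hf, (vanishesTo_zero_fun k).congr ?_⟩
  filter_upwards [h] with y hy
  rw [hy, sub_self]

theorem AgreesTo.trans (h1 : AgreesTo x k f g) (h2 : AgreesTo x k g h) : AgreesTo x k f h :=
  ⟨h1.left, h2.right, (h1.sub.add h2.sub).congr (Eventually.of_forall fun y => by ring)⟩

theorem AgreesTo.mono {l : ℕ} (h : AgreesTo x l f g) (hkl : k ≤ l) : AgreesTo x k f g :=
  ⟨h.left, h.right, h.sub.mono hkl⟩

theorem AgreesTo.add (h1 : AgreesTo x k f g) (h2 : AgreesTo x k f' g') :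
    AgreesTo x k (fun y => f y + f' y) (fun y => g y + g' y) :=
  ⟨h1.left.add h2.left, h1.right.add h2.right,
    (h1.sub.add h2.sub).congr (Eventually.of_forall fun y => by ring)⟩

theorem AgreesTo.sub' (h1 : AgreesTo x k f g) (h2 : AgreesTo x k f' g') :
    AgreesTo x k (fun y => f y - f' y) (fun y => g y - g' y) :=
  ⟨h1.left.sub h2.left, h1.right.sub h2.right,
    (h1.sub.sub h2.sub).congr (Eventually.of_forall fun y => by ring)⟩

theorem AgreesTo.mul (h1 : AgreesTo x k f g) (h2 : AgreesTo x k f' g') :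
    AgreesTo x k (fun y => f y * f' y) (fun y => g y * g' y) :=
  ⟨h1.left.mul h2.left, h1.right.mul h2.right,
    ((VanishesTo.contDiffAt_mul h1.left h2.sub).add
      (VanishesTo.contDiffAt_mul h2.right h1.sub)).congr (Eventually.of_forall fun y => by ring)⟩

theorem AgreesTo.sum {ι : Type*} (s : Finset ι) {F F' : ι → EuclideanSpace ℝ (Fin n) → ℝ}
    (h : ∀ a ∈ s, AgreesTo x k (F a) (F' a)) :
    AgreesTo x k (fun y => ∑ a ∈ s, F a y) (fun y => ∑ a ∈ s, F' a y) :=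
  ⟨ContDiffAt.sum fun a ha => (h a ha).left, ContDiffAt.sum fun a ha => (h a ha).right,
    (VanishesTo.sum s fun a ha => (h a ha).sub).congr
      (Eventually.of_forall fun y => by simp only [Finset.sum_sub_distrib])⟩

theorem AgreesTo.pd (h : AgreesTo x (k + 1) f g) (i : Fin n) : AgreesTo x k (pd i f) (pd i g) := by
  refine ⟨ContDiffAt.pd h.left i, ContDiffAt.pd h.right i, (h.sub.pd i).congr ?_⟩
  filter_upwards [eventually_differentiableAt h.left, eventually_differentiableAt h.right]
    with y h1 h2 using (pd_sub h1 h2 i).symm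

theorem AgreesTo.eq (h : AgreesTo x (k + 1) f g) : f x = g x := sub_eq_zero.mp h.sub.eq_zero

theorem AgreesTo.vanishesTo (h : AgreesTo x k f g) (hg : VanishesTo x k g) : VanishesTo x k f :=
  (h.sub.add hg).congr (Eventually.of_forall fun y => by ring)

end Agreement

/-! ### The Schouten tensor and its divergence when u − 1 vanishes to third order -/

section HigherOrder

variable {n : ℕ} {x : EuclideanSpace ℝ (Fin n)}
  {G : EuclideanSpace ℝ (Fin n) → Matrix (Fin n) (Fin n) ℝ} {u v : EuclideanSpace ℝ (Fin n) → ℝ}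

theorem IsMetricAt.contDiffAt_ricci (h : IsMetricAt G x) (i j : Fin n) :
    ContDiffAt ℝ ∞ (fun y => ricci G y i j) x := by
  unfold ricci
  have hΓ := h.contDiffAt_christoffel
  refine ContDiffAt.sum fun a _ => ((ContDiffAt.pd (hΓ _ _ _) _).sub
    (ContDiffAt.pd (hΓ _ _ _) _)).add (ContDiffAt.sum fun m _ => ?_)
  exact ((hΓ _ _ _).mul (hΓ _ _ _)).sub ((hΓ _ _ _).mul (hΓ _ _ _))

theorem IsMetricAt.contDiffAt_schouten (h : IsMetricAt G x) (i j : Fin n) :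
    ContDiffAt ℝ ∞ (fun y => schouten G y i j) x := by
  unfold schouten
  have hs : ContDiffAt ℝ ∞ (fun y => scalarCurvature G y) x :=
    ContDiffAt.sum fun a _ => ContDiffAt.sum fun b _ =>
      (h.contDiffAt_inv a b).mul (h.contDiffAt_ricci a b)
  exact contDiffAt_const.mul ((h.contDiffAt_ricci i j).sub
    ((hs.mul (h.contDiffAt i j)).div_const _))

theorem IsMetricAt.contDiffAt_schoutenTrace (h : IsMetricAt G x) :
    ContDiffAt ℝ ∞ (fun y => schoutenTrace G y) x :=
  ContDiffAt.sum fun a _ => ContDiffAt.sum fun b _ =>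
    (h.contDiffAt_inv a b).mul (h.contDiffAt_schouten a b)

theorem IsMetricAt.contDiffAt_hess (h : IsMetricAt G x) (hu : ContDiffAt ℝ ∞ u x) (i j : Fin n) :
    ContDiffAt ℝ ∞ (fun y => hess G u y i j) x :=
  (ContDiffAt.pd (ContDiffAt.pd hu j) i).sub (ContDiffAt.sum fun m _ =>
    (h.contDiffAt_christoffel m i j).mul (ContDiffAt.pd hu m))

/-- The leading part `g^{ij} ∂_i ∂_j` of the Laplacian. -/
def lapLeading (G : EuclideanSpace ℝ (Fin n) → Matrix (Fin n) (Fin n) ℝ)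
    (u : EuclideanSpace ℝ (Fin n) → ℝ) (y : EuclideanSpace ℝ (Fin n)) : ℝ :=
  ∑ i, ∑ j, (G y)⁻¹ i j * pd i (pd j u) y

theorem IsMetricAt.contDiffAt_lapLeading (h : IsMetricAt G x) (hu : ContDiffAt ℝ ∞ u x) :
    ContDiffAt ℝ ∞ (lapLeading G u) x :=
  ContDiffAt.sum fun i _ => ContDiffAt.sum fun j _ =>
    (h.contDiffAt_inv i j).mul (ContDiffAt.pd (ContDiffAt.pd hu j) i)

theorem pd_sub_const (u : EuclideanSpace ℝ (Fin n) → ℝ) (a : ℝ) (i : Fin n) :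
    pd i (fun y => u y - a) = pd i u := by
  funext y
  simp [pd, fderiv_sub_const]

theorem VanishesTo.pd_of_sub_const {k : ℕ} {a : ℝ} (hv : VanishesTo x (k + 1) fun y => u y - a)
    (i : Fin n) : VanishesTo x k (ConformalOsculation.pd i u) := by
  have := hv.pd i
  rwa [pd_sub_const] at this

theorem sum_sum_sum_swap_left_right (F : Fin n → Fin n → Fin n → ℝ) :
    ∑ a, ∑ b, ∑ c, F a b c = ∑ a, ∑ b, ∑ c, F c b a := by
  rw [Finset.sum_comm]
  conv_rhs => rw [Finset.sum_comm]
  exact Finset.sum_congr rfl fun b _ => Finset.sum_comm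

theorem pd_pd_comm_eventually (hu : ContDiffAt ℝ ∞ u x) (l i j : Fin n) :
    pd l (pd i (pd j u)) =ᶠ[𝓝 x] pd i (pd j (pd l u)) :=
  (pd_comm_eventually (ContDiffAt.pd hu j) l i).trans
    (pd_eventuallyEq (pd_comm_eventually hu l j) i)

theorem pd_lapLeading_eventuallyEq (hG : IsMetricAt G x) (hu : ContDiffAt ℝ ∞ u x) (l : Fin n) :
    pd l (lapLeading G u) =ᶠ[𝓝 x] fun y => ∑ i, ∑ j,
      (pd l (fun z => (G z)⁻¹ i j) y * pd i (pd j u) y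
      + (G y)⁻¹ i j * pd i (pd j (pd l u)) y) := by
  have h1 := fun i j => eventually_differentiableAt (hG.contDiffAt_inv i j)
  have h2 := fun i j => eventually_differentiableAt (ContDiffAt.pd (ContDiffAt.pd hu j) i)
  have h3 := fun i j => pd_pd_comm_eventually hu l i j
  simp only [← eventually_all] at h1 h2
  have h3' : ∀ᶠ y in 𝓝 x, ∀ i j, pd l (pd i (pd j u)) y = pd i (pd j (pd l u)) y := by
    exact eventually_all.mpr fun i => eventually_all.mpr fun j => h3 i j
  filter_upwards [h1, h2, h3'] with y h1 h2 h3
  unfold lapLeading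
  rw [pd_sum _ (fun i _ => DifferentiableAt.fun_sum fun j _ => (h1 i j).fun_mul (h2 i j))]
  refine Finset.sum_congr rfl fun i _ => ?_
  rw [pd_sum _ (fun j _ => (h1 i j).fun_mul (h2 i j))]
  refine Finset.sum_congr rfl fun j _ => ?_
  rw [pd_mul (h1 i j) (h2 i j), h3]

/-- The third derivatives of `u`, contracted with the inverse metric. -/
theorem pd_lapLeading (hG : IsMetricAt G x) (hu : ∀ i, VanishesTo x 2 (pd i u))
    (hu' : ContDiffAt ℝ ∞ u x) (l : Fin n) :
    AgreesTo x 1 (pd l (lapLeading G u))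
      (fun y => ∑ i, ∑ j, (G y)⁻¹ i j * pd i (pd j (pd l u)) y) := by
  have hc : ContDiffAt ℝ ∞ (fun y => ∑ i, ∑ j, (G y)⁻¹ i j * pd i (pd j (pd l u)) y) x :=
    hG.contDiffAt_lapLeading (ContDiffAt.pd hu' l)
  -- Derivatives that fall on the inverse metric meet second derivatives of u, which vanish at x.
  have hz : VanishesTo x 1 (fun y => ∑ i, ∑ j,
      pd l (fun z => (G z)⁻¹ i j) y * pd i (pd j u) y) :=
    VanishesTo.sum _ fun i _ => VanishesTo.sum _ fun j _ =>
      VanishesTo.contDiffAt_mul (ContDiffAt.pd (hG.contDiffAt_inv i j) l) ((hu j).pd i)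
  refine ⟨ContDiffAt.pd (hG.contDiffAt_lapLeading hu') l, hc, hz.congr ?_⟩
  filter_upwards [pd_lapLeading_eventuallyEq hG hu' l] with y hy
  rw [hy]
  simp only [Finset.sum_add_distrib]
  ring

/-- The difference of the connections is linear in Υ, and Υ vanishes to second order together with
du. -/
theorem agreesTo_christoffel_rescale (hG : IsMetricNear G x) (hu : IsFactorNear u x)
    (hv : VanishesTo x 3 fun y => u y - 1) (k i j : Fin n) :
    AgreesTo x 2 (fun y => christoffel (rescale u G) y k i j) (fun y => christoffel G y k i j) := by
  have hx := hG.isMetricAt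
  have hΥ : ∀ i, VanishesTo x 2 fun y => rescaleCovector u y i := fun i =>
    VanishesTo.contDiffAt_mul (hu.contDiffAt.inv hu.ne_zero).neg (hv.pd_of_sub_const i)
  have hU : ∀ i, VanishesTo x 2 fun y => raise G y (rescaleCovector u y) i := fun i =>
    VanishesTo.sum _ fun j _ => VanishesTo.contDiffAt_mul (hx.contDiffAt_inv i j) (hΥ j)
  have hS : VanishesTo x 2 fun y => connectionShift (G y) (rescaleCovector u y)
      (raise G y (rescaleCovector u y)) k i j := by
    unfold connectionShift
    refine VanishesTo.sub (VanishesTo.add ?_ ?_)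
      (VanishesTo.contDiffAt_mul (hx.contDiffAt i j) (hU k))
    · split_ifs
      exacts [hΥ i, vanishesTo_zero_fun 2]
    · split_ifs
      exacts [hΥ j, vanishesTo_zero_fun 2]
  refine ⟨(hG.rescale hu).isMetricAt.contDiffAt_christoffel k i j, hx.contDiffAt_christoffel k i j,
    hS.congr ?_⟩
  filter_upwards [hG, hu.eventually] with y h1 h2
  rw [christoffel_rescale h1 h2]
  ring

/-- u² − 1 = (u + 1)(u − 1). -/
theorem agreesTo_rescale_inv (hG : IsMetricNear G x) (hu : IsFactorNear u x)
    (hv : VanishesTo x 3 fun y => u y - 1) (i j : Fin n) :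
    AgreesTo x 3 (fun y => (rescale u G y)⁻¹ i j) (fun y => (G y)⁻¹ i j) := by
  have hx := hG.isMetricAt
  have h : VanishesTo x 3 fun y => ((u y + 1) * (G y)⁻¹ i j) * (u y - 1) :=
    VanishesTo.contDiffAt_mul ((hu.contDiffAt.add contDiffAt_const).mul (hx.contDiffAt_inv i j)) hv
  refine ⟨(hG.rescale hu).isMetricAt.contDiffAt_inv i j, hx.contDiffAt_inv i j, h.congr ?_⟩
  filter_upwards [hG, hu] with y h1 h2
  rw [rescale_inv_apply h2.2 h1]
  ring

/-- In `schouten_rescale` the factor u⁻¹ differs from 1 by a multiple of u − 1, and |du|² is a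
product of two functions that vanish to second order. Order three is what two further divergences
require. -/
theorem agreesTo_schouten_rescale (hn : 2 < n) (hG : IsMetricNear G x) (hu : IsFactorNear u x)
    (hv : VanishesTo x 3 fun y => u y - 1) (i j : Fin n) :
    AgreesTo x 3 (fun y => schouten (rescale u G) y i j)
      (fun y => schouten G y i j + hess G u y i j) := by
  have hx := hG.isMetricAt
  have hinv := hu.contDiffAt.inv hu.ne_zero
  have h1 : VanishesTo x 3 fun y => (- ((u y)⁻¹ * hess G u y i j)) * (u y - 1) :=
    VanishesTo.contDiffAt_mul (hinv.mul (hx.contDiffAt_hess hu.contDiffAt i j)).neg hv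
  have h2 : VanishesTo x 3 fun y => covectorSq G y (fun k => pd k u y) := by
    unfold covectorSq raise
    refine VanishesTo.sum _ fun a _ => VanishesTo.mul_of_le (k := 2) (l := 2)
      (VanishesTo.sum _ fun b _ => VanishesTo.contDiffAt_mul (hx.contDiffAt_inv a b)
        (hv.pd_of_sub_const b)) (hv.pd_of_sub_const a) (by norm_num)
  have h3 : VanishesTo x 3 fun y => ((1 / 2) * (u y ^ 2)⁻¹ * G y i j) *
      covectorSq G y (fun k => pd k u y) :=
    VanishesTo.contDiffAt_mul ((contDiffAt_const.mul
      ((hu.contDiffAt.pow 2).inv (pow_ne_zero 2 hu.ne_zero))).mul (hx.contDiffAt i j)) h2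
  refine ⟨(hG.rescale hu).isMetricAt.contDiffAt_schouten i j,
    (hx.contDiffAt_schouten i j).add (hx.contDiffAt_hess hu.contDiffAt i j), (h1.sub h3).congr ?_⟩
  filter_upwards [hG.eventually, hu.eventually] with y h4 h5
  rw [schouten_rescale hn h4 h5]
  have := h5.ne_zero
  field_simp
  ring

theorem contDiffAt_divTwoTensor (hG : IsMetricAt G x)
    {T : EuclideanSpace ℝ (Fin n) → Fin n → Fin n → ℝ}
    (hT : ∀ i j, ContDiffAt ℝ ∞ (fun y => T y i j) x) (i : Fin n) :
    ContDiffAt ℝ ∞ (fun y => divTwoTensor G T y i) x := by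
  unfold divTwoTensor
  refine ContDiffAt.sum fun j _ => ContDiffAt.sum fun k _ => (hG.contDiffAt_inv j k).mul
    ((ContDiffAt.pd (hT i j) k).sub (ContDiffAt.sum fun l _ => ?_))
  exact ((hG.contDiffAt_christoffel _ _ _).mul (hT _ _)).add
    ((hG.contDiffAt_christoffel _ _ _).mul (hT _ _))

/-- The divergence of the Hessian of `u` up to terms that vanish to second order. -/
theorem agreesTo_divTwoTensor_hess (hG : IsMetricNear G x) (hu : ContDiffAt ℝ ∞ u x)
    (hv : ∀ i, VanishesTo x 2 (pd i u)) (i : Fin n) :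
    AgreesTo x 2 (fun y => divTwoTensor G (hess G u) y i)
      (fun y => pd i (lapLeading G u) y
        - ∑ l, (∑ j, ∑ k, (G y)⁻¹ j k * christoffel G y l j k) * pd i (pd l u) y) := by
  have hx := hG.isMetricAt
  have hΓ := hx.contDiffAt_christoffel
  have hI := hx.contDiffAt_inv
  have hu2 : ∀ i j, ContDiffAt ℝ ∞ (pd i (pd j u)) x := fun i j =>
    ContDiffAt.pd (ContDiffAt.pd hu j) i
  have hH : ∀ i j, AgreesTo x 2 (fun y => hess G u y i j) (pd i (pd j u)) := fun i j => by
    refine ⟨hx.contDiffAt_hess hu i j, hu2 i j, (VanishesTo.sum Finset.univ fun m _ =>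
      VanishesTo.contDiffAt_mul (hΓ m i j) (hv m)).neg.congr (Eventually.of_forall fun y => ?_)⟩
    simp only [hess]; ring
  -- A derivative on Γ leaves first derivatives of u, which are negligible. The terms Γ∂∂u vanish
  -- only to first order and have to be kept.
  have hdH : ∀ k i j, AgreesTo x 2 (pd k fun y => hess G u y i j) (fun y => pd k (pd i (pd j u)) y
      - ∑ m, christoffel G y m i j * pd k (pd m u) y) := fun k i j => by
    refine ⟨ContDiffAt.pd (hx.contDiffAt_hess hu i j) k, (ContDiffAt.pd (hu2 i j) k).sub
      (ContDiffAt.sum fun m _ => (hΓ m i j).mul (hu2 k m)),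
      (VanishesTo.sum Finset.univ fun m _ =>
        VanishesTo.contDiffAt_mul (ContDiffAt.pd (hΓ m i j) k) (hv m)).neg.congr ?_⟩
    have e1 : ∀ᶠ y in 𝓝 x, ∀ m, DifferentiableAt ℝ (fun y => christoffel G y m i j) y :=
      eventually_all.mpr fun m => eventually_differentiableAt (hΓ m i j)
    have e2 : ∀ᶠ y in 𝓝 x, ∀ m, DifferentiableAt ℝ (pd m u) y :=
      eventually_all.mpr fun m => eventually_differentiableAt (ContDiffAt.pd hu m)
    filter_upwards [e1, e2, eventually_differentiableAt (hu2 i j)] with y e1 e2 e3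
    unfold hess
    rw [pd_sub e3 (DifferentiableAt.fun_sum fun m _ => (e1 m).fun_mul (e2 m)),
      pd_sum _ (fun m _ => (e1 m).fun_mul (e2 m))]
    simp only [pd_mul (e1 _) (e2 _), Finset.sum_add_distrib]
    ring
  have hmain : AgreesTo x 2 (fun y => divTwoTensor G (hess G u) y i)
      (fun y => ∑ j, ∑ k, (G y)⁻¹ j k * ((pd k (pd i (pd j u)) y
        - ∑ m, christoffel G y m i j * pd k (pd m u) y)
        - ∑ l, (christoffel G y l k i * pd l (pd j u) y
          + christoffel G y l k j * pd i (pd l u) y))) := by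
    unfold divTwoTensor
    refine AgreesTo.sum _ fun j _ => AgreesTo.sum _ fun k _ => (AgreesTo.refl (hI j k)).mul
      ((hdH k i j).sub' (AgreesTo.sum _ fun l _ => ?_))
    exact ((AgreesTo.refl (hΓ _ _ _)).mul (hH l j)).add ((AgreesTo.refl (hΓ _ _ _)).mul (hH i l))
  refine hmain.trans (AgreesTo.of_eventuallyEq ?_ ?_)
  · exact (ContDiffAt.pd (hx.contDiffAt_lapLeading hu) i).sub (ContDiffAt.sum fun l _ =>
      (ContDiffAt.sum fun j _ => ContDiffAt.sum fun k _ => (hI j k).mul (hΓ l j k)).mul (hu2 i l))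
  have hsym : ∀ᶠ y in 𝓝 x, ∀ i j, pd i (pd j u) y = pd j (pd i u) y :=
    eventually_all.mpr fun i => eventually_all.mpr fun j => pd_comm_eventually hu i j
  have hsym3 : ∀ᶠ y in 𝓝 x, ∀ j k, pd k (pd i (pd j u)) y = pd j (pd k (pd i u)) y :=
    eventually_all.mpr fun j => eventually_all.mpr fun k =>
      (pd_eventuallyEq (pd_comm_eventually hu i j) k).trans
        (pd_comm_eventually (ContDiffAt.pd hu i) k j)
  filter_upwards [hG.eventually, hsym, hsym3, pd_lapLeading_eventuallyEq hx hu i]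
    with y hy hs hs3 hw
  simp only [hw, hs3, hy.pd_inv, mul_sub, mul_add, Finset.sum_add_distrib, Finset.sum_sub_distrib,
    neg_mul, add_mul, Finset.sum_neg_distrib, Finset.sum_mul, Finset.mul_sum]
  -- By metric compatibility ∂_i g^{jk} is a sum of two Christoffel terms. They match two of the
  -- three ΓHess sums (`e1`, `e2`); the third (`e3`) is the correction in the statement.
  have e1 : ∑ j, ∑ k, ∑ m, (G y)⁻¹ j k * (christoffel G y m i j * pd k (pd m u) y) =
      ∑ j, ∑ k, ∑ l, (G y)⁻¹ k l * christoffel G y j i l * pd j (pd k u) y := by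
    rw [sum_sum_sum_swap_left_right]
    refine Finset.sum_congr rfl fun a _ => Finset.sum_congr rfl fun b _ =>
      Finset.sum_congr rfl fun c _ => ?_
    rw [hy.isMetricAt.inv_symm b c, hs a b]; ring
  have e2 : ∑ j, ∑ k, ∑ l, (G y)⁻¹ j k * (christoffel G y l k i * pd l (pd j u) y) =
      ∑ j, ∑ k, ∑ l, (G y)⁻¹ j l * christoffel G y k i l * pd j (pd k u) y := by
    refine Finset.sum_congr rfl fun a _ => ?_
    rw [Finset.sum_comm]
    refine Finset.sum_congr rfl fun b _ => Finset.sum_congr rfl fun c _ => ?_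
    rw [hs a b, hy.christoffel_symm b c i]; ring
  have e3 : ∑ j, ∑ k, ∑ l, (G y)⁻¹ j k * (christoffel G y l k j * pd i (pd l u) y) =
      ∑ l, ∑ j, ∑ k, (G y)⁻¹ j k * christoffel G y l j k * pd i (pd l u) y := by
    rw [Finset.sum_comm]
    rw [sum_sum_sum_swap_left_right]
    refine Finset.sum_congr rfl fun a _ => Finset.sum_congr rfl fun b _ =>
      Finset.sum_congr rfl fun c _ => ?_
    rw [hy.christoffel_symm a b c]; ring
  rw [e1, e2, e3]
  ring

theorem agreesTo_divSchouten_rescale (hn : 2 < n) (hG : IsMetricNear G x) (hu : IsFactorNear u x)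
    (hv : VanishesTo x 3 fun y => u y - 1) (i : Fin n) :
    AgreesTo x 2 (fun y => divSchouten (rescale u G) y i)
      (fun y => divSchouten G y i + (pd i (lapLeading G u) y
        - ∑ l, (∑ j, ∑ k, (G y)⁻¹ j k * christoffel G y l j k) * pd i (pd l u) y)) := by
  have hx := hG.isMetricAt
  have hP := hx.contDiffAt_schouten
  have hH := hx.contDiffAt_hess hu.contDiffAt
  have hΓ := hx.contDiffAt_christoffel
  have hPH := agreesTo_schouten_rescale hn hG hu hv
  have h1 : AgreesTo x 2 (fun y => divSchouten (rescale u G) y i)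
      (fun y => divTwoTensor G (fun y i j => schouten G y i j + hess G u y i j) y i) := by
    unfold divSchouten divTwoTensor
    -- The one derivative in the divergence uses up one of the three orders of agreement of P.
    refine AgreesTo.sum _ fun j _ => AgreesTo.sum _ fun k _ =>
      ((agreesTo_rescale_inv hG hu hv j k).mono (by norm_num)).mul
      (((hPH i j).pd k).sub' (AgreesTo.sum _ fun l _ => ?_))
    exact ((agreesTo_christoffel_rescale hG hu hv l k i).mul ((hPH l j).mono (by norm_num))).add
      ((agreesTo_christoffel_rescale hG hu hv l k j).mul ((hPH i l).mono (by norm_num)))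
  have h2 : (fun y => divTwoTensor G (fun y i j => schouten G y i j + hess G u y i j) y i)
      =ᶠ[𝓝 x] fun y => divSchouten G y i + divTwoTensor G (hess G u) y i := by
    have e1 : ∀ᶠ y in 𝓝 x, ∀ j, DifferentiableAt ℝ (fun y => schouten G y i j) y :=
      eventually_all.mpr fun j => eventually_differentiableAt (hP i j)
    have e2 : ∀ᶠ y in 𝓝 x, ∀ j, DifferentiableAt ℝ (fun y => hess G u y i j) y :=
      eventually_all.mpr fun j => eventually_differentiableAt (hH i j)
    filter_upwards [e1, e2] with y e1 e2
    unfold divSchouten divTwoTensor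
    rw [← Finset.sum_add_distrib]
    refine Finset.sum_congr rfl fun j _ => ?_
    rw [← Finset.sum_add_distrib]
    refine Finset.sum_congr rfl fun k _ => ?_
    rw [pd_add (e1 j) (e2 j), ← mul_add]
    congr 1
    have : ∀ l, christoffel G y l k i * (schouten G y l j + hess G u y l j)
        + christoffel G y l k j * (schouten G y i l + hess G u y i l) =
        (christoffel G y l k i * schouten G y l j + christoffel G y l k j * schouten G y i l) +
        (christoffel G y l k i * hess G u y l j + christoffel G y l k j * hess G u y i l) :=
      fun l => by ring
    simp only [this, Finset.sum_add_distrib]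
    ring
  have h3 := (AgreesTo.refl (k := 2) (contDiffAt_divTwoTensor hx hP i)).add
    (agreesTo_divTwoTensor_hess hG hu.contDiffAt (fun i => hv.pd_of_sub_const i) i)
  refine h1.trans ((AgreesTo.of_eventuallyEq h3.left h2).trans h3)

end HigherOrder

/-! ### The osculation condition and its invariance -/

section Osculating

variable {n : ℕ} {x : EuclideanSpace ℝ (Fin n)}
  {G : EuclideanSpace ℝ (Fin n) → Matrix (Fin n) (Fin n) ℝ} {f u v w : EuclideanSpace ℝ (Fin n) → ℝ}

theorem AgreesTo.lapLeading {k : ℕ} (hG : IsMetricAt G x) (h : AgreesTo x (k + 2) v w) :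
    AgreesTo x k (lapLeading G v) (lapLeading G w) := by
  unfold ConformalOsculation.lapLeading
  exact AgreesTo.sum _ fun i _ => AgreesTo.sum _ fun j _ =>
    (AgreesTo.refl (hG.contDiffAt_inv i j)).mul ((h.pd j).pd i)

theorem lapLeading_eventuallyEq (h : v =ᶠ[𝓝 x] w) : lapLeading G v =ᶠ[𝓝 x] lapLeading G w := by
  have : ∀ᶠ y in 𝓝 x, ∀ i j, pd i (pd j v) y = pd i (pd j w) y :=
    eventually_all.mpr fun i => eventually_all.mpr fun j => pd_eventuallyEq (pd_eventuallyEq h j) i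
  filter_upwards [this] with y hy
  simp only [lapLeading, hy]

theorem pd_pd_add_eventually (hv : ContDiffAt ℝ ∞ v x) (hw : ContDiffAt ℝ ∞ w x) (i j : Fin n) :
    pd i (pd j fun y => v y + w y) =ᶠ[𝓝 x] fun y => pd i (pd j v) y + pd i (pd j w) y := by
  have h1 : (pd j fun y => v y + w y) =ᶠ[𝓝 x] fun y => pd j v y + pd j w y := by
    filter_upwards [eventually_differentiableAt hv, eventually_differentiableAt hw]
      with y h1 h2 using pd_add h1 h2 j
  refine (pd_eventuallyEq h1 i).trans ?_
  filter_upwards [eventually_differentiableAt (ContDiffAt.pd hv j),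
    eventually_differentiableAt (ContDiffAt.pd hw j)] with y h1 h2 using pd_add h1 h2 i

theorem lapLeading_add (hv : ContDiffAt ℝ ∞ v x) (hw : ContDiffAt ℝ ∞ w x) :
    lapLeading G (fun y => v y + w y) =ᶠ[𝓝 x] fun y => lapLeading G v y + lapLeading G w y := by
  have : ∀ᶠ y in 𝓝 x, ∀ i j, pd i (pd j fun y => v y + w y) y
      = pd i (pd j v) y + pd i (pd j w) y :=
    eventually_all.mpr fun i => eventually_all.mpr fun j => pd_pd_add_eventually hv hw i j
  filter_upwards [this] with y hy
  simp only [lapLeading, hy, mul_add, Finset.sum_add_distrib]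

theorem pd_pd_mul_eventually (hv : ContDiffAt ℝ ∞ v x) (hw : ContDiffAt ℝ ∞ w x) (i j : Fin n) :
    pd i (pd j fun y => v y * w y) =ᶠ[𝓝 x] fun y => pd i (pd j v) y * w y
      + pd j v y * pd i w y + pd i v y * pd j w y + v y * pd i (pd j w) y := by
  have hv' := eventually_differentiableAt hv
  have hw' := eventually_differentiableAt hw
  have h1 : (pd j fun y => v y * w y) =ᶠ[𝓝 x] fun y => pd j v y * w y + v y * pd j w y := by
    filter_upwards [hv', hw'] with y h1 h2 using pd_mul h1 h2 j
  refine (pd_eventuallyEq h1 i).trans ?_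
  filter_upwards [hv', hw', eventually_differentiableAt (ContDiffAt.pd hv j),
    eventually_differentiableAt (ContDiffAt.pd hw j)] with y h1 h2 h3 h4
  rw [pd_add (h3.fun_mul h2) (h1.fun_mul h4), pd_mul h3 h2, pd_mul h1 h4]
  ring

theorem lapLeading_mul (hG : IsMetricNear G x) (hv : ContDiffAt ℝ ∞ v x)
    (hw : ContDiffAt ℝ ∞ w x) :
    lapLeading G (fun y => v y * w y) =ᶠ[𝓝 x] fun y => v y * lapLeading G w y
      + (∑ l, (2 * raise G y (fun j => pd j v y) l) * pd l w y + lapLeading G v y * w y) := by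
  have : ∀ᶠ y in 𝓝 x, ∀ i j, pd i (pd j fun y => v y * w y) y
      = pd i (pd j v) y * w y
      + pd j v y * pd i w y + pd i v y * pd j w y + v y * pd i (pd j w) y :=
    eventually_all.mpr fun i => eventually_all.mpr fun j => pd_pd_mul_eventually hv hw i j
  filter_upwards [hG, this] with y hg hy
  simp only [lapLeading, hy, mul_add, Finset.sum_add_distrib, raise, Finset.mul_sum, Finset.sum_mul]
  have e1 : ∑ i, ∑ j, (G y)⁻¹ i j * (pd i v y * pd j w y) =
      ∑ i, ∑ j, (G y)⁻¹ i j * (pd j v y * pd i w y) := by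
    rw [Finset.sum_comm]
    exact Finset.sum_congr rfl fun i _ => Finset.sum_congr rfl fun j _ => by
      rw [hg.inv_symm j i]
  have e2 : ∑ i, ∑ j, 2 * ((G y)⁻¹ i j * pd j v y) * pd i w y =
      2 * ∑ i, ∑ j, (G y)⁻¹ i j * (pd j v y * pd i w y) := by
    simp only [Finset.mul_sum]
    exact Finset.sum_congr rfl fun i _ => Finset.sum_congr rfl fun j _ => by ring
  have e3 : ∑ i, ∑ j, (G y)⁻¹ i j * (pd i (pd j v) y * w y) =
      ∑ i, ∑ j, (G y)⁻¹ i j * pd i (pd j v) y * w y :=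
    Finset.sum_congr rfl fun i _ => Finset.sum_congr rfl fun j _ => by ring
  have e4 : ∑ i, ∑ j, (G y)⁻¹ i j * (v y * pd i (pd j w) y) =
      ∑ i, ∑ j, v y * ((G y)⁻¹ i j * pd i (pd j w) y) :=
    Finset.sum_congr rfl fun i _ => Finset.sum_congr rfl fun j _ => by ring
  rw [e1, e2, e3, e4]
  ring

/-- To leading order, a smooth factor is a constant. -/
theorem AgreesTo.mul_of_vanishesTo {k : ℕ} (hf : ContDiffAt ℝ ∞ f x) (hv : VanishesTo x k v) :
    AgreesTo x (k + 1) (fun y => f y * v y) (fun y => f x * v y) := by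
  have h1 : VanishesTo x 1 fun y => f y - f x :=
    vanishesTo_one (hf.sub contDiffAt_const) (sub_self _)
  refine ⟨hf.mul hv.contDiffAt, contDiffAt_const.mul hv.contDiffAt,
    (h1.mul_of_le hv (by omega)).congr (Eventually.of_forall fun y => by ring)⟩

theorem lapLeading_const_mul (a : ℝ) (hv : ContDiffAt ℝ ∞ v x) :
    lapLeading G (fun y => a * v y) =ᶠ[𝓝 x] fun y => a * lapLeading G v y := by
  have h1 : ∀ j, (pd j fun y => a * v y) =ᶠ[𝓝 x] fun y => a * pd j v y := fun j => by
    filter_upwards [eventually_differentiableAt hv] with y h1 using pd_const_mul a h1 j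
  have h2 : ∀ᶠ y in 𝓝 x, ∀ i j, pd i (pd j fun y => a * v y) y = a * pd i (pd j v) y := by
    refine eventually_all.mpr fun i => eventually_all.mpr fun j => ?_
    refine (pd_eventuallyEq (h1 j) i).trans ?_
    filter_upwards [eventually_differentiableAt (ContDiffAt.pd hv j)]
      with y h1 using pd_const_mul a h1 i
  filter_upwards [h2] with y hy
  simp only [lapLeading, hy, Finset.mul_sum]
  exact Finset.sum_congr rfl fun i _ => Finset.sum_congr rfl fun j _ => by ring

/-- Replacing f by the constant f(x) costs a term of third order, and two derivatives of it still
vanish at x. -/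
theorem lapLeading_mul_of_vanishesTo_two (hG : IsMetricAt G x) (hf : ContDiffAt ℝ ∞ f x)
    (hw : VanishesTo x 2 w) :
    lapLeading G (fun y => f y * w y) x = f x * lapLeading G w x := by
  rw [((AgreesTo.mul_of_vanishesTo hf hw).lapLeading (k := 1) hG).eq]
  exact (lapLeading_const_mul (f x) hw.contDiffAt).eq_of_nhds

theorem lapLeading_of_vanishesTo_three (hv : VanishesTo x 3 v) :
    lapLeading G v x = 0 := by
  unfold lapLeading
  exact Finset.sum_eq_zero fun i _ => Finset.sum_eq_zero fun j _ => by
    rw [((hv.pd j).pd i).eq_zero, mul_zero]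

theorem VanishesTo.lapLeading {k : ℕ} (hG : IsMetricAt G x) (hv : VanishesTo x (k + 2) v) :
    VanishesTo x k (lapLeading G v) :=
  VanishesTo.sum _ fun i _ => VanishesTo.sum _ fun j _ =>
    VanishesTo.contDiffAt_mul (hG.contDiffAt_inv i j) ((hv.pd j).pd i)

/-- The condition on `v` that, for the difference of two scales, expresses osculation. -/
structure OsculatesZero (G : EuclideanSpace ℝ (Fin n) → Matrix (Fin n) (Fin n) ℝ)
    (v : EuclideanSpace ℝ (Fin n) → ℝ) (x : EuclideanSpace ℝ (Fin n)) : Prop where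
  vanishesTo : VanishesTo x 3 v
  pd_lapLeading : ∀ i, pd i (lapLeading G v) x = 0
  lapLeading_lapLeading : lapLeading G (lapLeading G v) x = 0

theorem vanishesTo_two_lapLeading (hG : IsMetricAt G x) (hv : VanishesTo x 3 v)
    (ht : ∀ i, pd i (lapLeading G v) x = 0) : VanishesTo x 2 (lapLeading G v) :=
  vanishesTo_two (hG.contDiffAt_lapLeading hv.contDiffAt) (lapLeading_of_vanishesTo_three hv) ht

/-- First-order terms do not contribute to the fourth-order condition. -/
theorem lapLeading_sum_mul_pd (hG : IsMetricAt G x) (hv : VanishesTo x 3 v)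
    (ht : ∀ i, pd i (lapLeading G v) x = 0) {a : Fin n → EuclideanSpace ℝ (Fin n) → ℝ}
    (ha : ∀ l, ContDiffAt ℝ ∞ (a l) x) :
    lapLeading G (fun y => ∑ l, a l y * pd l v y) x = 0 := by
  -- At x the operators L and ∂_l commute on v, because their commutator involves only second
  -- derivatives of v.
  have hL : ∀ l, lapLeading G (pd l v) x = 0 := fun l => by
    rw [← ht l]
    exact (ConformalOsculation.pd_lapLeading hG (fun i => hv.pd i) hv.contDiffAt l).eq.symm
  have hs : ∀ s : Finset (Fin n), lapLeading G (fun y => ∑ l ∈ s, a l y * pd l v y) x = 0 := by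
    intro s
    induction s using Finset.induction_on with
    | empty =>
      simpa using lapLeading_of_vanishesTo_three (G := G) (vanishesTo_zero_fun (x := x) 3)
    | insert l s hl ih =>
      simp only [Finset.sum_insert hl]
      rw [(lapLeading_add ((ha l).mul (hv.pd l).contDiffAt) (ContDiffAt.sum fun l _ =>
        (ha l).mul (hv.pd l).contDiffAt)).eq_of_nhds, ih,
        lapLeading_mul_of_vanishesTo_two hG (ha l) (hv.pd l), hL]
      ring
  exact hs _

theorem pd_lapLeading_mul (hG : IsMetricAt G x) (hf : ContDiffAt ℝ ∞ f x)
    (hv : VanishesTo x 3 v) (i : Fin n) :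
    pd i (lapLeading G fun y => f y * v y) x = f x * pd i (lapLeading G v) x := by
  rw [(((AgreesTo.mul_of_vanishesTo hf hv).lapLeading (k := 2) hG).pd i).eq,
    pd_congr (lapLeading_const_mul (f x) hv.contDiffAt),
    pd_const_mul _ (differentiableAt_of_contDiffAt (hG.contDiffAt_lapLeading hv.contDiffAt))]

/-- L(fv) = f Lv + 2⟨df, dv⟩ + (Lf)v. After a second L, the middle term drops by
`lapLeading_sum_mul_pd` and the last because it vanishes to third order. In the first, f acts as the
constant f(x), since Lv vanishes to second order. -/
theorem lapLeading_lapLeading_mul (hG : IsMetricNear G x) (hf : ContDiffAt ℝ ∞ f x)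
    (hv : VanishesTo x 3 v) (ht : ∀ i, pd i (lapLeading G v) x = 0) :
    lapLeading G (lapLeading G fun y => f y * v y) x = f x * lapLeading G (lapLeading G v) x := by
  have hx := hG.isMetricAt
  have hw := hx.contDiffAt_lapLeading hv.contDiffAt
  have ha : ∀ l, ContDiffAt ℝ ∞ (fun y => 2 * raise G y (fun j => pd j f y) l) x := fun l =>
    contDiffAt_const.mul (hx.contDiffAt_raise (fun i => ContDiffAt.pd hf i) l)
  have hs : ContDiffAt ℝ ∞ (fun y => ∑ l, (2 * raise G y (fun j => pd j f y) l) * pd l v y) x :=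
    ContDiffAt.sum fun l _ => (ha l).mul (hv.pd l).contDiffAt
  have hz := VanishesTo.contDiffAt_mul (hx.contDiffAt_lapLeading hf) hv
  rw [(lapLeading_eventuallyEq (lapLeading_mul hG hf hv.contDiffAt)).eq_of_nhds,
    (lapLeading_add (hf.mul hw) (hs.add hz.contDiffAt)).eq_of_nhds,
    (lapLeading_add hs hz.contDiffAt).eq_of_nhds, lapLeading_of_vanishesTo_three hz,
    lapLeading_sum_mul_pd hx hv ht ha,
    lapLeading_mul_of_vanishesTo_two hx hf (vanishesTo_two_lapLeading hx hv ht)]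
  ring

theorem OsculatesZero.mul (hG : IsMetricNear G x) (hf : ContDiffAt ℝ ∞ f x)
    (h : OsculatesZero G v x) : OsculatesZero G (fun y => f y * v y) x where
  vanishesTo := VanishesTo.contDiffAt_mul hf h.vanishesTo
  pd_lapLeading i := by
    rw [pd_lapLeading_mul hG.isMetricAt hf h.vanishesTo, h.pd_lapLeading, mul_zero]
  lapLeading_lapLeading := by
    rw [lapLeading_lapLeading_mul hG hf h.vanishesTo h.pd_lapLeading, h.lapLeading_lapLeading,
      mul_zero]

theorem lapLeading_rescale (hG : IsMetricNear G x) (hf : IsFactorNear f x)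
    (v : EuclideanSpace ℝ (Fin n) → ℝ) :
    lapLeading (rescale f G) v =ᶠ[𝓝 x] fun y => f y ^ 2 * lapLeading G v y := by
  filter_upwards [hG, hf] with y h1 h2
  simp only [lapLeading, rescale_inv_apply h2.2 h1, Finset.mul_sum]
  exact Finset.sum_congr rfl fun i _ => Finset.sum_congr rfl fun j _ => by ring

theorem pd_lapLeading_rescale (hG : IsMetricNear G x) (hf : IsFactorNear f x)
    (hv : VanishesTo x 3 v) (i : Fin n) :
    pd i (lapLeading (rescale f G) v) x = f x ^ 2 * pd i (lapLeading G v) x := by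
  have hw := VanishesTo.lapLeading (k := 1) hG.isMetricAt hv
  rw [pd_congr (lapLeading_rescale hG hf v),
    ((AgreesTo.mul_of_vanishesTo (hf.contDiffAt.pow 2) hw).pd i).eq,
    pd_const_mul _ hw.differentiableAt]

theorem lapLeading_lapLeading_rescale (hG : IsMetricNear G x) (hf : IsFactorNear f x)
    (hv : VanishesTo x 3 v) (ht : ∀ i, pd i (lapLeading G v) x = 0) :
    lapLeading (rescale f G) (lapLeading (rescale f G) v) x =
      f x ^ 4 * lapLeading G (lapLeading G v) x := by
  rw [(lapLeading_eventuallyEq (lapLeading_rescale hG hf v)).eq_of_nhds,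
    (lapLeading_rescale hG hf _).eq_of_nhds]
  have := lapLeading_mul_of_vanishesTo_two hG.isMetricAt (hf.contDiffAt.pow 2)
    (vanishesTo_two_lapLeading hG.isMetricAt hv ht)
  rw [this]
  ring

/-- Given the preceding conditions, each next one is only multiplied by a nonzero power of f(x): f²
for the gradient of Lv and f⁴ for LLv. -/
theorem osculatesZero_rescale_iff (hG : IsMetricNear G x) (hf : IsFactorNear f x) :
    OsculatesZero (rescale f G) v x ↔ OsculatesZero G v x := by
  have h0 := hf.ne_zero
  constructor
  · intro h
    have ht : ∀ i, pd i (lapLeading G v) x = 0 := fun i => by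
      have := h.pd_lapLeading i
      rw [pd_lapLeading_rescale hG hf h.vanishesTo] at this
      exact (mul_eq_zero.mp this).resolve_left (pow_ne_zero 2 h0)
    refine ⟨h.vanishesTo, ht, ?_⟩
    have := h.lapLeading_lapLeading
    rw [lapLeading_lapLeading_rescale hG hf h.vanishesTo ht] at this
    exact (mul_eq_zero.mp this).resolve_left (pow_ne_zero 4 h0)
  · intro h
    refine ⟨h.vanishesTo, fun i => ?_, ?_⟩
    · rw [pd_lapLeading_rescale hG hf h.vanishesTo, h.pd_lapLeading, mul_zero]
    · rw [lapLeading_lapLeading_rescale hG hf h.vanishesTo h.pd_lapLeading,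
        h.lapLeading_lapLeading, mul_zero]

theorem OsculatesZero.congr (h : OsculatesZero G v x) (hw : w =ᶠ[𝓝 x] v) :
    OsculatesZero G w x where
  vanishesTo := h.vanishesTo.congr hw
  pd_lapLeading i := by rw [pd_congr (lapLeading_eventuallyEq hw), h.pd_lapLeading]
  lapLeading_lapLeading := by
    rw [(lapLeading_eventuallyEq (lapLeading_eventuallyEq hw)).eq_of_nhds,
      h.lapLeading_lapLeading]

end Osculating

/-! ### Osculation compared with equality of P, div P and div² P -/

section Comparison

variable {n : ℕ} {x : EuclideanSpace ℝ (Fin n)}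
  {G : EuclideanSpace ℝ (Fin n) → Matrix (Fin n) (Fin n) ℝ} {u : EuclideanSpace ℝ (Fin n) → ℝ}

theorem lapLeading_sub_const (a : ℝ) : lapLeading G (fun y => u y - a) = lapLeading G u := by
  funext y
  simp only [lapLeading, pd_sub_const]

theorem schouten_rescale_of_vanishesTo (hn : 2 < n) (hG : IsMetricNear G x)
    (hu : IsFactorNear u x) (hv : VanishesTo x 3 fun y => u y - 1) :
    schouten (rescale u G) x = schouten G x := by
  funext i j
  rw [(agreesTo_schouten_rescale hn hG hu hv i j).eq, hess]
  have h1 : ∀ i, pd i u x = 0 := fun i => (hv.pd_of_sub_const i).eq_zero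
  have h2 : pd i (pd j u) x = 0 := ((hv.pd_of_sub_const j).pd i).eq_zero
  simp [h1, h2]

theorem divSchouten_rescale_of_vanishesTo (hn : 2 < n) (hG : IsMetricNear G x)
    (hu : IsFactorNear u x) (hv : VanishesTo x 3 fun y => u y - 1) (i : Fin n) :
    divSchouten (rescale u G) x i = divSchouten G x i + pd i (lapLeading G u) x := by
  rw [(agreesTo_divSchouten_rescale hn hG hu hv i).eq]
  have h2 : ∀ l, pd i (pd l u) x = 0 := fun l => ((hv.pd_of_sub_const l).pd i).eq_zero
  simp [h2]

/-- One more divergence of `agreesTo_divSchouten_rescale`. The correction b^l ∂_j∂_l u contributes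
third derivatives of u contracted with g, and these vanish because d(Lu) does. -/
theorem divDivSchouten_rescale_of_vanishesTo (hn : 2 < n) (hG : IsMetricNear G x)
    (hu : IsFactorNear u x) (hv : VanishesTo x 3 fun y => u y - 1)
    (ht : ∀ i, pd i (lapLeading G u) x = 0) :
    divDivSchouten (rescale u G) x = divDivSchouten G x + lapLeading G (lapLeading G u) x := by
  have hx := hG.isMetricAt
  have hα := agreesTo_divSchouten_rescale hn hG hu hv
  set b : Fin n → EuclideanSpace ℝ (Fin n) → ℝ :=
    fun l y => ∑ j, ∑ k, (G y)⁻¹ j k * christoffel G y l j k with hb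
  have hbc : ∀ l, ContDiffAt ℝ ∞ (b l) x := fun l => ContDiffAt.sum fun j _ =>
    ContDiffAt.sum fun k _ => (hx.contDiffAt_inv j k).mul (hx.contDiffAt_christoffel l j k)
  have hw := hx.contDiffAt_lapLeading hu.contDiffAt
  have hu2 : ∀ i l, VanishesTo x 1 (pd i (pd l u)) := fun i l => (hv.pd_of_sub_const l).pd i
  have hdα : ∀ i j, pd i (fun y => divSchouten (rescale u G) y j) x =
      pd i (fun y => divSchouten G y j) x + (pd i (pd j (lapLeading G u)) x
        - ∑ l, b l x * pd i (pd j (pd l u)) x) := fun i j => by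
    have hd : ContDiffAt ℝ ∞ (fun y => divSchouten G y j) x :=
      contDiffAt_divTwoTensor hx hx.contDiffAt_schouten j
    have h1 : ∀ l, DifferentiableAt ℝ (fun y => b l y * pd j (pd l u) y) x := fun l =>
      (differentiableAt_of_contDiffAt (hbc l)).fun_mul (hu2 j l).differentiableAt
    have h2 := differentiableAt_of_contDiffAt (ContDiffAt.pd hw j)
    rw [((hα j).pd i).eq, pd_add (differentiableAt_of_contDiffAt hd)
      (h2.fun_sub (DifferentiableAt.fun_sum fun l _ => h1 l)),
      pd_sub h2 (DifferentiableAt.fun_sum fun l _ => h1 l), pd_sum _ (fun l _ => h1 l)]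
    congr 2
    refine Finset.sum_congr rfl fun l _ => ?_
    -- A derivative on b is multiplied by second derivatives of u, zero at x.
    rw [pd_mul (differentiableAt_of_contDiffAt (hbc l)) (hu2 j l).differentiableAt,
      (hu2 j l).eq_zero, mul_zero, zero_add]
  have hα0 : ∀ i, divSchouten (rescale u G) x i = divSchouten G x i := fun i => by
    rw [divSchouten_rescale_of_vanishesTo hn hG hu hv, ht, add_zero]
  -- At x the contracted third derivatives are the gradient of Lu.
  have hL : ∀ l, ∑ i, ∑ j, (G x)⁻¹ i j * pd i (pd j (pd l u)) x = 0 := fun l => by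
    rw [← ht l]
    exact (pd_lapLeading hx (fun i => hv.pd_of_sub_const i) hu.contDiffAt l).eq.symm
  unfold divDivSchouten divCovector
  have hI : ∀ i j, (rescale u G x)⁻¹ i j = (G x)⁻¹ i j := fun i j =>
    (agreesTo_rescale_inv hG hu hv i j).eq
  have hΓ : ∀ k i j, christoffel (rescale u G) x k i j = christoffel G x k i j := fun k i j =>
    (agreesTo_christoffel_rescale hG hu hv k i j).eq
  have h3 : ∀ i j, (G x)⁻¹ i j * (pd i (fun y => divSchouten G y j) x
      + (pd i (pd j (lapLeading G u)) x - ∑ l, b l x * pd i (pd j (pd l u)) x)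
      - ∑ k, christoffel G x k i j * divSchouten G x k) =
      (G x)⁻¹ i j * (pd i (fun y => divSchouten G y j) x
        - ∑ k, christoffel G x k i j * divSchouten G x k)
      + (G x)⁻¹ i j * pd i (pd j (lapLeading G u)) x
      - ∑ l, b l x * ((G x)⁻¹ i j * pd i (pd j (pd l u)) x) := fun i j => by
    have : ∑ l, b l x * ((G x)⁻¹ i j * pd i (pd j (pd l u)) x) =
        (G x)⁻¹ i j * ∑ l, b l x * pd i (pd j (pd l u)) x := by
      rw [Finset.mul_sum]
      exact Finset.sum_congr rfl fun l _ => by ring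
    rw [this]; ring
  simp only [hdα, hI, hΓ, hα0, h3, Finset.sum_add_distrib, Finset.sum_sub_distrib]
  have h4 : ∑ i, ∑ j, ∑ l, b l x * ((G x)⁻¹ i j * pd i (pd j (pd l u)) x) = 0 := by
    have : ∀ i, ∑ j, ∑ l, b l x * ((G x)⁻¹ i j * pd i (pd j (pd l u)) x) =
        ∑ l, b l x * ∑ j, (G x)⁻¹ i j * pd i (pd j (pd l u)) x := fun i => by
      rw [Finset.sum_comm]
      simp only [Finset.mul_sum]
    simp only [this]
    rw [Finset.sum_comm]
    simp only [← Finset.mul_sum, hL, mul_zero, Finset.sum_const_zero]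
  rw [h4, sub_zero]
  rfl

/-- Equality of the Schouten tensor and its divergences for two metrics with the same one-jet of
the scale. -/
theorem osculatesZero_sub_one_iff (hn : 2 < n) (hG : IsMetricNear G x) (hu : IsFactorNear u x)
    (h1 : u x = 1) (hd : ∀ i, pd i u x = 0) :
    OsculatesZero G (fun y => u y - 1) x ↔
      schouten (rescale u G) x = schouten G x ∧ divSchouten (rescale u G) x = divSchouten G x ∧
        divDivSchouten (rescale u G) x = divDivSchouten G x := by
  constructor
  · intro h
    have hv := h.vanishesTo
    have ht := h.pd_lapLeading
    have hl := h.lapLeading_lapLeading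
    simp only [lapLeading_sub_const] at ht hl
    refine ⟨schouten_rescale_of_vanishesTo hn hG hu hv, funext fun i => ?_, ?_⟩
    · rw [divSchouten_rescale_of_vanishesTo hn hG hu hv, ht, add_zero]
    · rw [divDivSchouten_rescale_of_vanishesTo hn hG hu hv ht, hl, add_zero]
  · rintro ⟨hP, hdiv, hdd⟩
    have hv : VanishesTo x 3 fun y => u y - 1 := by
      refine vanishesTo_three (hu.contDiffAt.sub contDiffAt_const) (by simp [h1])
        (fun i => by rw [pd_sub_const, hd]) fun i j => ?_
      -- With u = 1 and du = 0 at x, the transformation law reduces to P̂ = P + ∂∂u.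
      have := congrFun (congrFun hP i) j
      rw [schouten_rescale hn hG hu, hess] at this
      simp [covectorSq, hd, h1] at this
      rwa [pd_sub_const]
    have ht : ∀ i, pd i (lapLeading G u) x = 0 := fun i => by
      have := congrFun hdiv i
      rw [divSchouten_rescale_of_vanishesTo hn hG hu hv] at this
      linarith
    rw [divDivSchouten_rescale_of_vanishesTo hn hG hu hv ht] at hdd
    refine ⟨hv, ?_, ?_⟩
    · rwa [lapLeading_sub_const]
    · rw [lapLeading_sub_const]; linarith

end Comparison

/-! ### Linearity and locality of the tractor D-operator -/

section TractorCalculus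

variable {n : ℕ} {x : EuclideanSpace ℝ (Fin n)}
  {G : EuclideanSpace ℝ (Fin n) → Matrix (Fin n) (Fin n) ℝ}
  {F : Type*} [NormedAddCommGroup F] [NormedSpace ℝ F] {A : ConnectionForm n F}
  {V W : EuclideanSpace ℝ (Fin n) → F}

theorem covDeriv_eventuallyEq (h : V =ᶠ[𝓝 x] W) (j : Fin n) :
    (fun y => covDeriv A V y j) =ᶠ[𝓝 x] fun y => covDeriv A W y j := by
  filter_upwards [pd_eventuallyEq h j, h] with y h1 h2
  simp only [covDeriv, h1, h2]

theorem tractorD_congr (w : ℤ) (h : V =ᶠ[𝓝 x] W) : tractorD G A w V x = tractorD G A w W x := by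
  have h1 := fun j => covDeriv_eventuallyEq (A := A) h j
  have h2 : ∀ j, covDeriv A V x j = covDeriv A W x j := fun j => (h1 j).eq_of_nhds
  have h3 : ∀ i j, covDeriv A (fun z => covDeriv A V z j) x i =
      covDeriv A (fun z => covDeriv A W z j) x i := fun i j =>
    (covDeriv_eventuallyEq (A := A) (h1 j) i).eq_of_nhds
  simp only [tractorD, laplacian, h2, h3, h.eq_of_nhds]

/-- A connection form that is additive on the fibres and maps smooth sections to smooth
sections. -/
structure IsRegularConnection (A : ConnectionForm n F) (x : EuclideanSpace ℝ (Fin n)) : Prop where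
  sub : ∀ y j v w, A y j (v - w) = A y j v - A y j w
  contDiffAt : ∀ (V : EuclideanSpace ℝ (Fin n) → F) (j : Fin n), ContDiffAt ℝ ∞ V x →
    ContDiffAt ℝ ∞ (fun y => A y j (V y)) x

theorem IsRegularConnection.covDeriv (hA : IsRegularConnection A x) (hV : ContDiffAt ℝ ∞ V x)
    (j : Fin n) : ContDiffAt ℝ ∞ (fun y => covDeriv A V y j) x :=
  (ContDiffAt.pd hV j).add (hA.contDiffAt V j hV)

theorem IsRegularConnection.covDeriv_sub (hA : IsRegularConnection A x) (hV : ContDiffAt ℝ ∞ V x)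
    (hW : ContDiffAt ℝ ∞ W x) (j : Fin n) :
    (fun y => ConformalOsculation.covDeriv A (fun z => V z - W z) y j) =ᶠ[𝓝 x]
      fun y => ConformalOsculation.covDeriv A V y j - ConformalOsculation.covDeriv A W y j := by
  filter_upwards [eventually_differentiableAt hV, eventually_differentiableAt hW] with y h1 h2
  simp only [ConformalOsculation.covDeriv, pd_sub h1 h2, hA.sub]
  abel

/-- Reduces the comparison of two scales to the vanishing of D and D² on a single function, their
difference. -/
theorem tractorD_sub (hA : IsRegularConnection A x) (w : ℤ) (hV : ContDiffAt ℝ ∞ V x)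
    (hW : ContDiffAt ℝ ∞ W x) :
    tractorD G A w (fun y => V y - W y) x = tractorD G A w V x - tractorD G A w W x := by
  have h1 := fun j => hA.covDeriv_sub hV hW j
  have h2 : ∀ j, covDeriv A (fun y => V y - W y) x j = covDeriv A V x j - covDeriv A W x j :=
    fun j => (h1 j).eq_of_nhds
  have h3 : ∀ i j, covDeriv A (fun z => covDeriv A (fun y => V y - W y) z j) x i =
      covDeriv A (fun z => covDeriv A V z j) x i - covDeriv A (fun z => covDeriv A W z j) x i :=
    fun i j => ((covDeriv_eventuallyEq (A := A) (h1 j) i).trans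
      (hA.covDeriv_sub (hA.covDeriv hV j) (hA.covDeriv hW j) i)).eq_of_nhds
  have hL : laplacian G A (fun y => V y - W y) x = laplacian G A V x - laplacian G A W x := by
    simp only [laplacian, h2, h3, smul_sub, Finset.sum_sub_distrib]
    abel
  refine Prod.ext ?_ (Prod.ext (funext fun i => ?_) ?_)
  · simp only [tractorD, hL, Prod.fst_sub, smul_sub]
    abel
  · simp only [tractorD, h2, Prod.snd_sub, Prod.fst_sub, Pi.sub_apply, smul_sub,
      Finset.sum_sub_distrib]
  · simp only [tractorD, Prod.snd_sub, smul_sub]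

theorem isRegularConnection_density : IsRegularConnection (densityConnection n) x :=
  ⟨fun _ _ _ _ => by simp [densityConnection], fun _ _ _ => contDiffAt_const⟩

theorem contDiffAt_tractor {a c : EuclideanSpace ℝ (Fin n) → ℝ}
    {b : EuclideanSpace ℝ (Fin n) → Fin n → ℝ} (ha : ContDiffAt ℝ ∞ a x)
    (hb : ∀ i, ContDiffAt ℝ ∞ (fun y => b y i) x) (hc : ContDiffAt ℝ ∞ c x) :
    ContDiffAt ℝ ∞ (fun y => ((a y, b y, c y) : Tractor n)) x :=
  ha.prodMk ((contDiffAt_pi.mpr hb).prodMk hc)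

theorem IsMetricAt.isRegularConnection (hG : IsMetricAt G x) :
    IsRegularConnection (tractorConnection G) x where
  sub y j v w := by
    refine Prod.ext ?_ (Prod.ext (funext fun i => ?_) ?_)
    · simp only [tractorConnection, Prod.fst_sub, Prod.snd_sub, Pi.sub_apply, mul_sub,
        Finset.sum_sub_distrib]
      ring
    · simp only [tractorConnection, Prod.fst_sub, Prod.snd_sub, Pi.sub_apply, mul_sub,
        Finset.sum_sub_distrib]
      split_ifs <;> ring
    · simp only [tractorConnection, Prod.fst_sub, Prod.snd_sub, Pi.sub_apply, mul_sub,
        Finset.sum_sub_distrib]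
      ring
  contDiffAt V j hV := by
    have h1 : ContDiffAt ℝ ∞ (fun y => (V y).1) x := hV.fst
    have h2 : ∀ i, ContDiffAt ℝ ∞ (fun y => (V y).2.1 i) x := contDiffAt_pi.mp hV.snd.fst
    have h3 : ContDiffAt ℝ ∞ (fun y => (V y).2.2) x := hV.snd.snd
    unfold tractorConnection
    refine contDiffAt_tractor ?_ (fun i => ?_) ?_
    · exact (ContDiffAt.sum fun i _ => (hG.contDiffAt_schouten j i).mul (h2 i)).neg
    · refine ((ContDiffAt.sum fun k _ => (hG.contDiffAt_christoffel i j k).mul (h2 k)).add ?_).add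
        ((ContDiffAt.sum fun k _ => (hG.contDiffAt_inv i k).mul
          (hG.contDiffAt_schouten j k)).mul h3)
      split_ifs
      exacts [h1, contDiffAt_const]
    · exact (ContDiffAt.sum fun i _ => (hG.contDiffAt j i).mul (h2 i)).neg

theorem pd_tractor {a c : EuclideanSpace ℝ (Fin n) → ℝ}
    {b : EuclideanSpace ℝ (Fin n) → Fin n → ℝ} (ha : DifferentiableAt ℝ a x)
    (hb : ∀ i, DifferentiableAt ℝ (fun y => b y i) x) (hc : DifferentiableAt ℝ c x) (j : Fin n) :
    pd j (fun y => ((a y, b y, c y) : Tractor n)) x =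
      (pd j a x, fun i => pd j (fun y => b y i) x, pd j c x) := by
  have hb' : HasFDerivAt b (ContinuousLinearMap.pi fun i => fderiv ℝ (fun y => b y i) x) x :=
    hasFDerivAt_pi.mpr fun i => (hb i).hasFDerivAt
  have := (ha.hasFDerivAt.prodMk (hb'.prodMk hc.hasFDerivAt)).fderiv
  unfold pd
  rw [this]
  rfl

/-- Raising an index is invertible. The coefficients may lie in any normed space, since this is also
applied to the tractors ∇_j(Dh). -/
theorem IsMetricAt.eq_zero_of_sum_inv_smul (hG : IsMetricAt G x) {c : Fin n → F}
    (h : ∀ i, ∑ j, (G x)⁻¹ i j • c j = 0) (k : Fin n) : c k = 0 := by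
  have h1 : ∑ i, G x k i • ∑ j, (G x)⁻¹ i j • c j = c k := by
    simp only [Finset.smul_sum, smul_smul]
    rw [Finset.sum_comm]
    simp [← Finset.sum_smul, hG.sum_mul_inv]
  rw [← h1]
  simp [h]

end TractorCalculus

/-! ### Vanishing of D and D² on a density of weight one -/

section Density

variable {n : ℕ} {x : EuclideanSpace ℝ (Fin n)}
  {G : EuclideanSpace ℝ (Fin n) → Matrix (Fin n) (Fin n) ℝ} {h : EuclideanSpace ℝ (Fin n) → ℝ}

/-- The coefficients `b^l = g^{ij} Γ^l_{ij}`. -/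
def contractedChristoffel (G : EuclideanSpace ℝ (Fin n) → Matrix (Fin n) (Fin n) ℝ) (l : Fin n)
    (y : EuclideanSpace ℝ (Fin n)) : ℝ := ∑ i, ∑ j, (G y)⁻¹ i j * christoffel G y l i j

theorem IsMetricAt.contDiffAt_contractedChristoffel (hG : IsMetricAt G x) (l : Fin n) :
    ContDiffAt ℝ ∞ (contractedChristoffel G l) x :=
  ContDiffAt.sum fun i _ => ContDiffAt.sum fun j _ =>
    (hG.contDiffAt_inv i j).mul (hG.contDiffAt_christoffel l i j)

theorem laplacian_density (h : EuclideanSpace ℝ (Fin n) → ℝ) (y : EuclideanSpace ℝ (Fin n)) :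
    laplacian G (densityConnection n) h y =
      lapLeading G h y - ∑ l, contractedChristoffel G l y * pd l h y := by
  have e : ∀ j, (fun z => pd j h z) = pd j h := fun j => rfl
  simp only [laplacian, covDeriv, densityConnection, add_zero, smul_eq_mul, lapLeading,
    contractedChristoffel, mul_sub, Finset.sum_sub_distrib, Finset.sum_mul, e]
  congr 1
  simp only [Finset.mul_sum, ← mul_assoc]
  conv_lhs => enter [2, i]; rw [Finset.sum_comm]
  rw [Finset.sum_comm]

/-- The `X`-component of `D h`. -/
def tractorDTop (G : EuclideanSpace ℝ (Fin n) → Matrix (Fin n) (Fin n) ℝ)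
    (h : EuclideanSpace ℝ (Fin n) → ℝ) (y : EuclideanSpace ℝ (Fin n)) : ℝ :=
  - (lapLeading G h y + (- (∑ l, contractedChristoffel G l y * pd l h y)
    + schoutenTrace G y * h y))

theorem tractorD_density (h : EuclideanSpace ℝ (Fin n) → ℝ) (y : EuclideanSpace ℝ (Fin n)) :
    tractorD G (densityConnection n) 1 h y =
      (tractorDTop G h y, fun i => ∑ l, (n * (G y)⁻¹ i l) * pd l h y, n * h y) := by
  refine Prod.ext ?_ (Prod.ext (funext fun i => ?_) ?_)
  · simp only [tractorD, laplacian_density, tractorDTop, smul_eq_mul]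
    push_cast
    ring
  · simp only [tractorD, covDeriv, densityConnection, smul_eq_mul, Finset.mul_sum]
    refine Finset.sum_congr rfl fun l _ => ?_
    push_cast
    ring
  · simp only [tractorD, smul_eq_mul]
    push_cast
    ring

theorem IsMetricAt.contDiffAt_tractorDTop (hG : IsMetricAt G x) (hh : ContDiffAt ℝ ∞ h x) :
    ContDiffAt ℝ ∞ (tractorDTop G h) x :=
  ((hG.contDiffAt_lapLeading hh).add ((ContDiffAt.sum fun l _ =>
    (hG.contDiffAt_contractedChristoffel l).mul (ContDiffAt.pd hh l)).neg.add
      (hG.contDiffAt_schoutenTrace.mul hh))).neg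

theorem IsMetricAt.contDiffAt_tractorD (hG : IsMetricAt G x) (hh : ContDiffAt ℝ ∞ h x) :
    ContDiffAt ℝ ∞ (tractorD G (densityConnection n) 1 h) x := by
  have : tractorD G (densityConnection n) 1 h = fun y =>
      (tractorDTop G h y, fun i => ∑ l, (n * (G y)⁻¹ i l) * pd l h y, n * h y) :=
    funext fun y => tractorD_density h y
  rw [this]
  exact contDiffAt_tractor (hG.contDiffAt_tractorDTop hh) (fun i => ContDiffAt.sum fun l _ =>
    (contDiffAt_const.mul (hG.contDiffAt_inv i l)).mul (ContDiffAt.pd hh l))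
    (contDiffAt_const.mul hh)

/-- For weight 1 the factor n + 2w − 2 is n, so the Y and Z slots recover the one-jet of h. -/
theorem tractorD_density_eq_zero (hn : 0 < n) (hG : IsMetricAt G x)
    (hD : tractorD G (densityConnection n) 1 h x = 0) : h x = 0 ∧ ∀ i, pd i h x = 0 := by
  have hn' : (n : ℝ) ≠ 0 := by exact_mod_cast hn.ne'
  rw [tractorD_density] at hD
  obtain ⟨-, hD⟩ := Prod.ext_iff.mp hD
  obtain ⟨h1, h2⟩ := Prod.ext_iff.mp hD
  refine ⟨(mul_eq_zero.mp h2).resolve_left hn', fun k => ?_⟩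
  refine hG.eq_zero_of_sum_inv_smul (c := fun l => pd l h x) (fun i => ?_) k
  have := congrFun h1 i
  simp only [mul_assoc, ← Finset.mul_sum] at this
  exact (mul_eq_zero.mp this).resolve_left hn'

/-- The `X`-component of `D h` up to terms that vanish to second order. -/
theorem agreesTo_tractorDTop (hG : IsMetricAt G x) (hh : VanishesTo x 3 h) :
    AgreesTo x 2 (tractorDTop G h) (fun y => - lapLeading G h y) := by
  have h1 : VanishesTo x 2 fun y => ∑ l, contractedChristoffel G l y * pd l h y :=
    VanishesTo.sum _ fun l _ => VanishesTo.contDiffAt_mul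
      (hG.contDiffAt_contractedChristoffel l) (hh.pd l)
  have h2 : VanishesTo x 2 fun y => schoutenTrace G y * h y :=
    VanishesTo.contDiffAt_mul hG.contDiffAt_schoutenTrace hh.of_succ
  refine ⟨hG.contDiffAt_tractorDTop hh.contDiffAt, (hG.contDiffAt_lapLeading hh.contDiffAt).neg,
    (h1.sub h2).congr (Eventually.of_forall fun y => ?_)⟩
  simp only [tractorDTop]
  ring

/-- `agreesTo_tractorDTop` is one order too weak for a second Laplacian. The first-order terms need
`lapLeading_sum_mul_pd`, hence the gradient hypothesis. -/
theorem lapLeading_tractorDTop (hG : IsMetricAt G x) (hh : VanishesTo x 3 h)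
    (ht : ∀ i, pd i (lapLeading G h) x = 0) :
    lapLeading G (tractorDTop G h) x = - lapLeading G (lapLeading G h) x := by
  have hz : VanishesTo x 3 fun y => schoutenTrace G y * h y :=
    VanishesTo.contDiffAt_mul hG.contDiffAt_schoutenTrace hh
  have hw := hG.contDiffAt_lapLeading hh.contDiffAt
  have hbc : ∀ l, ContDiffAt ℝ ∞ (fun y => - contractedChristoffel G l y) x := fun l =>
    (hG.contDiffAt_contractedChristoffel l).neg
  have hs : ContDiffAt ℝ ∞ (fun y => ∑ l, - contractedChristoffel G l y * pd l h y) x :=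
    ContDiffAt.sum fun l _ => (hbc l).mul (hh.pd l).contDiffAt
  have e : tractorDTop G h = fun y => (-1) * (lapLeading G h y +
      ((∑ l, - contractedChristoffel G l y * pd l h y) + schoutenTrace G y * h y)) := by
    funext y
    simp only [tractorDTop, neg_mul, Finset.sum_neg_distrib, one_mul]
  rw [e, (lapLeading_const_mul _ (hw.add (hs.add hz.contDiffAt))).eq_of_nhds,
    (lapLeading_add hw (hs.add hz.contDiffAt)).eq_of_nhds,
    (lapLeading_add hs hz.contDiffAt).eq_of_nhds, lapLeading_of_vanishesTo_three hz,
    lapLeading_sum_mul_pd hG hh ht hbc]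
  ring

theorem tractorConnection_zero (y : EuclideanSpace ℝ (Fin n)) (j : Fin n) :
    tractorConnection G y j 0 = 0 := by
  refine Prod.ext ?_ (Prod.ext (funext fun i => ?_) ?_) <;> simp [tractorConnection]

/-- If `h` vanishes to third order and its contracted third derivatives are zero, the tractor
Laplacian of `D h` is a multiple of `X`. -/
theorem laplacian_tractorD (hG : IsMetricAt G x) (hh : VanishesTo x 3 h)
    (ht : ∀ i, pd i (lapLeading G h) x = 0) :
    (∀ j, covDeriv (tractorConnection G) (tractorD G (densityConnection n) 1 h) x j = 0) ∧
    laplacian G (tractorConnection G) (tractorD G (densityConnection n) 1 h) x =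
      (- lapLeading G (lapLeading G h) x, 0, 0) := by
  set μ : EuclideanSpace ℝ (Fin n) → Fin n → ℝ :=
    fun y i => ∑ l, (n * (G y)⁻¹ i l) * pd l h y with hμdef
  have hD : tractorD G (densityConnection n) 1 h = fun y => (tractorDTop G h y, μ y, n * h y) :=
    funext fun y => tractorD_density h y
  have hnG : ∀ i l, ContDiffAt ℝ ∞ (fun y => (n : ℝ) * (G y)⁻¹ i l) x := fun i l =>
    contDiffAt_const.mul (hG.contDiffAt_inv i l)
  -- The three slots of Dh vanish to orders 2, 2 and 3; for the X slot this uses `ht`. Connection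
  -- terms therefore do not affect second covariant derivatives at x.
  have hρ : VanishesTo x 2 (tractorDTop G h) := (agreesTo_tractorDTop hG hh).vanishesTo
    (vanishesTo_two_lapLeading hG hh ht).neg
  have hμ : ∀ i, VanishesTo x 2 fun y => μ y i := fun i =>
    VanishesTo.sum _ fun l _ => VanishesTo.contDiffAt_mul (hnG i l) (hh.pd l)
  have hσ : VanishesTo x 3 fun y => (n : ℝ) * h y := VanishesTo.contDiffAt_mul contDiffAt_const hh
  -- The Z slots are first-order expressions in h, so their Laplacian vanishes at x by the same
  -- contraction of third derivatives.
  have hμL : ∀ i, lapLeading G (fun y => μ y i) x = 0 := fun i =>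
    lapLeading_sum_mul_pd hG hh ht (hnG i)
  -- the components of the covariant derivative
  set a : Fin n → EuclideanSpace ℝ (Fin n) → ℝ :=
    fun j y => pd j (tractorDTop G h) y - ∑ i, schouten G y j i * μ y i with ha
  set b : Fin n → Fin n → EuclideanSpace ℝ (Fin n) → ℝ :=
    fun j i y => pd j (fun z => μ z i) y + ((∑ k, christoffel G y i j k * μ y k)
      + (if i = j then tractorDTop G h y else 0)
      + (∑ k, (G y)⁻¹ i k * schouten G y j k) * (n * h y)) with hb
  set c : Fin n → EuclideanSpace ℝ (Fin n) → ℝ :=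
    fun j y => pd j (fun z => (n : ℝ) * h z) y - ∑ i, G y j i * μ y i with hc
  have hcov : ∀ j, (fun y => covDeriv (tractorConnection G)
      (tractorD G (densityConnection n) 1 h) y j) =ᶠ[𝓝 x]
        fun y => (a j y, fun i => b j i y, c j y) := by
    intro j
    have e1 : ∀ᶠ y in 𝓝 x, ∀ i, DifferentiableAt ℝ (fun z => μ z i) y :=
      eventually_all.mpr fun i => eventually_differentiableAt (hμ i).contDiffAt
    filter_upwards [eventually_differentiableAt hρ.contDiffAt, e1,
      eventually_differentiableAt hσ.contDiffAt] with y h1 h2 h3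
    rw [covDeriv, hD, pd_tractor h1 h2 h3]
    refine Prod.ext ?_ (Prod.ext (funext fun i => ?_) ?_)
    · simp [tractorConnection, ha, sub_eq_add_neg]
    · simp [tractorConnection, hb]
    · simp [tractorConnection, hc, sub_eq_add_neg]
  have ha' : ∀ j, AgreesTo x 2 (a j) (pd j (tractorDTop G h)) := fun j => by
    have : VanishesTo x 2 fun y => ∑ i, schouten G y j i * μ y i :=
      VanishesTo.sum _ fun i _ => VanishesTo.contDiffAt_mul (hG.contDiffAt_schouten j i) (hμ i)
    exact ⟨(ContDiffAt.pd hρ.contDiffAt j).sub this.contDiffAt, ContDiffAt.pd hρ.contDiffAt j,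
      this.neg.congr (Eventually.of_forall fun y => by simp only [ha]; ring)⟩
  have hb' : ∀ j i, AgreesTo x 2 (b j i) (pd j fun z => μ z i) := fun j i => by
    have : VanishesTo x 2 fun y => (∑ k, christoffel G y i j k * μ y k)
      + (if i = j then tractorDTop G h y else 0)
      + (∑ k, (G y)⁻¹ i k * schouten G y j k) * (n * h y) := by
      refine (VanishesTo.add (VanishesTo.sum _ fun k _ =>
        VanishesTo.contDiffAt_mul (hG.contDiffAt_christoffel i j k) (hμ k)) ?_).add
        (VanishesTo.contDiffAt_mul (ContDiffAt.sum fun k _ =>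
          (hG.contDiffAt_inv i k).mul (hG.contDiffAt_schouten j k)) hσ.of_succ)
      split_ifs
      exacts [hρ, vanishesTo_zero_fun 2]
    exact ⟨(ContDiffAt.pd (hμ i).contDiffAt j).add this.contDiffAt,
      ContDiffAt.pd (hμ i).contDiffAt j,
      this.congr (Eventually.of_forall fun y => by simp only [hb]; ring)⟩
  have hc' : ∀ j, VanishesTo x 2 (c j) := fun j =>
    (hσ.pd j).sub (VanishesTo.sum _ fun i _ => VanishesTo.contDiffAt_mul (hG.contDiffAt j i) (hμ i))
  have hzero : ∀ j, covDeriv (tractorConnection G)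
      (tractorD G (densityConnection n) 1 h) x j = 0 := fun j => by
    rw [(hcov j).eq_of_nhds, (ha' j).eq, (hρ.pd j).eq_zero, (hc' j).eq_zero]
    refine Prod.ext rfl (Prod.ext (funext fun i => ?_) rfl)
    change b j i x = 0
    rw [(hb' j i).eq, ((hμ i).pd j).eq_zero]
  refine ⟨hzero, ?_⟩
  have hsecond : ∀ i j, covDeriv (tractorConnection G) (fun z => covDeriv (tractorConnection G)
      (tractorD G (densityConnection n) 1 h) z j) x i =
      (pd i (pd j (tractorDTop G h)) x, fun m => pd i (pd j fun z => μ z m) x, 0) := fun i j => by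
    rw [covDeriv, hzero, tractorConnection_zero, add_zero, pd_congr (hcov j),
      pd_tractor (differentiableAt_of_contDiffAt (ha' j).left)
      (fun m => differentiableAt_of_contDiffAt (hb' j m).left) (hc' j).differentiableAt]
    refine Prod.ext ((ha' j).pd i).eq (Prod.ext (funext fun m => ((hb' j m).pd i).eq) ?_)
    exact ((hc' j).pd i).eq_zero
  simp only [laplacian, hsecond, hzero, smul_zero, Finset.sum_const_zero, sub_zero]
  refine Prod.ext ?_ (Prod.ext (funext fun m => ?_) ?_)
  · simp only [Prod.fst_sum, Prod.smul_fst, smul_eq_mul]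
    exact lapLeading_tractorDTop hG hh ht
  · simp only [Prod.snd_sum, Prod.fst_sum, Prod.smul_fst, Prod.smul_snd, Finset.sum_apply,
      Pi.smul_apply, smul_eq_mul, Pi.zero_apply]
    exact hμL m
  · simp [Prod.snd_sum]

/-- Vanishing of `h`, `D h` and `D² h` at a point. -/
theorem tractorD_eq_zero_iff (hn : 2 < n) (hG : IsMetricAt G x) (hh : ContDiffAt ℝ ∞ h x) :
    (h x = 0 ∧ tractorD G (densityConnection n) 1 h x = 0 ∧
      tractorD G (tractorConnection G) 0 (tractorD G (densityConnection n) 1 h) x = 0) ↔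
      OsculatesZero G h x := by
  have hn' : (2 : ℝ) < n := by exact_mod_cast hn
  have hn0 : (n : ℝ) ≠ 0 := by linarith
  have hn2 : (n : ℝ) - 2 ≠ 0 := by linarith
  constructor
  · rintro ⟨-, hD, hDD⟩
    obtain ⟨h0, h1⟩ := tractorD_density_eq_zero (by omega) hG hD
    obtain ⟨hDD1, hDD⟩ := Prod.ext_iff.mp hDD
    obtain ⟨hDD2, -⟩ := Prod.ext_iff.mp hDD
    have hcov : ∀ j, covDeriv (tractorConnection G)
        (tractorD G (densityConnection n) 1 h) x j = 0 := by
      -- Dh has weight 0, so its Z slot under D carries the factor n − 2, nonzero since n > 2; the Y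
      -- slot of D²h is zero and gives nothing.
      refine fun j => hG.eq_zero_of_sum_inv_smul (fun i => ?_) j
      have := congrFun hDD2 i
      simp only [tractorD, Int.cast_zero, mul_zero, add_zero, Prod.snd_zero, Prod.fst_zero,
        Pi.zero_apply] at this
      exact (smul_eq_zero.mp this).resolve_left hn2
    have hdiff : ∀ i, DifferentiableAt ℝ (fun y => ∑ l, ((n : ℝ) * (G y)⁻¹ i l) * pd l h y) x :=
      fun i => differentiableAt_of_contDiffAt (ContDiffAt.sum fun l _ =>
        (contDiffAt_const.mul (hG.contDiffAt_inv i l)).mul (ContDiffAt.pd hh l))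
    -- As Dh = 0 at x, the connection form drops out of ∇(Dh), and the ordinary derivatives of all
    -- slots vanish.
    have hpd : ∀ j, ((pd j (tractorDTop G h) x,
        fun i => pd j (fun y => ∑ l, ((n : ℝ) * (G y)⁻¹ i l) * pd l h y) x,
        pd j (fun y => (n : ℝ) * h y) x) : Tractor n) = 0 := fun j => by
      have := hcov j
      have e : tractorD G (densityConnection n) 1 h = fun y => (tractorDTop G h y,
        fun i => ∑ l, ((n : ℝ) * (G y)⁻¹ i l) * pd l h y, (n : ℝ) * h y) :=
        funext fun y => tractorD_density h y
      rw [covDeriv, hD, tractorConnection_zero, add_zero, e,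
        pd_tractor (differentiableAt_of_contDiffAt (hG.contDiffAt_tractorDTop hh)) hdiff
        (differentiableAt_of_contDiffAt (contDiffAt_const.mul hh))] at this
      exact this
    -- Read from the Z slots n g^{il}∂_l h: derivatives of g^{il} are multiplied by dh, already
    -- zero.
    have h2 : ∀ j k, pd j (pd k h) x = 0 := fun j k => by
      refine hG.eq_zero_of_sum_inv_smul (c := fun k => pd j (pd k h) x) (fun i => ?_) k
      have := congrFun (Prod.ext_iff.mp (Prod.ext_iff.mp (hpd j)).2).1 i
      simp only [Prod.snd_zero, Prod.fst_zero, Pi.zero_apply] at this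
      rw [pd_sum _ (fun l _ => differentiableAt_of_contDiffAt
        ((contDiffAt_const.mul (hG.contDiffAt_inv i l)).mul (ContDiffAt.pd hh l)))] at this
      have e : ∀ l, pd j (fun y => (n : ℝ) * (G y)⁻¹ i l * pd l h y) x =
          n * ((G x)⁻¹ i l * pd j (pd l h) x) := fun l => by
        rw [pd_mul (differentiableAt_of_contDiffAt (contDiffAt_const.mul (hG.contDiffAt_inv i l)))
          (differentiableAt_of_contDiffAt (ContDiffAt.pd hh l)), h1]
        ring
      simp only [e, ← Finset.mul_sum] at this
      exact (mul_eq_zero.mp this).resolve_left hn0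
    have hv : VanishesTo x 3 h := vanishesTo_three hh h0 h1 h2
    -- Read from the X slot, which is −Lh up to second order once the two-jet of h vanishes.
    have ht : ∀ i, pd i (lapLeading G h) x = 0 := fun i => by
      have := (Prod.ext_iff.mp (hpd i)).1
      simp only [((agreesTo_tractorDTop hG hv).pd i).eq, pd_neg, Prod.fst_zero] at this
      linarith
    refine ⟨hv, ht, ?_⟩
    have h3 : -(laplacian G (tractorConnection G) (tractorD G (densityConnection n) 1 h) x
        + (((0 : ℤ) : ℝ) * schoutenTrace G x) • tractorD G (densityConnection n) 1 h x) = 0 := hDD1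
    rw [hD, smul_zero, add_zero, (laplacian_tractorD hG hv ht).2] at h3
    simpa using (Prod.ext_iff.mp h3).1
  · intro hO
    obtain ⟨hcov, hlap⟩ := laplacian_tractorD hG hO.vanishesTo hO.pd_lapLeading
    have hD : tractorD G (densityConnection n) 1 h x = 0 := by
      rw [tractorD_density, (agreesTo_tractorDTop hG hO.vanishesTo).eq,
        lapLeading_of_vanishesTo_three hO.vanishesTo, hO.vanishesTo.eq_zero]
      refine Prod.ext (by simp) (Prod.ext (funext fun i => ?_) (by simp))
      simp [(hO.vanishesTo.pd _).eq_zero]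
    refine ⟨hO.vanishesTo.eq_zero, hD, ?_⟩
    refine Prod.ext ?_ (Prod.ext (funext fun i => ?_) ?_)
    · change -(laplacian G (tractorConnection G) (tractorD G (densityConnection n) 1 h) x
        + (((0 : ℤ) : ℝ) * schoutenTrace G x) • tractorD G (densityConnection n) 1 h x) = 0
      rw [hD, smul_zero, add_zero, hlap, hO.lapLeading_lapLeading]
      simp
    · change _ • ∑ j, (G x)⁻¹ i j • covDeriv (tractorConnection G)
        (tractorD G (densityConnection n) 1 h) x j = (0 : Tractor n)
      simp only [hcov, smul_zero, Finset.sum_const_zero]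
    · change _ • tractorD G (densityConnection n) 1 h x = (0 : Tractor n)
      rw [hD, smul_zero]

end Density

/-! ### Cubic and quartic polynomials with prescribed contracted derivatives -/

section Polynomials

variable {n : ℕ} {x : EuclideanSpace ℝ (Fin n)}
  {G : EuclideanSpace ℝ (Fin n) → Matrix (Fin n) (Fin n) ℝ}

theorem contDiff_coord_sub (x : EuclideanSpace ℝ (Fin n)) (i : Fin n) :
    ContDiff ℝ ∞ fun y : EuclideanSpace ℝ (Fin n) => y i - x i :=
  (EuclideanSpace.proj (𝕜 := ℝ) i).contDiff.sub contDiff_const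

theorem pd_coord_sub (x y : EuclideanSpace ℝ (Fin n)) (i j : Fin n) :
    pd j (fun z : EuclideanSpace ℝ (Fin n) => z i - x i) y = if i = j then 1 else 0 := by
  rw [pd_sub_const]
  have h : (fun z : EuclideanSpace ℝ (Fin n) => z i) = EuclideanSpace.proj (𝕜 := ℝ) i := rfl
  rw [pd, h, ContinuousLinearMap.fderiv]
  simp

theorem vanishesTo_coord_sub (x : EuclideanSpace ℝ (Fin n)) (i : Fin n) :
    VanishesTo x 1 fun y : EuclideanSpace ℝ (Fin n) => y i - x i :=
  vanishesTo_one (contDiff_coord_sub x i).contDiffAt (sub_self _)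

/-- The linear form with coefficients `c`, centred at `x`. -/
def linearAt (c : Fin n → ℝ) (x y : EuclideanSpace ℝ (Fin n)) : ℝ := ∑ i, c i * (y i - x i)

/-- The quadratic form with matrix `B`, centred at `x`. -/
def quadraticAt (B : Matrix (Fin n) (Fin n) ℝ) (x y : EuclideanSpace ℝ (Fin n)) : ℝ :=
  ∑ i, ∑ j, B i j * ((y i - x i) * (y j - x j))

theorem contDiff_linearAt (c : Fin n → ℝ) (x : EuclideanSpace ℝ (Fin n)) :
    ContDiff ℝ ∞ (linearAt c x) :=
  ContDiff.sum fun i _ => contDiff_const.mul (contDiff_coord_sub x i)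

theorem contDiff_quadraticAt (B : Matrix (Fin n) (Fin n) ℝ) (x : EuclideanSpace ℝ (Fin n)) :
    ContDiff ℝ ∞ (quadraticAt B x) :=
  ContDiff.sum fun i _ => ContDiff.sum fun j _ =>
    contDiff_const.mul ((contDiff_coord_sub x i).mul (contDiff_coord_sub x j))

theorem pd_linearAt (c : Fin n → ℝ) (x : EuclideanSpace ℝ (Fin n)) (j : Fin n) :
    pd j (linearAt c x) = fun _ => c j := by
  funext y
  have hd := fun i => differentiableAt_of_contDiffAt (contDiff_coord_sub x i).contDiffAt (x := y)
  unfold linearAt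
  rw [pd_sum _ (fun i _ => (hd i).const_mul (c i))]
  simp [pd_const_mul _ (hd _), pd_coord_sub]

theorem pd_quadraticAt {B : Matrix (Fin n) (Fin n) ℝ} (hB : ∀ i j, B i j = B j i)
    (x : EuclideanSpace ℝ (Fin n)) (l : Fin n) :
    pd l (quadraticAt B x) = linearAt (fun i => 2 * B l i) x := by
  funext y
  have hd := fun i => differentiableAt_of_contDiffAt (contDiff_coord_sub x i).contDiffAt (x := y)
  have h1 : ∀ i j, pd l (fun z : EuclideanSpace ℝ (Fin n) => B i j * ((z i - x i) * (z j - x j))) y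
      = (if i = l then B i j * (y j - x j) else 0)
        + (if j = l then B i j * (y i - x i) else 0) := by
    intro i j
    rw [pd_const_mul _ ((hd i).fun_mul (hd j)), pd_mul (hd i) (hd j), pd_coord_sub, pd_coord_sub]
    split_ifs <;> ring
  have hd2 : ∀ i j, DifferentiableAt ℝ
      (fun z : EuclideanSpace ℝ (Fin n) => B i j * ((z i - x i) * (z j - x j))) y :=
    fun i j => ((hd i).fun_mul (hd j)).const_mul _
  unfold quadraticAt
  rw [pd_sum _ (fun i _ => DifferentiableAt.fun_sum fun j _ => hd2 i j)]
  have h2 : ∀ i, pd l (fun z : EuclideanSpace ℝ (Fin n) =>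
      ∑ j, B i j * ((z i - x i) * (z j - x j))) y =
      (if i = l then ∑ j, B i j * (y j - x j) else 0) + B i l * (y i - x i) := fun i => by
    rw [pd_sum _ (fun j _ => hd2 i j)]
    simp only [h1, Finset.sum_add_distrib, Finset.sum_ite_eq', Finset.mem_univ, if_true]
    split_ifs <;> simp
  simp only [h2, Finset.sum_add_distrib, Finset.sum_ite_eq', Finset.mem_univ, if_true, linearAt]
  rw [← Finset.sum_add_distrib]
  exact Finset.sum_congr rfl fun i _ => by rw [hB i l]; ring

theorem vanishesTo_linearAt (c : Fin n → ℝ) (x : EuclideanSpace ℝ (Fin n)) :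
    VanishesTo x 1 (linearAt c x) :=
  VanishesTo.sum _ fun i _ => VanishesTo.contDiffAt_mul contDiffAt_const (vanishesTo_coord_sub x i)

theorem vanishesTo_quadraticAt (B : Matrix (Fin n) (Fin n) ℝ) (x : EuclideanSpace ℝ (Fin n)) :
    VanishesTo x 2 (quadraticAt B x) :=
  VanishesTo.sum _ fun i _ => VanishesTo.sum _ fun j _ =>
    VanishesTo.contDiffAt_mul contDiffAt_const
      ((vanishesTo_coord_sub x i).mul (vanishesTo_coord_sub x j))

theorem IsMetricAt.trace_self (hG : IsMetricAt G x) :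
    ∑ i, ∑ j, (G x)⁻¹ i j * G x i j = n := by
  have : ∀ i, ∑ j, (G x)⁻¹ i j * G x i j = 1 := fun i => by
    have := hG.sum_inv_mul i i
    rw [if_pos rfl] at this
    rw [← this]
    exact Finset.sum_congr rfl fun j _ => by rw [hG.symm]
  simp [this]

theorem agreesTo_lapLeading_quadraticAt (hG : IsMetricAt G x) :
    AgreesTo x 1 (lapLeading G (quadraticAt (G x) x)) (fun _ => 2 * n) := by
  have hc := hG.contDiffAt_lapLeading (contDiff_quadraticAt (G x) x).contDiffAt
  refine ⟨hc, contDiffAt_const, vanishesTo_one (hc.sub contDiffAt_const) ?_⟩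
  simp only [lapLeading, pd_quadraticAt hG.symm, pd_linearAt]
  have : ∑ i, ∑ j, (G x)⁻¹ i j * (2 * G x j i) = 2 * ∑ i, ∑ j, (G x)⁻¹ i j * G x i j := by
    simp only [Finset.mul_sum]
    exact Finset.sum_congr rfl fun i _ => Finset.sum_congr rfl fun j _ => by
      rw [hG.symm j i]; ring
  rw [this, hG.trace_self, sub_self]

/-- Contraction of the differential of `g_{ij} z^i z^j` with a raised covector. -/
theorem sum_raise_mul_pd_quadraticAt (hG : IsMetricAt G x) (Υ : Fin n → ℝ)
    (y : EuclideanSpace ℝ (Fin n)) :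
    ∑ l, raise G x Υ l * pd l (quadraticAt (G x) x) y = 2 * linearAt Υ x y := by
  simp only [pd_quadraticAt hG.symm, linearAt, Finset.mul_sum]
  rw [Finset.sum_comm]
  refine Finset.sum_congr rfl fun i _ => ?_
  rw [← hG.sum_mul_raise Υ i, Finset.sum_mul, Finset.mul_sum]
  exact Finset.sum_congr rfl fun j _ => by rw [hG.symm i j]; ring

/-- Euler's identity for a homogeneous quadratic, used to evaluate ⟨dN, dN⟩ as 4N. -/
theorem linearAt_quadraticAt_self (B : Matrix (Fin n) (Fin n) ℝ)
    (x y : EuclideanSpace ℝ (Fin n)) :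
    linearAt (fun i => linearAt (fun j => 2 * B i j) x y) x y = 2 * quadraticAt B x y := by
  simp only [linearAt, quadraticAt, Finset.sum_mul, Finset.mul_sum]
  exact Finset.sum_congr rfl fun i _ => Finset.sum_congr rfl fun j _ => by ring

theorem lapLeading_linearAt (c : Fin n → ℝ) (y : EuclideanSpace ℝ (Fin n)) :
    lapLeading G (linearAt c x) y = 0 := by
  simp only [lapLeading, pd_linearAt]
  refine Finset.sum_eq_zero fun i _ => Finset.sum_eq_zero fun j _ => ?_
  rw [pd_const, mul_zero]

theorem AgreesTo.raise_const (hG : IsMetricAt G x) {α : EuclideanSpace ℝ (Fin n) → Fin n → ℝ}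
    {k : ℕ} (hα : ∀ j, VanishesTo x k fun y => α y j) (l : Fin n) :
    AgreesTo x (k + 1) (fun y => raise G y (α y) l) (fun y => raise G x (α y) l) := by
  unfold raise
  exact AgreesTo.sum _ fun j _ => AgreesTo.mul_of_vanishesTo (hG.contDiffAt_inv l j) (hα j)

/-- Cubic polynomials realize all contracted third derivatives. -/
theorem exists_pd_lapLeading_eq (hG : IsMetricNear G x) (c : Fin n → ℝ) :
    ∃ p : EuclideanSpace ℝ (Fin n) → ℝ, ContDiff ℝ ∞ p ∧ VanishesTo x 3 p ∧
      ∀ i, pd i (lapLeading G p) x = c i := by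
  have hx := hG.isMetricAt
  -- To leading order L(ℓN) = ℓ LN + 2⟨dℓ, dN⟩ = 2nℓ + 4ℓ.
  set m : ℝ := 2 * n + 4 with hm
  have hm0 : m ≠ 0 := by positivity
  set a : Fin n → ℝ := fun i => m⁻¹ * c i with ha
  set ℓ := linearAt a x with hℓ
  set N := quadraticAt (G x) x with hN
  have hℓ1 : VanishesTo x 1 ℓ := vanishesTo_linearAt a x
  have hN2 : VanishesTo x 2 N := vanishesTo_quadraticAt (G x) x
  refine ⟨fun y => ℓ y * N y, (contDiff_linearAt a x).mul (contDiff_quadraticAt (G x) x),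
    hℓ1.mul hN2, fun i => ?_⟩
  have h1 : AgreesTo x 2 (fun y => ℓ y * lapLeading G N y) (fun y => ℓ y * (2 * n)) := by
    refine ⟨hℓ1.contDiffAt.mul (hx.contDiffAt_lapLeading hN2.contDiffAt),
      hℓ1.contDiffAt.mul contDiffAt_const,
      (hℓ1.mul (agreesTo_lapLeading_quadraticAt hx).sub).congr (Eventually.of_forall fun y => ?_)⟩
    simp only [hN]; ring
  have h2 : AgreesTo x 2 (fun y => ∑ l, (2 * raise G y (fun j => pd j ℓ y) l) * pd l N y)
      (fun y => ∑ l, (2 * raise G x a l) * pd l N y) := by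
    refine AgreesTo.sum _ fun l _ => ?_
    have h3 := AgreesTo.mul_of_vanishesTo (f := fun y => 2 * raise G y (fun j => pd j ℓ y) l)
      (contDiffAt_const.mul (hx.contDiffAt_raise
        (fun j => ContDiffAt.pd hℓ1.contDiffAt j) l)) (hN2.pd l)
    simpa only [hℓ, pd_linearAt] using h3
  have h4 : AgreesTo x 2 (lapLeading G fun y => ℓ y * N y) (fun y => m * ℓ y) := by
    refine (AgreesTo.of_eventuallyEq ?_ (lapLeading_mul hG hℓ1.contDiffAt hN2.contDiffAt)).trans
      ((h1.add (h2.add (AgreesTo.refl ((hx.contDiffAt_lapLeading hℓ1.contDiffAt).mul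
        hN2.contDiffAt)))).trans (AgreesTo.of_eventuallyEq (contDiffAt_const.mul hℓ1.contDiffAt)
        (Eventually.of_forall fun y => ?_)))
    · exact (h1.add (h2.add (AgreesTo.refl (k := 2) ((hx.contDiffAt_lapLeading hℓ1.contDiffAt).mul
        hN2.contDiffAt)))).left
    · simp only [mul_assoc, ← Finset.mul_sum]
      rw [sum_raise_mul_pd_quadraticAt hx, hℓ, lapLeading_linearAt, hm]
      ring
  rw [(h4.pd i).eq, pd_const_mul _ hℓ1.differentiableAt, hℓ, pd_linearAt, ha]
  field_simp

/-- Quartic polynomials realize all doubly contracted fourth derivatives. -/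
theorem exists_lapLeading_lapLeading_eq (hn : 0 < n) (hG : IsMetricNear G x) (d : ℝ) :
    ∃ p : EuclideanSpace ℝ (Fin n) → ℝ, ContDiff ℝ ∞ p ∧ VanishesTo x 4 p ∧
      lapLeading G (lapLeading G p) x = d := by
  have hx := hG.isMetricAt
  have hn' : (0 : ℝ) < n := by exact_mod_cast hn
  -- To leading order L(N²) = 2N LN + 2⟨dN, dN⟩ = (4n + 8)N, and LN = 2n at x.
  set m : ℝ := (4 * n + 8) * (2 * n) with hm
  have hm0 : m ≠ 0 := by positivity
  set N := quadraticAt (G x) x with hN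
  have hN2 : VanishesTo x 2 N := vanishesTo_quadraticAt (G x) x
  have hNN : VanishesTo x 4 fun y => N y * N y := hN2.mul hN2
  refine ⟨fun y => (d / m) * (N y * N y), contDiff_const.mul
    ((contDiff_quadraticAt (G x) x).mul (contDiff_quadraticAt (G x) x)),
    VanishesTo.contDiffAt_mul contDiffAt_const hNN, ?_⟩
  have h1 : AgreesTo x 3 (fun y => N y * lapLeading G N y) (fun y => N y * (2 * n)) := by
    refine ⟨hN2.contDiffAt.mul (hx.contDiffAt_lapLeading hN2.contDiffAt),
      hN2.contDiffAt.mul contDiffAt_const,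
      (hN2.mul (agreesTo_lapLeading_quadraticAt hx).sub).congr (Eventually.of_forall fun y => ?_)⟩
    simp only [hN]; ring
  have h2 : AgreesTo x 3 (fun y => ∑ l, (2 * raise G y (fun j => pd j N y) l) * pd l N y)
      (fun y => ∑ l, (2 * raise G x (fun j => pd j N y) l) * pd l N y) := by
    refine AgreesTo.sum _ fun l _ => ?_
    have h3 := AgreesTo.raise_const hx (α := fun y j => pd j N y) (k := 1) (fun j => hN2.pd j) l
    refine ⟨(contDiffAt_const.mul h3.left).mul (hN2.pd l).contDiffAt,
      (contDiffAt_const.mul h3.right).mul (hN2.pd l).contDiffAt,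
      ((VanishesTo.contDiffAt_mul (f := fun _ => 2) contDiffAt_const h3.sub).mul (hN2.pd l)).congr
        (Eventually.of_forall fun y => by ring)⟩
  have h3 : AgreesTo x 3 (fun y => lapLeading G N y * N y) (fun y => N y * (2 * n)) := by
    simpa only [mul_comm] using h1
  have h5 := h1.add (h2.add h3)
  have h4 : AgreesTo x 3 (lapLeading G fun y => N y * N y) (fun y => (4 * n + 8) * N y) := by
    refine (AgreesTo.of_eventuallyEq h5.left
      (lapLeading_mul hG hN2.contDiffAt hN2.contDiffAt)).trans
      (h5.trans (AgreesTo.of_eventuallyEq (contDiffAt_const.mul hN2.contDiffAt)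
        (Eventually.of_forall fun y => ?_)))
    simp only [mul_assoc, ← Finset.mul_sum]
    rw [sum_raise_mul_pd_quadraticAt hx, hN]
    simp only [pd_quadraticAt hx.symm, linearAt_quadraticAt_self]
    ring
  rw [(lapLeading_eventuallyEq (lapLeading_const_mul _ hNN.contDiffAt)).eq_of_nhds,
    (lapLeading_const_mul _ (hx.contDiffAt_lapLeading hNN.contDiffAt)).eq_of_nhds,
    (h4.lapLeading (k := 1) hx).eq, (lapLeading_const_mul _ hN2.contDiffAt).eq_of_nhds,
    (agreesTo_lapLeading_quadraticAt hx).eq]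
  rw [hm] at hm0 ⊢
  field_simp

end Polynomials

/-! ### Rescalings with arbitrary one-jet that keep P, div P and div² P at x -/

section Existence

variable {n : ℕ} {x : EuclideanSpace ℝ (Fin n)}
  {G : EuclideanSpace ℝ (Fin n) → Matrix (Fin n) (Fin n) ℝ}

theorem isFactorNear_of_contDiff {u : EuclideanSpace ℝ (Fin n) → ℝ} (hu : ContDiff ℝ ∞ u)
    (h0 : u x ≠ 0) : IsFactorNear u x := by
  filter_upwards [hu.continuous.continuousAt.eventually_ne h0] with y hy using ⟨hu.contDiffAt, hy⟩

theorem rescale_mul (u v : EuclideanSpace ℝ (Fin n) → ℝ) :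
    rescale (fun y => u y * v y) G = rescale v (rescale u G) := by
  funext y
  simp only [rescale, smul_smul, mul_pow, mul_inv]
  rw [mul_comm]

theorem pd_const_add (a : ℝ) (u : EuclideanSpace ℝ (Fin n) → ℝ) (i : Fin n) :
    pd i (fun y => a + u y) = pd i u := by
  funext y
  simp [pd, fderiv_const_add]

theorem lapLeading_const_add (a : ℝ) (u : EuclideanSpace ℝ (Fin n) → ℝ) :
    lapLeading G (fun y => a + u y) = lapLeading G u := by
  funext y
  simp only [lapLeading, pd_const_add]

/-- A rescaling with prescribed one-jet that leaves the Schouten tensor at `x` unchanged. -/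
theorem exists_rescale_schouten (hn : 2 < n) (hG : IsMetricNear G x) (ξ : Fin n → ℝ) :
    ∃ u : EuclideanSpace ℝ (Fin n) → ℝ, ContDiff ℝ ∞ u ∧ u x = 1 ∧ (∀ i, pd i u x = ξ i) ∧
      schouten (rescale u G) x = schouten G x := by
  have hx := hG.isMetricAt
  -- At x the Hessian of u is 2B − Γξ, and by `schouten_rescale` it has to equal ½|ξ|²g.
  set B : Matrix (Fin n) (Fin n) ℝ := Matrix.of fun i j => (1 / 2) *
    ((∑ m, christoffel G x m i j * ξ m) + (1 / 2) * covectorSq G x ξ * G x i j) with hB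
  have hBs : ∀ i j, B i j = B j i := fun i j => by
    simp only [hB, Matrix.of_apply]
    rw [hx.symm i j]
    simp only [hG.christoffel_symm _ i j]
  set u : EuclideanSpace ℝ (Fin n) → ℝ := fun y => 1 + (linearAt ξ x y + quadraticAt B x y) with hu
  have hl := contDiff_linearAt ξ x
  have hq := contDiff_quadraticAt B x
  have hc : ContDiff ℝ ∞ u := contDiff_const.add (hl.add hq)
  have hu1 : u x = 1 := by
    simp [hu, (vanishesTo_linearAt ξ x).eq_zero, (vanishesTo_quadraticAt B x).eq_zero]
  have hpd : ∀ j, pd j u = fun y => ξ j + linearAt (fun i => 2 * B j i) x y := fun j => by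
    funext y
    rw [hu, pd_const_add, pd_add (differentiableAt_of_contDiffAt hl.contDiffAt)
      (differentiableAt_of_contDiffAt hq.contDiffAt), pd_linearAt, pd_quadraticAt hBs]
  have hpd1 : ∀ j, pd j u x = ξ j := fun j => by
    simp only [hpd, (vanishesTo_linearAt _ x).eq_zero, add_zero]
  refine ⟨u, hc, hu1, hpd1, funext fun i => funext fun j => ?_⟩
  rw [schouten_rescale hn hG (isFactorNear_of_contDiff hc (by rw [hu1]; exact one_ne_zero)), hess]
  simp only [hpd1, hu1]
  rw [hpd, pd_const_add, pd_linearAt, hBs j i, hB, Matrix.of_apply]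
  ring

/-- A rescaling with prescribed one-jet that leaves the Schouten tensor, its divergence and its
double divergence at `x` unchanged. -/
theorem exists_rescale (hn : 2 < n) (hG : IsMetricNear G x) (ξ : Fin n → ℝ) :
    ∃ u : EuclideanSpace ℝ (Fin n) → ℝ, ContDiff ℝ ∞ u ∧ u x = 1 ∧ (∀ i, pd i u x = ξ i) ∧
      schouten (rescale u G) x = schouten G x ∧
      divSchouten (rescale u G) x = divSchouten G x ∧
      divDivSchouten (rescale u G) x = divDivSchouten G x := by
  obtain ⟨u, hu, hu1, hud, huP⟩ := exists_rescale_schouten hn hG ξ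
  have hG1 : IsMetricNear (rescale u G) x :=
    hG.rescale (isFactorNear_of_contDiff hu (by rw [hu1]; exact one_ne_zero))
  -- The factor 1 + p has trivial two-jet: it fixes P and shifts div P by d(Lp), chosen as the
  -- defect left by u. Here L belongs to the metric already rescaled by u.
  obtain ⟨p, hp, hpv, hpd⟩ := exists_pd_lapLeading_eq hG1
    fun i => divSchouten G x i - divSchouten (rescale u G) x i
  have hp1 : 1 + p x = 1 := by simp [hpv.eq_zero]
  have hpc : ContDiff ℝ ∞ fun y => 1 + p y := contDiff_const.add hp
  have hpf := isFactorNear_of_contDiff hpc (x := x) (by rw [hp1]; exact one_ne_zero)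
  have hpv' : VanishesTo x 3 fun y => (1 + p y) - 1 := by simpa using hpv
  have hG2 := hG1.rescale hpf
  have hP2 := schouten_rescale_of_vanishesTo hn hG1 hpf hpv'
  have hdiv2 : divSchouten (rescale (fun y => 1 + p y) (rescale u G)) x = divSchouten G x :=
    funext fun i => by
      rw [divSchouten_rescale_of_vanishesTo hn hG1 hpf hpv', lapLeading_const_add, hpd]
      ring
  -- As q vanishes to fourth order, Lq vanishes to second order, so P and div P stay fixed while
  -- div² P moves by LLq.
  obtain ⟨q, hq, hqv, hqd⟩ := exists_lapLeading_lapLeading_eq (by omega) hG2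
    (divDivSchouten G x - divDivSchouten (rescale (fun y => 1 + p y) (rescale u G)) x)
  have hq1 : 1 + q x = 1 := by simp [hqv.eq_zero]
  have hqc : ContDiff ℝ ∞ fun y => 1 + q y := contDiff_const.add hq
  have hqf := isFactorNear_of_contDiff hqc (x := x) (by rw [hq1]; exact one_ne_zero)
  have hqv' : VanishesTo x 3 fun y => (1 + q y) - 1 := by simpa using hqv.of_succ
  have ht : ∀ i, pd i (lapLeading (rescale (fun y => 1 + p y) (rescale u G))
      fun y => 1 + q y) x = 0 := fun i => by
    rw [lapLeading_const_add]
    exact ((VanishesTo.lapLeading (k := 2) hG2.isMetricAt hqv).pd i).eq_zero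
  refine ⟨fun y => (u y * (1 + p y)) * (1 + q y), (hu.mul hpc).mul hqc, ?_, fun i => ?_, ?_, ?_, ?_⟩
  · simp [hu1, hpv.eq_zero, hqv.eq_zero]
  · have d1 := differentiableAt_of_contDiffAt (hu.contDiffAt (x := x))
    have d2 := differentiableAt_of_contDiffAt (hpc.contDiffAt (x := x))
    have d3 := differentiableAt_of_contDiffAt (hqc.contDiffAt (x := x))
    rw [pd_mul (d1.fun_mul d2) d3, pd_mul d1 d2, pd_const_add, pd_const_add, (hpv.pd i).eq_zero,
      (hqv.pd i).eq_zero, hud, hpv.eq_zero, hqv.eq_zero]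
    ring
  · rw [rescale_mul, rescale_mul, schouten_rescale_of_vanishesTo hn hG2 hqf hqv', hP2, huP]
  · funext i
    rw [rescale_mul, rescale_mul, divSchouten_rescale_of_vanishesTo hn hG2 hqf hqv', ht, hdiv2,
      add_zero]
  · rw [rescale_mul, rescale_mul, divDivSchouten_rescale_of_vanishesTo hn hG2 hqf hqv' ht,
      lapLeading_const_add, hqd]
    ring

end Existence

/-! ### Dependence of curvature on the germ of the metric -/

section Germs

variable {n : ℕ} {x : EuclideanSpace ℝ (Fin n)}
  {G G' : EuclideanSpace ℝ (Fin n) → Matrix (Fin n) (Fin n) ℝ}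

/-- The global scale constructed later agrees with the polynomial model only near x, so every
curvature quantity has to be seen to depend on germs alone. -/
theorem christoffel_eventuallyEq (h : G =ᶠ[𝓝 x] G') : christoffel G =ᶠ[𝓝 x] christoffel G' := by
  have h1 : ∀ᶠ y in 𝓝 x, ∀ i j k, pd i (fun z => G z j k) y = pd i (fun z => G' z j k) y :=
    eventually_all.mpr fun i => eventually_all.mpr fun j => eventually_all.mpr fun k =>
      pd_eventuallyEq (h.mono fun y hy => by rw [hy]) i
  filter_upwards [h, h1] with y h2 h3
  funext k i j
  simp only [christoffel, h2, h3]

theorem schouten_eventuallyEq (h : G =ᶠ[𝓝 x] G') : schouten G =ᶠ[𝓝 x] schouten G' := by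
  have hΓ := christoffel_eventuallyEq h
  have h1 : ∀ᶠ y in 𝓝 x, ∀ l k i j,
      pd l (fun z => christoffel G z k i j) y = pd l (fun z => christoffel G' z k i j) y :=
    eventually_all.mpr fun l => eventually_all.mpr fun k => eventually_all.mpr fun i =>
      eventually_all.mpr fun j => pd_eventuallyEq (hΓ.mono fun y hy => by rw [hy]) l
  filter_upwards [h, hΓ, h1] with y h2 h3 h4
  funext i j
  simp only [schouten, scalarCurvature, ricci, h2, h3, h4]

theorem divSchouten_eventuallyEq (h : G =ᶠ[𝓝 x] G') : divSchouten G =ᶠ[𝓝 x] divSchouten G' := by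
  have hP := schouten_eventuallyEq h
  have h1 : ∀ᶠ y in 𝓝 x, ∀ k i j,
      pd k (fun z => schouten G z i j) y = pd k (fun z => schouten G' z i j) y :=
    eventually_all.mpr fun k => eventually_all.mpr fun i =>
      eventually_all.mpr fun j => pd_eventuallyEq (hP.mono fun y hy => by rw [hy]) k
  filter_upwards [h, christoffel_eventuallyEq h, hP, h1] with y h2 h3 h4 h5
  funext i
  simp only [divSchouten, divTwoTensor, h2, h3, h4, h5]

theorem divDivSchouten_congr (h : G =ᶠ[𝓝 x] G') : divDivSchouten G x = divDivSchouten G' x := by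
  have hD := divSchouten_eventuallyEq h
  have h1 : ∀ i j, pd i (fun z => divSchouten G z j) x = pd i (fun z => divSchouten G' z j) x :=
    fun i j => pd_congr (hD.mono fun y hy => by rw [hy]) i
  simp only [divDivSchouten, divCovector, h.eq_of_nhds, (christoffel_eventuallyEq h).eq_of_nhds,
    hD.eq_of_nhds, h1]

end Germs

/-! ### From the manifold to charts and back -/

section Manifold

variable {n : ℕ} {M : Type*} [TopologicalSpace M] [ChartedSpace (EuclideanSpace ℝ (Fin n)) M]
  {c : ConformalStructure n M} {g : PseudoRiemannianMetric n M}
  {e : OpenPartialHomeomorph M (EuclideanSpace ℝ (Fin n))}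

theorem mdifferentiable_of_mem_maximalAtlas (he : e ∈ IsManifold.maximalAtlas (𝓡 n) ∞ M) :
    e.MDifferentiable (𝓡 n) (𝓡 n) :=
  ⟨(contMDiffOn_of_mem_maximalAtlas he).mdifferentiableOn (by simp),
    (contMDiffOn_symm_of_mem_maximalAtlas he).mdifferentiableOn (by simp)⟩

theorem coordVector_sum (v : EuclideanSpace ℝ (Fin n)) (y : EuclideanSpace ℝ (Fin n)) :
    ∑ i, v i • coordVector e y i =
      (mfderiv (𝓡 n) (𝓡 n) e.symm y (v : EuclideanSpace ℝ (Fin n)) :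
        TangentSpace (𝓡 n) (e.symm y)) := by
  have hv : v = ∑ i, v i • EuclideanSpace.single i (1 : ℝ) := by
    ext j
    simp [Pi.single_apply]
  conv_rhs => rw [hv]
  unfold coordVector
  refine Eq.symm ((map_sum (mfderiv (𝓡 n) (𝓡 n) e.symm y) _ _).trans ?_)
  exact Finset.sum_congr rfl fun i _ => map_smul (mfderiv (𝓡 n) (𝓡 n) e.symm y) _ _

/-- A kernel vector of the matrix gives a tangent vector orthogonal to all coordinate vectors. These
span because the derivative of the inverse chart is surjective, so nondegeneracy kills the vector,
and injectivity kills its coordinates. -/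
theorem isUnit_det_coordMatrix (he : e ∈ IsManifold.maximalAtlas (𝓡 n) ∞ M)
    {y : EuclideanSpace ℝ (Fin n)} (hy : y ∈ e.target) :
    IsUnit (coordMatrix e g.form y).det := by
  have hE := (mdifferentiable_of_mem_maximalAtlas he).symm
  rw [isUnit_iff_ne_zero]
  intro h0
  obtain ⟨v, hv0, hv⟩ := Matrix.exists_mulVec_eq_zero_iff.mpr h0
  set v' : EuclideanSpace ℝ (Fin n) := WithLp.toLp 2 v with hv'
  set w : TangentSpace (𝓡 n) (e.symm y) := ∑ i, v' i • coordVector e y i with hw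
  have h1 : ∀ i, g.form (e.symm y) w (coordVector e y i) = 0 := by
    intro i
    have := congrFun hv i
    simp only [Matrix.mulVec, dotProduct, coordMatrix, Matrix.of_apply, Pi.zero_apply] at this
    rw [g.symm, hw, map_sum, ← this]
    refine Finset.sum_congr rfl fun j _ => ?_
    rw [map_smul, smul_eq_mul, mul_comm]
  have h2 : w = 0 := by
    refine g.nondegenerate _ w fun t => ?_
    obtain ⟨s, hs⟩ := hE.mfderiv_surjective hy t
    have h3 := coordVector_sum (e := e) s y
    rw [← hs]
    refine (congrArg (g.form (e.symm y) w) h3.symm).trans ?_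
    rw [map_sum]
    refine Finset.sum_eq_zero fun i _ => ?_
    rw [map_smul, h1, smul_zero]
  rw [hw, coordVector_sum] at h2
  have h3 := hE.mfderiv_injective hy (h2.trans (map_zero _).symm)
  apply hv0
  funext i
  exact congrArg (fun z : EuclideanSpace ℝ (Fin n) => z i) h3

theorem isMetricNear_coordMatrix (he : e ∈ IsManifold.maximalAtlas (𝓡 n) ∞ M)
    {y : EuclideanSpace ℝ (Fin n)} (hy : y ∈ e.target) : IsMetricNear (coordMatrix e g.form) y := by
  filter_upwards [e.open_target.mem_nhds hy] with z hz
  exact ⟨fun i j => (g.smooth e he i j).contDiffAt (e.open_target.mem_nhds hz),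
    fun i j => g.symm _ _ _, isUnit_det_coordMatrix he hz⟩

theorem Scale.isFactorNear_coord (τ : Scale c) (hg : c.Compatible g)
    (he : e ∈ IsManifold.maximalAtlas (𝓡 n) ∞ M) {y : EuclideanSpace ℝ (Fin n)}
    (hy : y ∈ e.target) : IsFactorNear (τ.coord hg e) y := by
  have h : ContMDiffOn (𝓡 n) 𝓘(ℝ, ℝ) ∞ (fun y => τ.coord hg e y) e.target :=
    (τ.smooth g hg).comp_contMDiffOn (contMDiffOn_symm_of_mem_maximalAtlas he)
  filter_upwards [e.open_target.mem_nhds hy] with z hz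
  exact ⟨h.contDiffOn.contDiffAt (e.open_target.mem_nhds hz), τ.ne_zero _ _⟩

theorem Scale.coordMatrix_metric [IsManifold (𝓡 n) ∞ M] (τ : Scale c) (hg : c.Compatible g) :
    coordMatrix e τ.metric.form = rescale (τ.coord hg e) (coordMatrix e g.form) := by
  funext y
  ext i j
  have h : τ.metric.form (e.symm y) = ((τ.coord hg e y) ^ 2)⁻¹ • g.form (e.symm y) :=
    τ.form_eq (e.symm y) ⟨g.form (e.symm y), hg _⟩
  simp only [coordMatrix, Matrix.of_apply, rescale, Matrix.smul_apply, h, LinearMap.smul_apply]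

/-- Homogeneity: the fibre is a single ray, so the value at one of its points determines all others.
-/
theorem Density.eqAt_iff {w : ℤ} (σ₁ σ₂ : Density c w) (hg : c.Compatible g) (x : M) :
    σ₁.EqAt σ₂ x ↔ σ₁.value hg x = σ₂.value hg x := by
  refine ⟨fun h => h _, fun h b => ?_⟩
  obtain ⟨g', hg'⟩ := c.exists_metric
  obtain ⟨s, hs, hbs⟩ : ∃ s : ℝ, 0 < s ∧ (b : TangentForm n x) = s ^ 2 • g'.form x :=
    (Set.ext_iff.mp (hg' x) _).mp b.2
  obtain ⟨t, ht, hdt⟩ : ∃ t : ℝ, 0 < t ∧ g.form x = t ^ 2 • g'.form x :=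
    (Set.ext_iff.mp (hg' x) _).mp (hg x)
  have hrel : (b : TangentForm n x) = (s / t) ^ 2 • g.form x := by
    rw [hbs, hdt, smul_smul]
    congr 1
    field_simp
  rw [σ₁.homogeneous x ⟨_, hg x⟩ b (s / t) (div_pos hs ht) hrel,
    σ₂.homogeneous x ⟨_, hg x⟩ b (s / t) (div_pos hs ht) hrel]
  exact congrArg _ h

/-- The product of a scale with a smooth function without zeros. -/
def Scale.mulFun (τ : Scale c) (φ : M → ℝ) (hφ : ContMDiff (𝓡 n) 𝓘(ℝ, ℝ) ∞ φ)
    (h0 : ∀ x, φ x ≠ 0) : Scale c where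
  toFun x b := τ.toFun x b * φ x
  homogeneous x b b' s hs h := by rw [τ.homogeneous x b b' s hs h]; ring
  smooth g hg := (τ.smooth g hg).mul hφ
  ne_zero x b := mul_ne_zero (τ.ne_zero x b) (h0 x)

/-- A smooth function in a chart that is `1` at a point extends, near the point, to a smooth
function without zeros on the manifold. -/
theorem exists_extension [IsManifold (𝓡 n) ∞ M] [T2Space M]
    (he : e ∈ IsManifold.maximalAtlas (𝓡 n) ∞ M) {x : M}
    (hx : x ∈ e.source) {u : EuclideanSpace ℝ (Fin n) → ℝ} (hu : ContDiff ℝ ∞ u)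
    (h1 : u (e x) = 1) :
    ∃ φ : M → ℝ, ContMDiff (𝓡 n) 𝓘(ℝ, ℝ) ∞ φ ∧ (∀ p, φ p ≠ 0) ∧
      (fun y => φ (e.symm y)) =ᶠ[𝓝 (e x)] u := by
  have hU : {p | p ∈ e.source ∧ 0 < u (e p)} ∈ 𝓝 x := by
    have h2 : ∀ᶠ p in 𝓝 x, 0 < u (e p) :=
      (hu.continuous.continuousAt.comp (e.continuousAt hx)).eventually
        (lt_mem_nhds (by simp [h1]))
    filter_upwards [e.open_source.mem_nhds hx, h2] with p hp h3 using ⟨hp, h3⟩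
  obtain ⟨f, -, hf⟩ := (SmoothBumpFunction.nhds_basis_tsupport (I := 𝓡 n) x).mem_iff.mp hU
  have hsupp : tsupport (fun p => f p * (u (e p) - 1)) ⊆ tsupport f := tsupport_mul_subset_left
  -- A convex combination of 1 and u with weight f. The support of f lies where u is positive, so
  -- there are no zeros.
  refine ⟨fun p => 1 + f p * (u (e p) - 1), ?_, fun p => ?_, ?_⟩
  · refine contMDiff_const.add (contMDiff_of_tsupport fun p hp => ?_)
    have hp' := hf (hsupp hp)
    have h3 : ContMDiffAt (𝓡 n) 𝓘(ℝ, ℝ) ∞ (fun p => u (e p)) p :=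
      (hu.contMDiff.contMDiffAt).comp p
        ((contMDiffOn_of_mem_maximalAtlas he).contMDiffAt (e.open_source.mem_nhds hp'.1))
    exact f.contMDiffAt.mul (h3.sub contMDiffAt_const)
  · by_cases hp : p ∈ tsupport f
    · have h3 := (hf hp).2
      have h4 := f.nonneg (x := p)
      have h5 := f.le_one (x := p)
      have : 0 < 1 + f p * (u (e p) - 1) := by
        rcases h5.eq_or_lt with h6 | h6
        · rw [h6]; linarith
        · nlinarith [mul_nonneg h4 h3.le]
      exact this.ne'
    · simp [image_eq_zero_of_notMem_tsupport hp]
  · have h3 : Tendsto e.symm (𝓝 (e x)) (𝓝 x) := by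
      have := e.continuousAt_symm (e.map_source hx)
      rwa [ContinuousAt, e.left_inv hx] at this
    filter_upwards [h3.eventually f.eventuallyEq_one, e.open_target.mem_nhds (e.map_source hx)]
      with y h4 hy
    simp [h4, e.right_inv hy]

end Manifold

/-! ### Null tractors W with k(X, W) = 1 -/

section NullTractors

variable {n : ℕ} {x : EuclideanSpace ℝ (Fin n)}
  {G : EuclideanSpace ℝ (Fin n) → Matrix (Fin n) (Fin n) ℝ}

/-- The null tractor `Y - g⁻¹(Υ, Z) - g⁻¹(Υ, Υ) X / 2`. -/
def translateY (G : EuclideanSpace ℝ (Fin n) → Matrix (Fin n) (Fin n) ℝ)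
    (y : EuclideanSpace ℝ (Fin n)) (Υ : Fin n → ℝ) : Tractor n :=
  (- (1 / 2) * covectorSq G y Υ, fun i => - raise G y Υ i, 1)

theorem IsMetricAt.translateY_injective (hG : IsMetricAt G x) :
    Function.Injective (translateY G x) := by
  intro Υ Υ' h
  have h1 : ∀ i, raise G x Υ i = raise G x Υ' i := fun i =>
    neg_injective (congrFun (Prod.ext_iff.mp (Prod.ext_iff.mp h).2).1 i)
  funext i
  rw [← hG.sum_mul_raise Υ i, ← hG.sum_mul_raise Υ' i]
  simp only [h1]

theorem IsMetricAt.sum_raise_raise (hG : IsMetricAt G x) (Υ Υ' : Fin n → ℝ) :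
    ∑ i, ∑ j, G x i j * raise G x Υ i * raise G x Υ' j = ∑ i, raise G x Υ i * Υ' i := by
  refine Finset.sum_congr rfl fun i _ => ?_
  rw [← hG.sum_mul_raise Υ' i, Finset.mul_sum]
  exact Finset.sum_congr rfl fun j _ => by ring

/-- The condition k(X, W) = 1 makes the Y coefficient 1, the Z coefficients are free, and nullity
fixes the X coefficient. Lowering the Z coefficients and changing the sign recovers Υ. -/
theorem IsMetricAt.translateY_bijOn (hG : IsMetricAt G x) :
    Set.BijOn (translateY G x) Set.univ (nullTractors G x) := by
  refine ⟨fun Υ _ => ⟨?_, ?_⟩, hG.translateY_injective.injOn, ?_⟩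
  · have := hG.sum_raise_raise Υ Υ
    simp only [tractorMetric, translateY, mul_neg, neg_mul, neg_neg, this, covectorSq]
    ring
  · simp [tractorMetric, translateY, tractorX]
  · rintro ⟨a, μ, r⟩ ⟨h1, h2⟩
    simp only [tractorMetric, tractorX] at h1 h2
    have hr : r = 1 := by simpa using h2
    subst hr
    have hraise : ∀ i, raise G x (fun j => - ∑ k, G x j k * μ k) i = - μ i := fun i => by
      simp only [raise, mul_neg, Finset.sum_neg_distrib, hG.sum_inv_mul_lower]
    refine ⟨fun j => - ∑ k, G x j k * μ k, Set.mem_univ _, ?_⟩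
    refine Prod.ext ?_ (Prod.ext (funext fun i => ?_) rfl)
    · simp only [translateY, covectorSq, hraise, neg_mul_neg]
      have : ∑ i, μ i * ∑ k, G x i k * μ k = ∑ i, ∑ j, G x i j * μ i * μ j := by
        refine Finset.sum_congr rfl fun i _ => ?_
        rw [Finset.mul_sum]
        exact Finset.sum_congr rfl fun j _ => by ring
      rw [this]
      linarith
    · simp only [translateY, hraise, neg_neg]

/-- Polarization of g⁻¹: the cross term g⁻¹(Υ, Υ') comes from the X components of the tractors Z_τ.
Hence shifting Y_τ adds covectors. -/
theorem IsMetricAt.translateY_add (hG : IsMetricAt G x) (Υ Υ' : Fin n → ℝ) :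
    translateY G x (fun i => Υ i + Υ' i) = translateY G x Υ
      - ∑ i, raise G x Υ' i • ((Υ i, Pi.single i 1, 0) : Tractor n)
      - ((1 / 2) * covectorSq G x Υ') • tractorX n := by
  have hadd : ∀ i, raise G x (fun i => Υ i + Υ' i) i = raise G x Υ i + raise G x Υ' i := fun i => by
    simp only [raise, mul_add, Finset.sum_add_distrib]
  have hcomm : ∑ i, raise G x Υ i * Υ' i = ∑ i, raise G x Υ' i * Υ i := by
    simp only [raise, Finset.sum_mul]
    rw [Finset.sum_comm]
    exact Finset.sum_congr rfl fun i _ => Finset.sum_congr rfl fun j _ => by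
      rw [hG.inv_symm j i]; ring
  refine Prod.ext ?_ (Prod.ext (funext fun i => ?_) ?_)
  · simp only [translateY, tractorX, Prod.fst_sub, Prod.fst_sum, Prod.smul_fst, smul_eq_mul,
      covectorSq, hadd, mul_add, add_mul, Finset.sum_add_distrib, hcomm]
    ring
  · simp only [translateY, tractorX, Prod.fst_sub, Prod.snd_sub, Prod.fst_sum, Prod.snd_sum,
      Prod.smul_fst, Prod.smul_snd, hadd, Pi.sub_apply, Finset.sum_apply, Pi.smul_apply,
      Pi.single_apply, Pi.zero_apply, smul_eq_mul]
    simp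
    ring
  · simp [translateY, tractorX, Prod.snd_sum]

end NullTractors

/-! ### Osculation and curvature conditions for two scales -/

section Scales

variable {n : ℕ} {M : Type*} [TopologicalSpace M] [ChartedSpace (EuclideanSpace ℝ (Fin n)) M]
  {c : ConformalStructure n M} {g : PseudoRiemannianMetric n M} {hg : c.Compatible g}
  {e : OpenPartialHomeomorph M (EuclideanSpace ℝ (Fin n))} {x : M} {τ τ₁ τ₂ : Scale c}

theorem Scale.tractorY_eq (τ : Scale c) (hg : c.Compatible g)
    (e : OpenPartialHomeomorph M (EuclideanSpace ℝ (Fin n))) (y : EuclideanSpace ℝ (Fin n)) :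
    τ.tractorY hg e y = translateY (coordMatrix e g.form) y (τ.upsilon hg e y) := rfl

theorem Scale.shiftedY_eq (he : e ∈ IsManifold.maximalAtlas (𝓡 n) ∞ M)
    {y : EuclideanSpace ℝ (Fin n)} (hy : y ∈ e.target) (Υ : Fin n → ℝ) :
    τ.shiftedY hg e y Υ =
      translateY (coordMatrix e g.form) y (fun i => τ.upsilon hg e y i + Υ i) :=
  ((isMetricNear_coordMatrix he hy).isMetricAt.translateY_add _ _).symm

theorem Scale.coord_ne_zero (τ : Scale c) (hg : c.Compatible g)
    (e : OpenPartialHomeomorph M (EuclideanSpace ℝ (Fin n))) (y : EuclideanSpace ℝ (Fin n)) :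
    τ.coord hg e y ≠ 0 := τ.ne_zero _ _

theorem Scale.eqAt_iff_coord (hx : x ∈ e.source) :
    τ₁.EqAt τ₂.toDensity x ↔ τ₁.coord hg e (e x) = τ₂.coord hg e (e x) := by
  rw [Density.eqAt_iff _ _ hg, Density.coord, Density.coord, e.left_inv hx]

theorem Scale.upsilon_eq_of_coord {y : EuclideanSpace ℝ (Fin n)}
    (h0 : τ₁.coord hg e y = τ₂.coord hg e y)
    (h1 : ∀ i, pd i (τ₁.coord hg e) y = pd i (τ₂.coord hg e) y) :
    τ₁.upsilon hg e y = τ₂.upsilon hg e y := by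
  funext i
  simp only [Scale.upsilon, h0, h1]

theorem Scale.D_sub (he : e ∈ IsManifold.maximalAtlas (𝓡 n) ∞ M)
    {y : EuclideanSpace ℝ (Fin n)} (hy : y ∈ e.target) :
    tractorD (coordMatrix e g.form) (densityConnection n) 1
      (fun z => τ₂.coord hg e z - τ₁.coord hg e z) y = τ₂.D hg e y - τ₁.D hg e y :=
  tractorD_sub isRegularConnection_density 1 (τ₂.isFactorNear_coord hg he hy).contDiffAt
    (τ₁.isFactorNear_coord hg he hy).contDiffAt

theorem Scale.contDiffAt_D (τ : Scale c) (hg : c.Compatible g)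
    (he : e ∈ IsManifold.maximalAtlas (𝓡 n) ∞ M)
    {y : EuclideanSpace ℝ (Fin n)} (hy : y ∈ e.target) : ContDiffAt ℝ ∞ (τ.D hg e) y :=
  (isMetricNear_coordMatrix he hy).isMetricAt.contDiffAt_tractorD
    (τ.isFactorNear_coord hg he hy).contDiffAt

theorem Scale.DD_sub (he : e ∈ IsManifold.maximalAtlas (𝓡 n) ∞ M)
    {y : EuclideanSpace ℝ (Fin n)} (hy : y ∈ e.target) :
    tractorD (coordMatrix e g.form) (tractorConnection (coordMatrix e g.form)) 0
      (tractorD (coordMatrix e g.form) (densityConnection n) 1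
        fun z => τ₂.coord hg e z - τ₁.coord hg e z) y = τ₂.DD hg e y - τ₁.DD hg e y := by
  have h1 : tractorD (coordMatrix e g.form) (densityConnection n) 1
      (fun z => τ₂.coord hg e z - τ₁.coord hg e z) =ᶠ[𝓝 y] fun z => τ₂.D hg e z - τ₁.D hg e z := by
    filter_upwards [e.open_target.mem_nhds hy] with z hz using Scale.D_sub he hz
  rw [tractorD_congr 0 h1, tractorD_sub
    (isMetricNear_coordMatrix he hy).isMetricAt.isRegularConnection 0
    (τ₂.contDiffAt_D hg he hy) (τ₁.contDiffAt_D hg he hy)]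
  -- The weight 1 − 1 in `Density.DD` reduces definitionally to 0.
  rfl

/-- Osculation of two scales in terms of the difference of their coordinate representatives. -/
theorem Scale.osculate_iff (hn : 2 < n) (he : e ∈ IsManifold.maximalAtlas (𝓡 n) ∞ M)
    (hx : x ∈ e.source) :
    Density.Osculate hg e τ₁.toDensity τ₂.toDensity x ↔
      OsculatesZero (coordMatrix e g.form) (fun z => τ₂.coord hg e z - τ₁.coord hg e z) (e x) := by
  have hy := e.map_source hx
  rw [← tractorD_eq_zero_iff hn (isMetricNear_coordMatrix he hy).isMetricAt
    ((τ₂.isFactorNear_coord hg he hy).contDiffAt.sub (τ₁.isFactorNear_coord hg he hy).contDiffAt),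
    Scale.D_sub he hy, Scale.DD_sub he hy, Density.Osculate, Scale.eqAt_iff_coord (hg := hg) hx,
    sub_eq_zero, sub_eq_zero, sub_eq_zero, eq_comm, @eq_comm _ (τ₁.D hg e (e x)),
    @eq_comm _ (τ₁.DD hg e (e x))]

theorem Scale.tractorY_eq_of_D_eq (hn : 0 < n) (he : e ∈ IsManifold.maximalAtlas (𝓡 n) ∞ M)
    {y : EuclideanSpace ℝ (Fin n)} (hy : y ∈ e.target) (h : τ₁.D hg e y = τ₂.D hg e y) :
    τ₁.tractorY hg e y = τ₂.tractorY hg e y := by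
  have h1 := Scale.D_sub (τ₁ := τ₁) (τ₂ := τ₂) (hg := hg) he hy
  rw [h, sub_self] at h1
  obtain ⟨h2, h3⟩ := tractorD_density_eq_zero hn (isMetricNear_coordMatrix he hy).isMetricAt h1
  have h4 : ∀ i, pd i (τ₁.coord hg e) y = pd i (τ₂.coord hg e) y := fun i => by
    have := h3 i
    rw [pd_sub (differentiableAt_of_contDiffAt (τ₂.isFactorNear_coord hg he hy).contDiffAt)
      (differentiableAt_of_contDiffAt (τ₁.isFactorNear_coord hg he hy).contDiffAt)] at this
    linarith
  rw [Scale.tractorY_eq, Scale.tractorY_eq,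
    Scale.upsilon_eq_of_coord (sub_eq_zero.mp h2).symm h4]

variable [IsManifold (𝓡 n) ∞ M]

/-- Both sides force the one-jets of f₁ and f₂ to agree at x. With this, `osculatesZero_sub_one_iff`
applies to u = f₂/f₁ over the metric of τ₁. -/
theorem Scale.curvatureAgree_and_tractorY_iff (hn : 2 < n)
    (he : e ∈ IsManifold.maximalAtlas (𝓡 n) ∞ M) (hx : x ∈ e.source) :
    CurvatureAgree e τ₁ τ₂ x ∧ τ₁.tractorY hg e (e x) = τ₂.tractorY hg e (e x) ↔
      OsculatesZero (coordMatrix e g.form) (fun z => τ₂.coord hg e z - τ₁.coord hg e z) (e x) := by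
  have hy := e.map_source hx
  have hG : IsMetricNear (coordMatrix e g.form) (e x) := isMetricNear_coordMatrix he hy
  have hf₁ := τ₁.isFactorNear_coord hg he hy
  have hf₂ := τ₂.isFactorNear_coord hg he hy
  have hd₁ := differentiableAt_of_contDiffAt hf₁.contDiffAt
  have hd₂ := differentiableAt_of_contDiffAt hf₂.contDiffAt
  have h0 := τ₁.coord_ne_zero hg e
  set f₁ := τ₁.coord hg e with hf₁def
  set f₂ := τ₂.coord hg e with hf₂def
  set u : EuclideanSpace ℝ (Fin n) → ℝ := fun z => (f₁ z)⁻¹ * f₂ z with hu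
  have huf : IsFactorNear u (e x) := by
    filter_upwards [hf₁, hf₂] with z h1 h2
    exact ⟨(h1.1.inv h1.2).mul h2.1, mul_ne_zero (inv_ne_zero h1.2) h2.2⟩
  have hGu : rescale u (rescale f₁ (coordMatrix e g.form)) = rescale f₂ (coordMatrix e g.form) := by
    rw [← rescale_mul]
    congr 1
    funext z
    simp only [hu, mul_inv_cancel_left₀ (h0 z)]
  have hG₁ := hG.rescale hf₁
  -- Since f₂ − f₁ = f₁(u − 1), this is invariance under a change of metric and under multiplication
  -- by f₁ or its inverse.
  have hosc : OsculatesZero (rescale f₁ (coordMatrix e g.form)) (fun z => u z - 1) (e x) ↔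
      OsculatesZero (coordMatrix e g.form) (fun z => f₂ z - f₁ z) (e x) := by
    rw [osculatesZero_rescale_iff hG hf₁]
    constructor
    · intro h
      refine (h.mul hG hf₁.contDiffAt).congr (Eventually.of_forall fun z => ?_)
      simp only [hu, mul_sub, mul_inv_cancel_left₀ (h0 z), mul_one]
    · intro h
      refine (h.mul hG (hf₁.contDiffAt.inv hf₁.ne_zero)).congr (Eventually.of_forall fun z => ?_)
      simp only [hu, mul_sub, Pi.inv_apply, inv_mul_cancel₀ (h0 z)]
  have hpdu : ∀ i, pd i u (e x) =
      (f₁ (e x) ^ 2)⁻¹ * (f₁ (e x) * pd i f₂ (e x) - f₂ (e x) * pd i f₁ (e x)) := fun i => by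
    rw [hu, pd_mul (hd₁.fun_inv (h0 _)) hd₂, pd_inv hd₁ (h0 _)]
    have := h0 (e x)
    field_simp
    ring
  have hequiv (h1 : f₁ (e x) = f₂ (e x)) (h2 : ∀ i, pd i f₁ (e x) = pd i f₂ (e x)) :=
    osculatesZero_sub_one_iff hn hG₁ huf (by rw [hu]; simp only [← h1, inv_mul_cancel₀ (h0 _)])
      fun i => by rw [hpdu, h1, h2]; ring
  rw [hGu] at hequiv
  constructor
  · rintro ⟨⟨hs, hP, hdiv, hdd⟩, hY⟩
    have h1 : f₁ (e x) = f₂ (e x) := (Scale.eqAt_iff_coord hx).mp hs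
    -- The Y tractor determines Υ = −f⁻¹df, and with equal values f₁ = f₂ this gives df₁ = df₂.
    have hΥ : τ₁.upsilon hg e (e x) = τ₂.upsilon hg e (e x) :=
      hG.isMetricAt.translateY_injective hY
    have h2 : ∀ i, pd i f₁ (e x) = pd i f₂ (e x) := fun i => by
      have := congrFun hΥ i
      simp only [Scale.upsilon, ← hf₁def, ← hf₂def, ← h1] at this
      exact mul_left_cancel₀ (neg_ne_zero.mpr (inv_ne_zero (h0 (e x)))) this
    rw [τ₁.coordMatrix_metric hg, τ₂.coordMatrix_metric hg] at hP hdiv hdd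
    exact hosc.mp ((hequiv h1 h2).mpr ⟨hP.symm, hdiv.symm, hdd.symm⟩)
  · intro h
    have h1 : f₁ (e x) = f₂ (e x) := (sub_eq_zero.mp h.vanishesTo.eq_zero).symm
    have h2 : ∀ i, pd i f₁ (e x) = pd i f₂ (e x) := fun i => by
      have := (h.vanishesTo.pd i).eq_zero
      rw [pd_sub hd₂ hd₁] at this
      linarith
    obtain ⟨hP, hdiv, hdd⟩ := (hequiv h1 h2).mp (hosc.mpr h)
    refine ⟨⟨(Scale.eqAt_iff_coord hx).mpr h1, ?_, ?_, ?_⟩, ?_⟩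
    · rw [τ₁.coordMatrix_metric hg, τ₂.coordMatrix_metric hg]; exact hP.symm
    · rw [τ₁.coordMatrix_metric hg, τ₂.coordMatrix_metric hg]; exact hdiv.symm
    · rw [τ₁.coordMatrix_metric hg, τ₂.coordMatrix_metric hg]; exact hdd.symm
    · rw [Scale.tractorY_eq, Scale.tractorY_eq, Scale.upsilon_eq_of_coord h1 h2]

/-- The conditions on the curvature leave the covector `Υ` of a scale arbitrary. -/
theorem Scale.exists_curvatureAgree [T2Space M] (hn : 2 < n)
    (he : e ∈ IsManifold.maximalAtlas (𝓡 n) ∞ M) (hx : x ∈ e.source) (hg : c.Compatible g)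
    (τ₁ : Scale c) (Υ : Fin n → ℝ) :
    ∃ τ₂ : Scale c, CurvatureAgree e τ₁ τ₂ x ∧ τ₂.upsilon hg e (e x) = Υ := by
  have hy := e.map_source hx
  have hG : IsMetricNear (coordMatrix e g.form) (e x) := isMetricNear_coordMatrix he hy
  have hf₁ := τ₁.isFactorNear_coord hg he hy
  have hd₁ := differentiableAt_of_contDiffAt hf₁.contDiffAt
  have h0 := τ₁.coord_ne_zero hg e (e x)
  -- For the product f₁u with u = 1 at x, the covector is Υ₁ − du; hence the prescribed differential
  -- Υ₁ − Υ.
  obtain ⟨u, hu, hu1, hud, hP, hdiv, hdd⟩ := exists_rescale hn (hG.rescale hf₁)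
    fun i => τ₁.upsilon hg e (e x) i - Υ i
  obtain ⟨φ, hφ, hφ0, hφu⟩ := exists_extension he hx hu hu1
  have hcoord : (τ₁.mulFun φ hφ hφ0).coord hg e =ᶠ[𝓝 (e x)] fun z => τ₁.coord hg e z * u z := by
    filter_upwards [hφu] with z hz
    change τ₁.coord hg e z * φ (e.symm z) = _
    rw [hz]
  have hmetric : coordMatrix e (τ₁.mulFun φ hφ hφ0).metric.form =ᶠ[𝓝 (e x)]
      rescale u (rescale (τ₁.coord hg e) (coordMatrix e g.form)) := by
    rw [Scale.coordMatrix_metric _ hg, ← rescale_mul]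
    filter_upwards [hcoord] with z hz
    simp only [rescale, hz]
  refine ⟨τ₁.mulFun φ hφ hφ0, ⟨?_, ?_, ?_, ?_⟩, funext fun i => ?_⟩
  · rw [Scale.eqAt_iff_coord (hg := hg) hx, hcoord.eq_of_nhds, hu1, mul_one]
  · rw [(schouten_eventuallyEq hmetric).eq_of_nhds, hP, τ₁.coordMatrix_metric hg]
  · rw [(divSchouten_eventuallyEq hmetric).eq_of_nhds, hdiv, τ₁.coordMatrix_metric hg]
  · rw [divDivSchouten_congr hmetric, hdd, τ₁.coordMatrix_metric hg]
  · rw [Scale.upsilon, hcoord.eq_of_nhds, pd_congr hcoord,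
      pd_mul hd₁ (differentiableAt_of_contDiffAt hu.contDiffAt), hud, hu1, Scale.upsilon]
    field_simp
    ring

end Scales

end ConformalOsculation

end

/-! ### The main theorem -/

theorem mainTheorem6 {n : ℕ} (hn : 2 < n) {M : Type*} [TopologicalSpace M] [T2Space M]
    [ChartedSpace (EuclideanSpace ℝ (Fin n)) M] [IsManifold (𝓡 n) ∞ M]
    (c : ConformalOsculation.ConformalStructure n M)
    (g : ConformalOsculation.PseudoRiemannianMetric n M) (hg : c.Compatible g)
    (e : OpenPartialHomeomorph M (EuclideanSpace ℝ (Fin n)))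
    (he : e ∈ IsManifold.maximalAtlas (𝓡 n) ∞ M) (x : M) (hx : x ∈ e.source) :
    -- the four conditions are necessary for osculation
    (∀ τ₁ τ₂ : ConformalOsculation.Scale c,
      ConformalOsculation.Density.Osculate hg e τ₁.toDensity τ₂.toDensity x →
        ConformalOsculation.CurvatureAgree e τ₁ τ₂ x) ∧
    -- they are never sufficient
    (∀ τ₁ : ConformalOsculation.Scale c, ∃ τ₂ : ConformalOsculation.Scale c,
      ConformalOsculation.CurvatureAgree e τ₁ τ₂ x ∧
        ¬ ConformalOsculation.Density.Osculate hg e τ₁.toDensity τ₂.toDensity x) ∧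
    -- the equation between the images under `D` contains the equation between the `Y` tractors
    (∀ τ₁ τ₂ : ConformalOsculation.Scale c,
      τ₁.toDensity.D hg e (e x) = τ₂.toDensity.D hg e (e x) →
        τ₁.tractorY hg e (e x) = τ₂.tractorY hg e (e x)) ∧
    -- this is exactly what the four conditions leave out
    (∀ τ₁ τ₂ : ConformalOsculation.Scale c,
      ConformalOsculation.Density.Osculate hg e τ₁.toDensity τ₂.toDensity x ↔
        ConformalOsculation.CurvatureAgree e τ₁ τ₂ x ∧
          τ₁.tractorY hg e (e x) = τ₂.tractorY hg e (e x)) ∧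
    -- under the four conditions the `Y` tractor is arbitrary, with `n` affine degrees of freedom
    (∀ τ₁ : ConformalOsculation.Scale c,
      {W | ∃ τ₂ : ConformalOsculation.Scale c,
          ConformalOsculation.CurvatureAgree e τ₁ τ₂ x ∧ τ₂.tractorY hg e (e x) = W} =
        ConformalOsculation.nullTractors (ConformalOsculation.coordMatrix e g.form) (e x) ∧
      Set.BijOn (τ₁.shiftedY hg e (e x)) Set.univ
        (ConformalOsculation.nullTractors (ConformalOsculation.coordMatrix e g.form) (e x))) := by
  have hy := e.map_source hx
  have hG := (ConformalOsculation.isMetricNear_coordMatrix (g := g) he hy).isMetricAt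
  have hiff : ∀ τ₁ τ₂ : ConformalOsculation.Scale c,
      ConformalOsculation.Density.Osculate hg e τ₁.toDensity τ₂.toDensity x ↔
        ConformalOsculation.CurvatureAgree e τ₁ τ₂ x ∧
          τ₁.tractorY hg e (e x) = τ₂.tractorY hg e (e x) := fun τ₁ τ₂ =>
    (ConformalOsculation.Scale.osculate_iff hn he hx).trans
      (ConformalOsculation.Scale.curvatureAgree_and_tractorY_iff hn he hx).symm
  refine ⟨fun τ₁ τ₂ h => ((hiff τ₁ τ₂).mp h).1, fun τ₁ => ?_, fun τ₁ τ₂ h =>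
    ConformalOsculation.Scale.tractorY_eq_of_D_eq (by omega) he hy h, hiff, fun τ₁ => ⟨?_, ?_⟩⟩
  -- Any covector other than Υ₁ gives a counterexample to sufficiency; here every component is
  -- raised by 1.
  · obtain ⟨τ₂, h1, h2⟩ := ConformalOsculation.Scale.exists_curvatureAgree hn he hx hg τ₁
      fun i => τ₁.upsilon hg e (e x) i + 1
    refine ⟨τ₂, h1, fun h => ?_⟩
    have h3 := congrFun (hG.translateY_injective ((hiff τ₁ τ₂).mp h).2) ⟨0, by omega⟩
    rw [h2] at h3
    linarith
  · ext W
    constructor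
    · rintro ⟨τ₂, -, rfl⟩
      exact hG.translateY_bijOn.mapsTo (Set.mem_univ _)
    · intro hW
      obtain ⟨Υ, -, rfl⟩ := hG.translateY_bijOn.surjOn hW
      obtain ⟨τ₂, h1, h2⟩ := ConformalOsculation.Scale.exists_curvatureAgree hn he hx hg τ₁ Υ
      exact ⟨τ₂, h1, by rw [ConformalOsculation.Scale.tractorY_eq, h2]⟩
  -- The shifted tractor is the standard parametrization after translation by Υ₁, which is bijective
  -- on covectors.
  · have h : τ₁.shiftedY hg e (e x) =
        ConformalOsculation.translateY (ConformalOsculation.coordMatrix e g.form) (e x) ∘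
          Equiv.addLeft (τ₁.upsilon hg e (e x)) :=
      funext fun Υ => ConformalOsculation.Scale.shiftedY_eq he hy Υ
    rw [h]
    exact hG.translateY_bijOn.comp
      (Set.bijOn_univ.mpr (Equiv.addLeft (τ₁.upsilon hg e (e x))).bijective)
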